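/- **Conventions.** Let $A$ be a unital $*$-algebra over $\mathbb C$. A $*$-differential calculus on $A$ is an $A$-bimodule $\Omega^1$ with a linear map $d:A\to\Omega^1$ such that $d(ab)=(da)b+a\,db$ and $\Omega^1=\mathrm{span}\{a\,db\}$, and with an antilinear involution $*$ such that $(a\omega b)^*=b^*\omega^*a^*$ and $d(a^*)=(da)^*$. It is *pivotal* if there is an $A$-bimodule $\mathfrak X$ that is both a left and a right dual of $\Omega^1$: there are bimodule maps $\mathrm{ev}^L:\mathfrak X\otimes_A\Omega^1\to A$, $\mathrm{ev}^R:\Omega^1\otimes_A\mathfrak X\to A$ and elements $\mathrm{coev}^L(1)=\omega_i\otimes x_i\in\Omega^1\otimes_A\mathfrak X$, $\mathrm{coev}^R(1)=y_j\otimes\eta_j\in\mathfrak X\otimes_A\Omega^1$ (finite sums understood) with $$\omega=\omega_i\,\mathrm{ev}^L(x_i,\omega),\quad x=\mathrm{ev}^L(x,\omega_i)x_i,\quad \omega=\mathrm{ev}^R(\omega,y_j)\eta_j,\quad x=y_j\,\mathrm{ev}^R(\eta_j,x)$$ for all $\omega\in\Omega^1$, $x\in\mathfrak X$ (so $\Omega^1$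 is finitely generated projective on both sides). Define $\circledast:\mathfrak X\to\mathfrak X$ by $\mathrm{ev}^R(\omega,x^\circledast)=\mathrm{ev}^L(x,\omega^*)^*$; it is bijective. The pivotal structure is *compatible with $*$* if $\circledast=\circledast^{-1}$ on $\mathfrak X$. **Bialgebroids.** A left $A$-bialgebroid $\mathcal L$ is an algebra with an algebra map $s_L$ and an anti-algebra map $t_L$ from $A$ with commuting images, and an $A$-coring $(\Delta_L,\varepsilon_L)$ for the bimodule structure $a.X.b=s_L(a)t_L(b)X$, $\Delta_L(X)=X_{(1)}\otimes X_{(2)}$, such that $X_{(1)}t_L(a)\otimes X_{(2)}=X_{(1)}\otimes X_{(2)}s_L(a)$, $\Delta_L$ is multiplicative and unital, $\varepsilon_L(1)=1$ and $\varepsilon_L(XY)=\varepsilon_L(Xs_L(\varepsilon_L(Y)))=\varepsilon_L(Xt_L(\varepsilon_L(Y)))$. A right $A$-bialgebroid $\mathcal R$ is defined in the same way with $a.X.b=Xt_R(a)s_R(b)$, $s_R(a)X_{[1]}\otimes X_{[2]}=X_{[1]}\otimes t_R(a)X_{[2]}$ and $\varepsilon_R(XY)=\varepsilon_R(s_R(\varepsilon_R(X))Y)=\varepsilon_R(t_R(\varepsilon_R(X))Y)$.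 $\mathcal L$ is *left Hopf* if $X\otimes Y\mapsto X_{(1)}\otimes X_{(2)}Y$ is a bijection to $\mathcal L\otimes_A\mathcal L$ from $\mathcal L\otimes\mathcal L$ modulo $Xt_L(a)\otimes Y=X\otimes t_L(a)Y$, and *anti-left Hopf* if $X\otimes Y\mapsto Y_{(1)}X\otimes Y_{(2)}$ is a bijection to $\mathcal L\otimes_A\mathcal L$ from $\mathcal L\otimes\mathcal L$ modulo $s_L(a)X\otimes Y=X\otimes Ys_L(a)$. $\mathcal R$ is *right Hopf* (*anti-right Hopf*) if $X\otimes Y\mapsto XY_{[1]}\otimes Y_{[2]}$ (resp. $X\otimes Y\mapsto X_{[1]}\otimes YX_{[2]}$) is a bijection to $\mathcal R\otimes_A\mathcal R$ from $\mathcal R\otimes\mathcal R$ modulo the same relations with $t_R$ (resp. $s_R$). A *$*$-Hopf algebroid pair* $(\mathcal L,\mathcal R)$ over $A$ consists of a left bialgebroid $\mathcal L$ that is left and anti-left Hopf, a right bialgebroid $\mathcal R$ that is right and anti-right Hopf, and two bijective unital anti-multiplicative maps $\circledast,\Phi:\mathcal L\to\mathcal R$ such that $\circledast$ is antilinear with $s_L(a)^\circledast=s_R(a^*)$,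 $t_L(a)^\circledast=t_R(a^*)$, $\Delta_R(X^\circledast)=X_{(2)}^\circledast\otimes X_{(1)}^\circledast$, $\varepsilon_R(X^\circledast)=\varepsilon_L(X)^*$; $\Phi$ is linear with $\Phi s_L=t_R$, $\Phi t_L=s_R$, $\Delta_R\Phi=(\Phi\otimes\Phi)\Delta_L$, $\varepsilon_R\Phi=\varepsilon_L$; and $\Phi^{-1}\circ\circledast=\circledast^{-1}\circ\Phi$. **The algebras.** $\mathcal{IL}(\Omega^1)$ and $\mathcal{IR}(\Omega^1)$ are the algebras generated by $a$ and $\underline a$ for $a\in A$, by $x\in\mathfrak X$, by $(x,\omega)\in\mathfrak X\otimes\Omega^1$ and by $(\omega,y)\in\Omega^1\otimes\mathfrak X$ (linearly resp. bilinearly), where $a\mapsto a$ is a unital algebra map, $a\mapsto\underline a$ a unital anti-algebra map, their images commute, and the following hold. For $\mathcal{IL}(\Omega^1)$ (product $\bullet$): $a\bullet(x,\omega)=(ax,\omega)$, $(x,\omega)\bullet a=(xa,\omega)$, $\underline a\bullet(x,\omega)=(x,\omega a)$, $(x,\omega)\bullet\underline a=(x,a\omega)$; $a\bullet(\omega,y)=(a\omega,y)$,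 $(\omega,y)\bullet a=(\omega a,y)$, $\underline a\bullet(\omega,y)=(\omega,ya)$, $(\omega,y)\bullet\underline a=(\omega,ay)$; $a\bullet x=ax$, $x\bullet a=xa+\mathrm{ev}^L(x,da)$, $x\bullet\underline a=\underline a\bullet x+(x,da)$; $(\omega_i,y)\bullet(x_i,\omega)=\underline{\mathrm{ev}^R(\omega,y)}$, $(x,\eta_j)\bullet(\omega,y_j)=\mathrm{ev}^L(x,\omega)$. For $\mathcal{IR}(\Omega^1)$ (product $\underline\bullet$): $a\,\underline\bullet\,(\omega,y)=(\omega,ay)$, $(\omega,y)\,\underline\bullet\,a=(\omega,ya)$, $\underline a\,\underline\bullet\,(\omega,y)=(\omega a,y)$, $(\omega,y)\,\underline\bullet\,\underline a=(a\omega,y)$; $a\,\underline\bullet\,(x,\omega)=(x,a\omega)$, $(x,\omega)\,\underline\bullet\,a=(x,\omega a)$, $\underline a\,\underline\bullet\,(x,\omega)=(xa,\omega)$, $(x,\omega)\,\underline\bullet\,\underline a=(ax,\omega)$; $y\,\underline\bullet\,a=ya$, $a\,\underline\bullet\,y=ay+\mathrm{ev}^R(da,y)$, $\underline a\,\underline\bullet\,y=y\,\underline\bullet\,\underline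 a+(da,y)$; $(x_i,\omega)\,\underline\bullet\,(\omega_i,y)=\mathrm{ev}^R(\omega,y)$, $(\omega,y_j)\,\underline\bullet\,(x,\eta_j)=\underline{\mathrm{ev}^L(x,\omega)}$. $\mathcal{IIL}(\Omega^1)$ is the quotient of $\mathcal{IL}(\Omega^1)$ by $(y_j,\omega)\bullet(\eta_j,x)=\underline{\mathrm{ev}^L(x,\omega)}$, $(\omega,x_i)\bullet(x,\omega_i)=\mathrm{ev}^R(\omega,x)$, and $\mathcal{IIR}(\Omega^1)$ is the quotient of $\mathcal{IR}(\Omega^1)$ by $(\eta_j,x)\,\underline\bullet\,(y_j,\omega)=\mathrm{ev}^L(x,\omega)$, $(x,\omega_i)\,\underline\bullet\,(\omega,x_i)=\underline{\mathrm{ev}^R(\omega,x)}$. **Proposition 5.10.** Let $A$ be a $*$-algebra and $(\Omega^1,d)$ a pivotal $*$-differential calculus on $A$ whose pivotal structure is compatible with $*$. Then $\mathcal{IIL}(\Omega^1)$ is a left and $\mathcal{IIR}(\Omega^1)$ a right $A$-bialgebroid with $s(a)=a$, $t(a)=\underline a$ and $$\Delta_L(a)=a\otimes1,\ \ \Delta_L(\underline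 a)=1\otimes\underline a,\ \ \Delta_L(x)=x\otimes1+(x,\omega_i)\otimes x_i,\ \ \Delta_L(x,\omega)=(x,\omega_i)\otimes(x_i,\omega),\ \ \Delta_L(\omega,y)=(\omega,y_j)\otimes(\eta_j,y),$$ $$\Delta_R(a)=1\otimes a,\ \ \Delta_R(\underline a)=\underline a\otimes1,\ \ \Delta_R(y)=1\otimes y+y_j\otimes(\eta_j,y),\ \ \Delta_R(x,\omega)=(x,\omega_i)\otimes(x_i,\omega),\ \ \Delta_R(\omega,y)=(\omega,y_j)\otimes(\eta_j,y),$$ where both counits are $\varepsilon(a)=\varepsilon(\underline a)=a$, $\varepsilon(x)=0$, $\varepsilon(x,\omega)=\mathrm{ev}^L(x,\omega)$, $\varepsilon(\omega,y)=\mathrm{ev}^R(\omega,y)$; and $(\mathcal{IIL}(\Omega^1),\mathcal{IIR}(\Omega^1))$ is a $*$-Hopf algebroid pair with $$a^\circledast=a^*,\quad\underline a^\circledast=\underline{a^*},\quad(\underline a\bullet x)^\circledast=x^\circledast\,\underline\bullet\,\underline{a^*},\quad(x,\omega)^\circledast=(\omega^*,x^\circledast),\quad(\omega,y)^\circledast=(y^{\circledast^{-1}},\omega^*),$$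 $$\Phi(a\,\underline b)=\underline a\,b,\quad\Phi(x,\omega)=(x,\omega),\quad\Phi(\omega,y)=(\omega,y),\quad\Phi((\omega_i,y)\bullet x_i)=y,\quad\Phi(x)=y_j\,\underline\bullet\,(x,\eta_j).$$ Moreover the same formulas define bijective unital anti-multiplicative maps $\circledast$ (antilinear) and $\Phi$ (linear) $\mathcal{IL}(\Omega^1)\to\mathcal{IR}(\Omega^1)$, and these descend to the maps $\circledast$ and $\Phi$ above. -/

import Mathlib

open scoped TensorProduct

noncomputable section

/-! ### Balanced tensor products over a noncommutative base -/

/-- The relations `r a m ⊗ n = m ⊗ l a n` for a family `r` of endomorphisms of `M` (a right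
action of the base) and a family `l` of endomorphisms of `N` (a left action of the base). -/
def balSub {A M N : Type*} [AddCommGroup M] [Module ℂ M] [AddCommGroup N] [Module ℂ N]
    (r : A → M →ₗ[ℂ] M) (l : A → N →ₗ[ℂ] N) : Submodule ℂ (M ⊗[ℂ] N) :=
  Submodule.span ℂ {z | ∃ a m n, z = r a m ⊗ₜ[ℂ] n - m ⊗ₜ[ℂ] l a n}

/-- The balanced tensor product `M ⊗_A N`. -/
abbrev BalTensor {A M N : Type*} [AddCommGroup M] [Module ℂ M] [AddCommGroup N] [Module ℂ N]
    (r : A → M →ₗ[ℂ] M) (l : A → N →ₗ[ℂ] N) : Type _ :=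
  (M ⊗[ℂ] N) ⧸ balSub r l

/-- The relations of `M ⊗_A M ⊗_A M`. -/
def balSub3 {A M : Type*} [AddCommGroup M] [Module ℂ M]
    (r l : A → M →ₗ[ℂ] M) : Submodule ℂ (M ⊗[ℂ] (M ⊗[ℂ] M)) :=
  Submodule.span ℂ
    ({w | ∃ a x y z, w = r a x ⊗ₜ[ℂ] (y ⊗ₜ[ℂ] z) - x ⊗ₜ[ℂ] (l a y ⊗ₜ[ℂ] z)} ∪
     {w | ∃ a x y z, w = x ⊗ₜ[ℂ] (r a y ⊗ₜ[ℂ] z) - x ⊗ₜ[ℂ] (y ⊗ₜ[ℂ] l a z)})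

/-- The balanced tensor product `M ⊗_A M ⊗_A M`. -/
abbrev BalTensor3 {A M : Type*} [AddCommGroup M] [Module ℂ M]
    (r l : A → M →ₗ[ℂ] M) : Type _ :=
  (M ⊗[ℂ] (M ⊗[ℂ] M)) ⧸ balSub3 r l

/-- The canonical map `(M ⊗_A M) ⊗ M → M ⊗_A M ⊗_A M`. -/
def balAssocL {A M : Type*} [AddCommGroup M] [Module ℂ M] (r l : A → M →ₗ[ℂ] M) :
    (BalTensor r l) ⊗[ℂ] M →ₗ[ℂ] BalTensor3 r l :=
  TensorProduct.lift
    ((balSub r l).liftQ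
      (TensorProduct.curry ((balSub3 r l).mkQ ∘ₗ (TensorProduct.assoc ℂ M M M).toLinearMap))
      (by
        refine Submodule.span_le.2 ?_
        rintro _ ⟨a, x, y, rfl⟩
        refine LinearMap.ext fun z => ?_
        have h : r a x ⊗ₜ[ℂ] (y ⊗ₜ[ℂ] z) - x ⊗ₜ[ℂ] (l a y ⊗ₜ[ℂ] z) ∈ balSub3 r l :=
          Submodule.subset_span (Or.inl ⟨a, x, y, z, rfl⟩)
        rw [← Submodule.Quotient.mk_eq_zero] at h
        simpa [TensorProduct.sub_tmul] using h))

/-- The canonical map `M ⊗ (M ⊗_A M) → M ⊗_A M ⊗_A M`. -/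
def balAssocR {A M : Type*} [AddCommGroup M] [Module ℂ M] (r l : A → M →ₗ[ℂ] M) :
    M ⊗[ℂ] (BalTensor r l) →ₗ[ℂ] BalTensor3 r l :=
  TensorProduct.lift
    ((balSub r l).liftQ
      (TensorProduct.curry (balSub3 r l).mkQ).flip
      (by
        refine Submodule.span_le.2 ?_
        rintro _ ⟨a, y, z, rfl⟩
        refine LinearMap.ext fun x => ?_
        have h : x ⊗ₜ[ℂ] (r a y ⊗ₜ[ℂ] z) - x ⊗ₜ[ℂ] (y ⊗ₜ[ℂ] l a z) ∈ balSub3 r l :=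
          Submodule.subset_span (Or.inr ⟨a, x, y, z, rfl⟩)
        rw [← Submodule.Quotient.mk_eq_zero] at h
        simpa [TensorProduct.tmul_sub] using h)).flip

/-! ### Left bialgebroids -/

section Left

variable {A L : Type*} [Ring A] [Algebra ℂ A] [Ring L] [Algebra ℂ L]

/-- The right `A`-action `X . a = t(a) X` of a left bialgebroid. -/
def leftActR (t : Aᵐᵒᵖ →ₐ[ℂ] L) (a : A) : L →ₗ[ℂ] L := LinearMap.mulLeft ℂ (t (.op a))

/-- The left `A`-action `a . X = s(a) X` of a left bialgebroid. -/
def leftActL (s : A →ₐ[ℂ] L) (a : A) : L →ₗ[ℂ] L := LinearMap.mulLeft ℂ (s a)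

end Left

/-- A left bialgebroid over `A` (over the ground field `ℂ`). The product `L ⊗_A L` is taken for
`a . X . b = s(a) t(b) X`. An axiom about `Δ X = X₁ ⊗ X₂` is stated for every representative
`u ∈ L ⊗ L` of `Δ X`. -/
structure LeftBialgebroid (A L : Type*) [Ring A] [Algebra ℂ A] [Ring L] [Algebra ℂ L] where
  s : A →ₐ[ℂ] L
  t : Aᵐᵒᵖ →ₐ[ℂ] L
  s_t_comm : ∀ a b, s a * t b = t b * s a
  comul : L →ₗ[ℂ] BalTensor (leftActR t) (leftActL s)
  counit : L →ₗ[ℂ] A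
  /-- `Δ(a . X . b) = a . X₁ ⊗ X₂ . b` -/
  comul_bimod : ∀ (a b : A) (X : L) (u : L ⊗[ℂ] L), (balSub _ _).mkQ u = comul X →
    comul (s a * t (.op b) * X) = (balSub _ _).mkQ ((s a ⊗ₜ[ℂ] t (.op b)) * u)
  /-- `ε(a . X . b) = a ε(X) b` -/
  counit_bimod : ∀ (a b : A) (X : L), counit (s a * t (.op b) * X) = a * counit X * b
  /-- `(Δ ⊗ id) Δ = (id ⊗ Δ) Δ` in `L ⊗_A L ⊗_A L` -/
  coassoc : ∀ (X : L) (u : L ⊗[ℂ] L), (balSub _ _).mkQ u = comul X →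
    balAssocL _ _ (TensorProduct.map comul LinearMap.id u) =
      balAssocR _ _ (TensorProduct.map LinearMap.id comul u)
  /-- `s(ε(X₁)) X₂ = X` -/
  counit_left : ∀ (X : L) (u : L ⊗[ℂ] L), (balSub _ _).mkQ u = comul X →
    LinearMap.mul' ℂ L (TensorProduct.map (s.toLinearMap ∘ₗ counit) LinearMap.id u) = X
  /-- `t(ε(X₂)) X₁ = X` -/
  counit_right : ∀ (X : L) (u : L ⊗[ℂ] L), (balSub _ _).mkQ u = comul X →
    LinearMap.mul' ℂ L (TensorProduct.comm ℂ L L (TensorProduct.map LinearMap.id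
      (t.toLinearMap ∘ₗ (MulOpposite.opLinearEquiv ℂ).toLinearMap ∘ₗ counit) u)) = X
  /-- the image of `Δ` lies in the Takeuchi product: `X₁ t(a) ⊗ X₂ = X₁ ⊗ X₂ s(a)` -/
  takeuchi : ∀ (a : A) (X : L) (u : L ⊗[ℂ] L), (balSub _ _).mkQ u = comul X →
    (balSub (leftActR t) (leftActL s)).mkQ (u * (t (.op a) ⊗ₜ[ℂ] 1)) =
      (balSub _ _).mkQ (u * (1 ⊗ₜ[ℂ] s a))
  comul_one : comul 1 = (balSub _ _).mkQ 1
  comul_mul : ∀ (X Y : L) (u v : L ⊗[ℂ] L), (balSub _ _).mkQ u = comul X →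
    (balSub _ _).mkQ v = comul Y → comul (X * Y) = (balSub _ _).mkQ (u * v)
  counit_one : counit 1 = 1
  counit_mul_s : ∀ X Y, counit (X * Y) = counit (X * s (counit Y))
  counit_mul_t : ∀ X Y, counit (X * Y) = counit (X * t (.op (counit Y)))

namespace LeftBialgebroid

variable {A L : Type*} [Ring A] [Algebra ℂ A] [Ring L] [Algebra ℂ L]

/-- `L ⊗_A L` -/
abbrev Tens (H : LeftBialgebroid A L) : Type _ := BalTensor (leftActR H.t) (leftActL H.s)

/-- The projection `L ⊗ L → L ⊗_A L`. -/
abbrev proj (H : LeftBialgebroid A L) : L ⊗[ℂ] L →ₗ[ℂ] H.Tens := (balSub _ _).mkQ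

/-- The relations `X t(a) ⊗ Y = X ⊗ t(a) Y` of `L ⊗_{A^op} L`. -/
abbrev opSub (H : LeftBialgebroid A L) : Submodule ℂ (L ⊗[ℂ] L) :=
  balSub (fun a : A => LinearMap.mulRight ℂ (H.t (.op a)))
    (fun a : A => LinearMap.mulLeft ℂ (H.t (.op a)))

/-- The relations `s(a) X ⊗ Y = X ⊗ Y s(a)` of `L ⊗^A L`. -/
abbrev upSub (H : LeftBialgebroid A L) : Submodule ℂ (L ⊗[ℂ] L) :=
  balSub (fun a : A => LinearMap.mulLeft ℂ (H.s a)) (fun a : A => LinearMap.mulRight ℂ (H.s a))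

/-- `L` is a left Hopf algebroid: the canonical map `X ⊗ Y ↦ X₁ ⊗ X₂ Y` from `L ⊗_{A^op} L` to
`L ⊗_A L` (which is determined by the displayed formula) is bijective. -/
def IsLeftHopf (H : LeftBialgebroid A L) : Prop :=
  ∃ lam : ((L ⊗[ℂ] L) ⧸ H.opSub) →ₗ[ℂ] H.Tens,
    (∀ (X Y : L) (u : L ⊗[ℂ] L), H.proj u = H.comul X →
      lam (H.opSub.mkQ (X ⊗ₜ[ℂ] Y)) = H.proj (u * (1 ⊗ₜ[ℂ] Y))) ∧
    Function.Bijective lam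

/-- `L` is an anti-left Hopf algebroid: the canonical map `X ⊗ Y ↦ Y₁ X ⊗ Y₂` from `L ⊗^A L` to
`L ⊗_A L` (which is determined by the displayed formula) is bijective. -/
def IsAntiLeftHopf (H : LeftBialgebroid A L) : Prop :=
  ∃ mu : ((L ⊗[ℂ] L) ⧸ H.upSub) →ₗ[ℂ] H.Tens,
    (∀ (X Y : L) (u : L ⊗[ℂ] L), H.proj u = H.comul Y →
      mu (H.upSub.mkQ (X ⊗ₜ[ℂ] Y)) = H.proj (u * (X ⊗ₜ[ℂ] 1))) ∧
    Function.Bijective mu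

end LeftBialgebroid

/-! ### Right bialgebroids -/

section Right

variable {A R : Type*} [Ring A] [Algebra ℂ A] [Ring R] [Algebra ℂ R]

/-- The right `A`-action `X . a = X s(a)` of a right bialgebroid. -/
def rightActR (s : A →ₐ[ℂ] R) (a : A) : R →ₗ[ℂ] R := LinearMap.mulRight ℂ (s a)

/-- The left `A`-action `a . X = X t(a)` of a right bialgebroid. -/
def rightActL (t : Aᵐᵒᵖ →ₐ[ℂ] R) (a : A) : R →ₗ[ℂ] R := LinearMap.mulRight ℂ (t (.op a))

end Right

/-- A right bialgebroid over `A` (over the ground field `ℂ`). The product `R ⊗_A R` is taken for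
`a . X . b = X t(a) s(b)`. An axiom about `Δ X = X₁ ⊗ X₂` is stated for every representative
`u ∈ R ⊗ R` of `Δ X`. -/
structure RightBialgebroid (A R : Type*) [Ring A] [Algebra ℂ A] [Ring R] [Algebra ℂ R] where
  s : A →ₐ[ℂ] R
  t : Aᵐᵒᵖ →ₐ[ℂ] R
  s_t_comm : ∀ a b, s a * t b = t b * s a
  comul : R →ₗ[ℂ] BalTensor (rightActR s) (rightActL t)
  counit : R →ₗ[ℂ] A
  /-- `Δ(a . X . b) = a . X₁ ⊗ X₂ . b` -/
  comul_bimod : ∀ (a b : A) (X : R) (u : R ⊗[ℂ] R), (balSub _ _).mkQ u = comul X →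
    comul (X * t (.op a) * s b) = (balSub _ _).mkQ (u * (t (.op a) ⊗ₜ[ℂ] s b))
  /-- `ε(a . X . b) = a ε(X) b` -/
  counit_bimod : ∀ (a b : A) (X : R), counit (X * t (.op a) * s b) = a * counit X * b
  /-- `(Δ ⊗ id) Δ = (id ⊗ Δ) Δ` in `R ⊗_A R ⊗_A R` -/
  coassoc : ∀ (X : R) (u : R ⊗[ℂ] R), (balSub _ _).mkQ u = comul X →
    balAssocL _ _ (TensorProduct.map comul LinearMap.id u) =
      balAssocR _ _ (TensorProduct.map LinearMap.id comul u)
  /-- `X₂ t(ε(X₁)) = X` -/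
  counit_left : ∀ (X : R) (u : R ⊗[ℂ] R), (balSub _ _).mkQ u = comul X →
    LinearMap.mul' ℂ R (TensorProduct.comm ℂ R R (TensorProduct.map
      (t.toLinearMap ∘ₗ (MulOpposite.opLinearEquiv ℂ).toLinearMap ∘ₗ counit)
      LinearMap.id u)) = X
  /-- `X₁ s(ε(X₂)) = X` -/
  counit_right : ∀ (X : R) (u : R ⊗[ℂ] R), (balSub _ _).mkQ u = comul X →
    LinearMap.mul' ℂ R (TensorProduct.map LinearMap.id (s.toLinearMap ∘ₗ counit) u) = X
  /-- the image of `Δ` lies in the Takeuchi product: `s(a) X₁ ⊗ X₂ = X₁ ⊗ t(a) X₂` -/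
  takeuchi : ∀ (a : A) (X : R) (u : R ⊗[ℂ] R), (balSub _ _).mkQ u = comul X →
    (balSub (rightActR s) (rightActL t)).mkQ ((s a ⊗ₜ[ℂ] 1) * u) =
      (balSub _ _).mkQ ((1 ⊗ₜ[ℂ] t (.op a)) * u)
  comul_one : comul 1 = (balSub _ _).mkQ 1
  comul_mul : ∀ (X Y : R) (u v : R ⊗[ℂ] R), (balSub _ _).mkQ u = comul X →
    (balSub _ _).mkQ v = comul Y → comul (X * Y) = (balSub _ _).mkQ (u * v)
  counit_one : counit 1 = 1
  counit_mul_s : ∀ X Y, counit (X * Y) = counit (s (counit X) * Y)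
  counit_mul_t : ∀ X Y, counit (X * Y) = counit (t (.op (counit X)) * Y)

namespace RightBialgebroid

variable {A R : Type*} [Ring A] [Algebra ℂ A] [Ring R] [Algebra ℂ R]

/-- `R ⊗_A R` -/
abbrev Tens (H : RightBialgebroid A R) : Type _ := BalTensor (rightActR H.s) (rightActL H.t)

/-- The projection `R ⊗ R → R ⊗_A R`. -/
abbrev proj (H : RightBialgebroid A R) : R ⊗[ℂ] R →ₗ[ℂ] H.Tens := (balSub _ _).mkQ

/-- The relations `X t(a) ⊗ Y = X ⊗ t(a) Y` of `R ⊗_{A^op} R`. -/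
abbrev opSub (H : RightBialgebroid A R) : Submodule ℂ (R ⊗[ℂ] R) :=
  balSub (fun a : A => LinearMap.mulRight ℂ (H.t (.op a)))
    (fun a : A => LinearMap.mulLeft ℂ (H.t (.op a)))

/-- The relations `s(a) X ⊗ Y = X ⊗ Y s(a)` of `R ⊗^A R`. -/
abbrev upSub (H : RightBialgebroid A R) : Submodule ℂ (R ⊗[ℂ] R) :=
  balSub (fun a : A => LinearMap.mulLeft ℂ (H.s a)) (fun a : A => LinearMap.mulRight ℂ (H.s a))

/-- `R` is a right Hopf algebroid: the canonical map `X ⊗ Y ↦ X Y₁ ⊗ Y₂` from `R ⊗_{A^op} R` to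
`R ⊗_A R` is bijective. -/
def IsRightHopf (H : RightBialgebroid A R) : Prop :=
  ∃ lam : ((R ⊗[ℂ] R) ⧸ H.opSub) →ₗ[ℂ] H.Tens,
    (∀ (X Y : R) (u : R ⊗[ℂ] R), H.proj u = H.comul Y →
      lam (H.opSub.mkQ (X ⊗ₜ[ℂ] Y)) = H.proj ((X ⊗ₜ[ℂ] 1) * u)) ∧
    Function.Bijective lam

/-- `R` is an anti-right Hopf algebroid: the canonical map `X ⊗ Y ↦ X₁ ⊗ Y X₂` from `R ⊗^A R` to
`R ⊗_A R` is bijective. -/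
def IsAntiRightHopf (H : RightBialgebroid A R) : Prop :=
  ∃ mu : ((R ⊗[ℂ] R) ⧸ H.upSub) →ₗ[ℂ] H.Tens,
    (∀ (X Y : R) (u : R ⊗[ℂ] R), H.proj u = H.comul X →
      mu (H.upSub.mkQ (X ⊗ₜ[ℂ] Y)) = H.proj ((1 ⊗ₜ[ℂ] Y) * u)) ∧
    Function.Bijective mu

end RightBialgebroid

/-! ### `*`-bialgebroid pairs and `*`-Hopf algebroid pairs -/

section Pair

variable {A L R : Type*} [Ring A] [Algebra ℂ A] [StarRing A] [StarModule ℂ A]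
  [Ring L] [Algebra ℂ L] [Ring R] [Algebra ℂ R]

/-- `(L, R)` is `*`-related by the invertible antilinear anti-algebra map `st`. -/
structure IsStarRelated (HL : LeftBialgebroid A L) (HR : RightBialgebroid A R)
    (st : L ≃ₛₗ[starRingEnd ℂ] R) : Prop where
  map_one : st 1 = 1
  map_mul : ∀ X Y, st (X * Y) = st Y * st X
  map_s : ∀ a, st (HL.s a) = HR.s (star a)
  map_t : ∀ a, st (HL.t (.op a)) = HR.t (.op (star a))
  /-- `Δ_R(X^⊛) = flip (⊛ ⊗ ⊛) Δ_L(X)` -/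
  map_comul : ∀ (X : L) (u : L ⊗[ℂ] L), HL.proj u = HL.comul X →
    HR.comul (st X) =
      HR.proj (TensorProduct.comm ℂ R R (TensorProduct.map st.toLinearMap st.toLinearMap u))
  map_counit : ∀ X, HR.counit (st X) = star (HL.counit X)

/-- `(L, R)` is reflexive by the invertible linear anti-algebra and coalgebra map `Φ`. -/
structure IsReflexive (HL : LeftBialgebroid A L) (HR : RightBialgebroid A R)
    (Φ : L ≃ₗ[ℂ] R) : Prop where
  map_one : Φ 1 = 1
  map_mul : ∀ X Y, Φ (X * Y) = Φ Y * Φ X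
  map_s : ∀ a, Φ (HL.s a) = HR.t (.op a)
  map_t : ∀ a, Φ (HL.t (.op a)) = HR.s a
  /-- `Δ_R(Φ X) = (Φ ⊗ Φ) Δ_L(X)` -/
  map_comul : ∀ (X : L) (u : L ⊗[ℂ] L), HL.proj u = HL.comul X →
    HR.comul (Φ X) = HR.proj (TensorProduct.map Φ.toLinearMap Φ.toLinearMap u)
  map_counit : ∀ X, HR.counit (Φ X) = HL.counit X

/-- `(L, R)` is a `*`-bialgebroid pair with respect to `st` (the map `⊛`) and `Φ`. -/
structure IsStarBialgebroidPair (HL : LeftBialgebroid A L) (HR : RightBialgebroid A R)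
    (st : L ≃ₛₗ[starRingEnd ℂ] R) (Φ : L ≃ₗ[ℂ] R) : Prop where
  star_related : IsStarRelated HL HR st
  reflexive : IsReflexive HL HR Φ
  /-- `Φ⁻¹ ∘ ⊛ = ⊛⁻¹ ∘ Φ` -/
  compat : ∀ X, Φ.symm (st X) = st.symm (Φ X)

/-- `(L, R)` is a `*`-Hopf algebroid pair: a `*`-bialgebroid pair for which `L` is a left and
anti-left Hopf algebroid and `R` is a right and anti-right Hopf algebroid. -/
structure IsStarHopfAlgebroidPair (HL : LeftBialgebroid A L) (HR : RightBialgebroid A R)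
    (st : L ≃ₛₗ[starRingEnd ℂ] R) (Φ : L ≃ₗ[ℂ] R) : Prop
    extends IsStarBialgebroidPair HL HR st Φ where
  left_hopf : HL.IsLeftHopf
  anti_left_hopf : HL.IsAntiLeftHopf
  right_hopf : HR.IsRightHopf
  anti_right_hopf : HR.IsAntiRightHopf

end Pair

/-! ### `*`-differential calculi and pivotal duals

A bimodule `Ω` over `A` is given by commuting actions of `A` and `Aᵐᵒᵖ`; the right action
`ω a` is `MulOpposite.op a • ω`. -/

section Calculus

variable (A Ω 𝔛 : Type*) [Ring A] [Algebra ℂ A]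
  [AddCommGroup Ω] [Module ℂ Ω] [Module A Ω] [Module Aᵐᵒᵖ Ω]
  [AddCommGroup 𝔛] [Module ℂ 𝔛] [Module A 𝔛] [Module Aᵐᵒᵖ 𝔛]

/-- A first order `*`-differential calculus on the `*`-algebra `A`, with bimodule of one-forms
`Ω`. -/
structure StarFODC [StarRing A] [StarAddMonoid Ω] where
  d : A →ₗ[ℂ] Ω
  leibniz : ∀ a b, d (a * b) = MulOpposite.op b • d a + a • d b
  span_eq_top : Submodule.span ℂ {w : Ω | ∃ a b : A, w = a • d b} = ⊤
  star_bimod : ∀ (a b : A) (ω : Ω),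
    star (a • MulOpposite.op b • ω) = star b • MulOpposite.op (star a) • star ω
  star_d : ∀ a, d (star a) = star (d a)

/-- The bimodule `𝔛` is at the same time a left and a right dual of `Ω`. The coevaluations are
`coev^L(1) = ∑ ωL i ⊗ xL i ∈ Ω ⊗_A 𝔛` and `coev^R(1) = ∑ yR j ⊗ ηR j ∈ 𝔛 ⊗_A Ω`. In particular
`Ω` is finitely generated projective on both sides, and the evaluations identify `𝔛` with the
right module maps `Ω → A` and also with the left module maps `Ω → A`. -/
structure PivotalDual where
  evL : 𝔛 →ₗ[ℂ] Ω →ₗ[ℂ] A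
  evL_left : ∀ (a : A) x ω, evL (a • x) ω = a * evL x ω
  evL_mid : ∀ (a : A) x ω, evL (MulOpposite.op a • x) ω = evL x (a • ω)
  evL_right : ∀ (a : A) x ω, evL x (MulOpposite.op a • ω) = evL x ω * a
  nL : ℕ
  ωL : Fin nL → Ω
  xL : Fin nL → 𝔛
  snakeL_form : ∀ ω, ∑ i, MulOpposite.op (evL (xL i) ω) • ωL i = ω
  snakeL_field : ∀ x, ∑ i, evL x (ωL i) • xL i = x
  evR : Ω →ₗ[ℂ] 𝔛 →ₗ[ℂ] A
  evR_left : ∀ (a : A) ω y, evR (a • ω) y = a * evR ω y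
  evR_mid : ∀ (a : A) ω y, evR (MulOpposite.op a • ω) y = evR ω (a • y)
  evR_right : ∀ (a : A) ω y, evR ω (MulOpposite.op a • y) = evR ω y * a
  nR : ℕ
  yR : Fin nR → 𝔛
  ηR : Fin nR → Ω
  snakeR_form : ∀ ω, ∑ j, evR ω (yR j) • ηR j = ω
  snakeR_field : ∀ y, ∑ j, MulOpposite.op (evR (ηR j) y) • yR j = y

end Calculus

section Star

variable {A Ω 𝔛 : Type*} [Ring A] [Algebra ℂ A] [StarRing A]
  [AddCommGroup Ω] [Module ℂ Ω] [Module A Ω] [Module Aᵐᵒᵖ Ω] [StarAddMonoid Ω]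
  [AddCommGroup 𝔛] [Module ℂ 𝔛] [Module A 𝔛] [Module Aᵐᵒᵖ 𝔛]

/-- The map `⊛ : 𝔛 → 𝔛`, determined by `ev^R(ω, x^⊛) = ev^L(x, ω^*)^*`. -/
def PivotalDual.fieldStar (P : PivotalDual A Ω 𝔛) (x : 𝔛) : 𝔛 :=
  ∑ j, MulOpposite.op (star (P.evL x (star (P.ηR j)))) • P.yR j

/-- The map `⊛⁻¹ : 𝔛 → 𝔛`, determined by `ev^L(y^{⊛⁻¹}, ω) = ev^R(ω^*, y)^*`. -/
def PivotalDual.fieldStarInv (P : PivotalDual A Ω 𝔛) (y : 𝔛) : 𝔛 :=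
  ∑ i, star (P.evR (star (P.ωL i)) y) • P.xL i

theorem StarFODC.star_left (C : StarFODC A Ω) (a : A) (ω : Ω) :
    star (a • ω) = MulOpposite.op (star a) • star ω := by
  simpa using C.star_bimod a 1 ω

theorem StarFODC.star_right (C : StarFODC A Ω) (a : A) (ω : Ω) :
    star (MulOpposite.op a • ω) = star a • star ω := by
  simpa using C.star_bimod 1 a ω

theorem PivotalDual.evR_fieldStar (P : PivotalDual A Ω 𝔛) (C : StarFODC A Ω) (ω : Ω) (x : 𝔛) :
    P.evR ω (P.fieldStar x) = star (P.evL x (star ω)) := by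
  conv_rhs => rw [← P.snakeR_form ω]
  simp [PivotalDual.fieldStar, P.evR_right, C.star_left, P.evL_right, -MulOpposite.op_star]

theorem PivotalDual.evL_fieldStarInv (P : PivotalDual A Ω 𝔛) (C : StarFODC A Ω) (ω : Ω) (y : 𝔛) :
    P.evL (P.fieldStarInv y) ω = star (P.evR (star ω) y) := by
  conv_rhs => rw [← P.snakeL_form ω]
  simp [PivotalDual.fieldStarInv, P.evL_left, C.star_right, P.evR_left]

theorem PivotalDual.fieldStarInv_fieldStar (P : PivotalDual A Ω 𝔛) (C : StarFODC A Ω) (x : 𝔛) :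
    P.fieldStarInv (P.fieldStar x) = x := by
  conv_rhs => rw [← P.snakeL_field x]
  simp [PivotalDual.fieldStarInv, P.evR_fieldStar C]

theorem PivotalDual.fieldStar_fieldStarInv (P : PivotalDual A Ω 𝔛) (C : StarFODC A Ω) (y : 𝔛) :
    P.fieldStar (P.fieldStarInv y) = y := by
  conv_rhs => rw [← P.snakeR_field y]
  simp [PivotalDual.fieldStar, P.evL_fieldStarInv C]

end Star

/-! ### The algebras `IL(Ω)`, `IIL(Ω)`, `IR(Ω)`, `IIR(Ω)` -/

/-- Generators: `s a` is `a ∈ A`, `t a` is `a` regarded in `A^op` (underlined), `v x` is a vector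
field `x ∈ 𝔛`, `xo x ω` is `(x, ω) ∈ 𝔛 ⊗ Ω`, `ox ω y` is `(ω, y) ∈ Ω ⊗ 𝔛`. -/
inductive GhobadiGen (A Ω 𝔛 : Type*)
  | s (a : A)
  | t (a : A)
  | v (x : 𝔛)
  | xo (x : 𝔛) (ω : Ω)
  | ox (ω : Ω) (y : 𝔛)

/-- The five kinds of generators as elements of a type `L`. -/
structure Gens (A Ω 𝔛 L : Type*) where
  s : A → L
  t : A → L
  v : 𝔛 → L
  xo : 𝔛 → Ω → L
  ox : Ω → 𝔛 → L

/-- The images of generators under a map. -/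
def Gens.map {A Ω 𝔛 L L' : Type*} (g : Gens A Ω 𝔛 L) (f : L → L') : Gens A Ω 𝔛 L' where
  s a := f (g.s a)
  t a := f (g.t a)
  v x := f (g.v x)
  xo x ω := f (g.xo x ω)
  ox ω y := f (g.ox ω y)

/-- The free algebra on the generators. -/
abbrev GhobadiFree (A Ω 𝔛 : Type*) : Type _ := FreeAlgebra ℂ (GhobadiGen A Ω 𝔛)

/-- The free generators. -/
def freeGens (A Ω 𝔛 : Type*) : Gens A Ω 𝔛 (GhobadiFree A Ω 𝔛) where
  s a := FreeAlgebra.ι ℂ (.s a)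
  t a := FreeAlgebra.ι ℂ (.t a)
  v x := FreeAlgebra.ι ℂ (.v x)
  xo x ω := FreeAlgebra.ι ℂ (.xo x ω)
  ox ω y := FreeAlgebra.ι ℂ (.ox ω y)

section Algebras

variable {A Ω 𝔛 : Type*} [Ring A] [Algebra ℂ A] [StarRing A]
  [AddCommGroup Ω] [Module ℂ Ω] [Module A Ω] [Module Aᵐᵒᵖ Ω] [StarAddMonoid Ω]
  [AddCommGroup 𝔛] [Module ℂ 𝔛] [Module A 𝔛] [Module Aᵐᵒᵖ 𝔛]

/-- The relations saying that `s` and `t` are an algebra map and an anti-algebra map from `A` with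
commuting images, and that the other generators depend linearly (bilinearly) on their
arguments. -/
inductive BasicRel {L : Type*} [Ring L] [Algebra ℂ L] (g : Gens A Ω 𝔛 L) : L → L → Prop
  | s_add (a b : A) : BasicRel g (g.s (a + b)) (g.s a + g.s b)
  | s_mul (a b : A) : BasicRel g (g.s (a * b)) (g.s a * g.s b)
  | s_scalar (c : ℂ) : BasicRel g (g.s (algebraMap ℂ A c)) (algebraMap ℂ L c)
  | t_add (a b : A) : BasicRel g (g.t (a + b)) (g.t a + g.t b)
  | t_mul (a b : A) : BasicRel g (g.t (a * b)) (g.t b * g.t a)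
  | t_scalar (c : ℂ) : BasicRel g (g.t (algebraMap ℂ A c)) (algebraMap ℂ L c)
  | s_t (a b : A) : BasicRel g (g.s a * g.t b) (g.t b * g.s a)
  | v_add (x y : 𝔛) : BasicRel g (g.v (x + y)) (g.v x + g.v y)
  | v_smul (c : ℂ) (x : 𝔛) : BasicRel g (g.v (c • x)) (c • g.v x)
  | xo_add_left (x y : 𝔛) (ω : Ω) : BasicRel g (g.xo (x + y) ω) (g.xo x ω + g.xo y ω)
  | xo_add_right (x : 𝔛) (ω η : Ω) : BasicRel g (g.xo x (ω + η)) (g.xo x ω + g.xo x η)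
  | xo_smul_left (c : ℂ) (x : 𝔛) (ω : Ω) : BasicRel g (g.xo (c • x) ω) (c • g.xo x ω)
  | xo_smul_right (c : ℂ) (x : 𝔛) (ω : Ω) : BasicRel g (g.xo x (c • ω)) (c • g.xo x ω)
  | ox_add_left (ω η : Ω) (y : 𝔛) : BasicRel g (g.ox (ω + η) y) (g.ox ω y + g.ox η y)
  | ox_add_right (ω : Ω) (x y : 𝔛) : BasicRel g (g.ox ω (x + y)) (g.ox ω x + g.ox ω y)
  | ox_smul_left (c : ℂ) (ω : Ω) (y : 𝔛) : BasicRel g (g.ox (c • ω) y) (c • g.ox ω y)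
  | ox_smul_right (c : ℂ) (ω : Ω) (y : 𝔛) : BasicRel g (g.ox ω (c • y)) (c • g.ox ω y)

/-- The defining relations of `IL(Ω)`. -/
inductive ILRel (C : StarFODC A Ω) (P : PivotalDual A Ω 𝔛) {L : Type*} [Ring L] [Algebra ℂ L]
    (g : Gens A Ω 𝔛 L) : L → L → Prop
  | basic {X Y : L} (h : BasicRel g X Y) : ILRel C P g X Y
  | s_xo (a : A) (x : 𝔛) (ω : Ω) : ILRel C P g (g.s a * g.xo x ω) (g.xo (a • x) ω)
  | xo_s (a : A) (x : 𝔛) (ω : Ω) :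
      ILRel C P g (g.xo x ω * g.s a) (g.xo (MulOpposite.op a • x) ω)
  | t_xo (a : A) (x : 𝔛) (ω : Ω) :
      ILRel C P g (g.t a * g.xo x ω) (g.xo x (MulOpposite.op a • ω))
  | xo_t (a : A) (x : 𝔛) (ω : Ω) : ILRel C P g (g.xo x ω * g.t a) (g.xo x (a • ω))
  | s_ox (a : A) (ω : Ω) (y : 𝔛) : ILRel C P g (g.s a * g.ox ω y) (g.ox (a • ω) y)
  | ox_s (a : A) (ω : Ω) (y : 𝔛) :
      ILRel C P g (g.ox ω y * g.s a) (g.ox (MulOpposite.op a • ω) y)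
  | t_ox (a : A) (ω : Ω) (y : 𝔛) :
      ILRel C P g (g.t a * g.ox ω y) (g.ox ω (MulOpposite.op a • y))
  | ox_t (a : A) (ω : Ω) (y : 𝔛) : ILRel C P g (g.ox ω y * g.t a) (g.ox ω (a • y))
  | s_v (a : A) (x : 𝔛) : ILRel C P g (g.s a * g.v x) (g.v (a • x))
  | v_s (a : A) (x : 𝔛) :
      ILRel C P g (g.v x * g.s a) (g.v (MulOpposite.op a • x) + g.s (P.evL x (C.d a)))
  | v_t (a : A) (x : 𝔛) : ILRel C P g (g.v x * g.t a) (g.t a * g.v x + g.xo x (C.d a))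
  | ox_xo (ω : Ω) (y : 𝔛) :
      ILRel C P g (∑ i, g.ox (P.ωL i) y * g.xo (P.xL i) ω) (g.t (P.evR ω y))
  | xo_ox (x : 𝔛) (ω : Ω) :
      ILRel C P g (∑ j, g.xo x (P.ηR j) * g.ox ω (P.yR j)) (g.s (P.evL x ω))

/-- The additional relations of `IIL(Ω)`. -/
inductive IILRel (P : PivotalDual A Ω 𝔛) {L : Type*} [Ring L] (g : Gens A Ω 𝔛 L) : L → L → Prop
  | xo_ox (x : 𝔛) (ω : Ω) :
      IILRel P g (∑ j, g.xo (P.yR j) ω * g.ox (P.ηR j) x) (g.t (P.evL x ω))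
  | ox_xo (ω : Ω) (x : 𝔛) :
      IILRel P g (∑ i, g.ox ω (P.xL i) * g.xo x (P.ωL i)) (g.s (P.evR ω x))

/-- The defining relations of `IR(Ω)`. -/
inductive IRRel (C : StarFODC A Ω) (P : PivotalDual A Ω 𝔛) {R : Type*} [Ring R] [Algebra ℂ R]
    (g : Gens A Ω 𝔛 R) : R → R → Prop
  | basic {X Y : R} (h : BasicRel g X Y) : IRRel C P g X Y
  | s_ox (a : A) (ω : Ω) (y : 𝔛) : IRRel C P g (g.s a * g.ox ω y) (g.ox ω (a • y))
  | ox_s (a : A) (ω : Ω) (y : 𝔛) :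
      IRRel C P g (g.ox ω y * g.s a) (g.ox ω (MulOpposite.op a • y))
  | t_ox (a : A) (ω : Ω) (y : 𝔛) :
      IRRel C P g (g.t a * g.ox ω y) (g.ox (MulOpposite.op a • ω) y)
  | ox_t (a : A) (ω : Ω) (y : 𝔛) : IRRel C P g (g.ox ω y * g.t a) (g.ox (a • ω) y)
  | s_xo (a : A) (x : 𝔛) (ω : Ω) : IRRel C P g (g.s a * g.xo x ω) (g.xo x (a • ω))
  | xo_s (a : A) (x : 𝔛) (ω : Ω) :
      IRRel C P g (g.xo x ω * g.s a) (g.xo x (MulOpposite.op a • ω))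
  | t_xo (a : A) (x : 𝔛) (ω : Ω) :
      IRRel C P g (g.t a * g.xo x ω) (g.xo (MulOpposite.op a • x) ω)
  | xo_t (a : A) (x : 𝔛) (ω : Ω) : IRRel C P g (g.xo x ω * g.t a) (g.xo (a • x) ω)
  | v_s (a : A) (y : 𝔛) : IRRel C P g (g.v y * g.s a) (g.v (MulOpposite.op a • y))
  | s_v (a : A) (y : 𝔛) :
      IRRel C P g (g.s a * g.v y) (g.v (a • y) + g.s (P.evR (C.d a) y))
  | t_v (a : A) (y : 𝔛) : IRRel C P g (g.t a * g.v y) (g.v y * g.t a + g.ox (C.d a) y)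
  | xo_ox (ω : Ω) (y : 𝔛) :
      IRRel C P g (∑ i, g.xo (P.xL i) ω * g.ox (P.ωL i) y) (g.s (P.evR ω y))
  | ox_xo (x : 𝔛) (ω : Ω) :
      IRRel C P g (∑ j, g.ox ω (P.yR j) * g.xo x (P.ηR j)) (g.t (P.evL x ω))

/-- The additional relations of `IIR(Ω)`. -/
inductive IIRRel (P : PivotalDual A Ω 𝔛) {R : Type*} [Ring R] (g : Gens A Ω 𝔛 R) : R → R → Prop
  | ox_xo (x : 𝔛) (ω : Ω) :
      IIRRel P g (∑ j, g.ox (P.ηR j) x * g.xo (P.yR j) ω) (g.s (P.evL x ω))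
  | xo_ox (ω : Ω) (x : 𝔛) :
      IIRRel P g (∑ i, g.xo x (P.ωL i) * g.ox ω (P.xL i)) (g.t (P.evR ω x))

/-- The algebra `IL(Ω)`. -/
abbrev IL (C : StarFODC A Ω) (P : PivotalDual A Ω 𝔛) : Type _ :=
  RingQuot (ILRel C P (freeGens A Ω 𝔛))

/-- The generators of `IL(Ω)`. -/
def ILGens (C : StarFODC A Ω) (P : PivotalDual A Ω 𝔛) : Gens A Ω 𝔛 (IL C P) :=
  (freeGens A Ω 𝔛).map (RingQuot.mkAlgHom ℂ _)

/-- The algebra `IIL(Ω)`, a quotient of `IL(Ω)`. -/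
abbrev IIL (C : StarFODC A Ω) (P : PivotalDual A Ω 𝔛) : Type _ :=
  RingQuot (IILRel P (ILGens C P))

/-- The projection `IL(Ω) → IIL(Ω)`. -/
def ILProj (C : StarFODC A Ω) (P : PivotalDual A Ω 𝔛) : IL C P →ₐ[ℂ] IIL C P :=
  RingQuot.mkAlgHom ℂ _

/-- The generators of `IIL(Ω)`. -/
def IILGens (C : StarFODC A Ω) (P : PivotalDual A Ω 𝔛) : Gens A Ω 𝔛 (IIL C P) :=
  (ILGens C P).map (ILProj C P)

/-- The algebra `IR(Ω)`. -/
abbrev IR (C : StarFODC A Ω) (P : PivotalDual A Ω 𝔛) : Type _ :=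
  RingQuot (IRRel C P (freeGens A Ω 𝔛))

/-- The generators of `IR(Ω)`. -/
def IRGens (C : StarFODC A Ω) (P : PivotalDual A Ω 𝔛) : Gens A Ω 𝔛 (IR C P) :=
  (freeGens A Ω 𝔛).map (RingQuot.mkAlgHom ℂ _)

/-- The algebra `IIR(Ω)`, a quotient of `IR(Ω)`. -/
abbrev IIR (C : StarFODC A Ω) (P : PivotalDual A Ω 𝔛) : Type _ :=
  RingQuot (IIRRel P (IRGens C P))

/-- The projection `IR(Ω) → IIR(Ω)`. -/
def IRProj (C : StarFODC A Ω) (P : PivotalDual A Ω 𝔛) : IR C P →ₐ[ℂ] IIR C P :=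
  RingQuot.mkAlgHom ℂ _

/-- The generators of `IIR(Ω)`. -/
def IIRGens (C : StarFODC A Ω) (P : PivotalDual A Ω 𝔛) : Gens A Ω 𝔛 (IIR C P) :=
  (IRGens C P).map (IRProj C P)

/-! ### The structure maps on generators -/

/-- The left bialgebroid `H` has Ghobadi's structure maps on the generators `g`. -/
structure IsGhobadiLeft (P : PivotalDual A Ω 𝔛) {L : Type*} [Ring L] [Algebra ℂ L]
    (g : Gens A Ω 𝔛 L) (H : LeftBialgebroid A L) : Prop where
  s_eq : ∀ a, H.s a = g.s a
  t_eq : ∀ a, H.t (.op a) = g.t a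
  comul_s : ∀ a, H.comul (g.s a) = H.proj (g.s a ⊗ₜ[ℂ] 1)
  comul_t : ∀ a, H.comul (g.t a) = H.proj (1 ⊗ₜ[ℂ] g.t a)
  comul_v : ∀ x, H.comul (g.v x) =
    H.proj (g.v x ⊗ₜ[ℂ] 1 + ∑ i, g.xo x (P.ωL i) ⊗ₜ[ℂ] g.v (P.xL i))
  comul_xo : ∀ x ω, H.comul (g.xo x ω) = H.proj (∑ i, g.xo x (P.ωL i) ⊗ₜ[ℂ] g.xo (P.xL i) ω)
  comul_ox : ∀ ω y, H.comul (g.ox ω y) = H.proj (∑ j, g.ox ω (P.yR j) ⊗ₜ[ℂ] g.ox (P.ηR j) y)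
  counit_s : ∀ a, H.counit (g.s a) = a
  counit_t : ∀ a, H.counit (g.t a) = a
  counit_v : ∀ x, H.counit (g.v x) = 0
  counit_xo : ∀ x ω, H.counit (g.xo x ω) = P.evL x ω
  counit_ox : ∀ ω y, H.counit (g.ox ω y) = P.evR ω y

/-- The right bialgebroid `H` has the structure maps of the mirror construction on the
generators `g`. -/
structure IsGhobadiRight (P : PivotalDual A Ω 𝔛) {R : Type*} [Ring R] [Algebra ℂ R]
    (g : Gens A Ω 𝔛 R) (H : RightBialgebroid A R) : Prop where
  s_eq : ∀ a, H.s a = g.s a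
  t_eq : ∀ a, H.t (.op a) = g.t a
  comul_s : ∀ a, H.comul (g.s a) = H.proj (1 ⊗ₜ[ℂ] g.s a)
  comul_t : ∀ a, H.comul (g.t a) = H.proj (g.t a ⊗ₜ[ℂ] 1)
  comul_v : ∀ y, H.comul (g.v y) =
    H.proj (1 ⊗ₜ[ℂ] g.v y + ∑ j, g.v (P.yR j) ⊗ₜ[ℂ] g.ox (P.ηR j) y)
  comul_ox : ∀ ω y, H.comul (g.ox ω y) = H.proj (∑ j, g.ox ω (P.yR j) ⊗ₜ[ℂ] g.ox (P.ηR j) y)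
  comul_xo : ∀ x ω, H.comul (g.xo x ω) = H.proj (∑ i, g.xo x (P.ωL i) ⊗ₜ[ℂ] g.xo (P.xL i) ω)
  counit_s : ∀ a, H.counit (g.s a) = a
  counit_t : ∀ a, H.counit (g.t a) = a
  counit_v : ∀ y, H.counit (g.v y) = 0
  counit_ox : ∀ ω y, H.counit (g.ox ω y) = P.evR ω y
  counit_xo : ∀ x ω, H.counit (g.xo x ω) = P.evL x ω

/-- The values of `⊛` on generators. -/
structure IsGhobadiStar (P : PivotalDual A Ω 𝔛) {L R : Type*} [Ring L] [Ring R]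
    (g : Gens A Ω 𝔛 L) (h : Gens A Ω 𝔛 R) (st : L → R) : Prop where
  star_s : ∀ a, st (g.s a) = h.s (star a)
  star_t : ∀ a, st (g.t a) = h.t (star a)
  star_v : ∀ x, st (g.v x) = h.v (P.fieldStar x)
  star_t_v : ∀ a x, st (g.t a * g.v x) = h.v (P.fieldStar x) * h.t (star a)
  star_xo : ∀ x ω, st (g.xo x ω) = h.ox (star ω) (P.fieldStar x)
  star_ox : ∀ ω y, st (g.ox ω y) = h.xo (P.fieldStarInv y) (star ω)

/-- The values of `Φ` on generators. -/
structure IsGhobadiPhi (P : PivotalDual A Ω 𝔛) {L R : Type*} [Ring L] [Ring R]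
    (g : Gens A Ω 𝔛 L) (h : Gens A Ω 𝔛 R) (Φ : L → R) : Prop where
  phi_st : ∀ a b, Φ (g.s a * g.t b) = h.t a * h.s b
  phi_xo : ∀ x ω, Φ (g.xo x ω) = h.xo x ω
  phi_ox : ∀ ω y, Φ (g.ox ω y) = h.ox ω y
  phi_ox_v : ∀ y, Φ (∑ i, g.ox (P.ωL i) y * g.v (P.xL i)) = h.v y
  phi_v : ∀ x, Φ (g.v x) = ∑ j, h.v (P.yR j) * h.xo x (P.ηR j)

end Algebras

end

set_option linter.unusedSimpArgs false
set_option linter.unusedSectionVars false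

open scoped TensorProduct

noncomputable section

open MulOpposite (op unop)

/-! All four algebras are given by generators and relations, so every structure map has to come from
a universal property: prescribe values on generators in some algebra and verify the relations there.
The main difficulty is to find, for each map, an honest algebra to serve as target.

For the anti-multiplicative maps it is an opposite algebra. Φ and its candidate inverse are algebra
maps into opposites, mutually inverse on generators by the snake identities (`exists_phi`). The map
⊛ is an algebra map into the opposite with conjugated scalars. The composite θ = Φ⁻¹ ∘ ⊛ is
multiplicative, and θ² = id can be checked on generators; this single identity gives both the
bijectivity of ⊛ and Φ⁻¹ ∘ ⊛ = ⊛⁻¹ ∘ Φ (`exists_star`).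

The coproduct is harder, since L ⊗_A L is not an algebra. It is however B/I for the algebra B = L ⊗
L and a right ideal I, so the idealizer {b | bI ⊆ I} acts on B/I by left multiplication, and
elements congruent modulo I act in the same way. Membership in the idealizer is the Takeuchi
condition. The coproduct is therefore built as an algebra map L → End(B/I) and then evaluated at the
class of 1: the relations need only hold modulo I, and multiplicativity and the Takeuchi axiom are
automatic. The counit is ε(X) = X·1 for a representation of L on A in which a field x acts by b ↦
ev^L(x, db). Counitality and coassociativity are stable under sums and products, hence reduce to
generators (`exists_leftBialgebroid`).

For the left Hopf property, surjectivity of the canonical map reduces to hitting X ⊗ 1 for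
generators X. Injectivity uses the translation map, which is anti-multiplicative and is constructed
by the same idealizer device inside L^op ⊗ L. This is where the relations of IIL that are absent
from IL become indispensable.

The rest is transport. The right bialgebroid is the image of the left one under Φ, so reflexivity is
built in. Once ⊛ is known to relate the two sides, θ is an antilinear automorphism of L exchanging
source and target and flipping the coproduct, so left Hopf implies anti-left Hopf; Φ then carries
both properties to R. Compatibility of the pivotal structure with * serves to make ⊛ respect the
extra relations of IIL. -/

/-! ### Families of generators of an algebra -/

section Generates

variable {A Ω 𝔛 : Type*} {L L' : Type*} [Ring L] [Algebra ℂ L] [Ring L'] [Algebra ℂ L']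

/-- Every subalgebra containing the family `g` is the whole algebra. -/
def Gens.Generates (g : Gens A Ω 𝔛 L) : Prop :=
  ∀ S : Subalgebra ℂ L, (∀ a, g.s a ∈ S) → (∀ a, g.t a ∈ S) → (∀ x, g.v x ∈ S) →
    (∀ x ω, g.xo x ω ∈ S) → (∀ ω y, g.ox ω y ∈ S) → ∀ X, X ∈ S

/-- The algebra map from the free algebra with prescribed values on the generators. -/
def Gens.freeLift (g : Gens A Ω 𝔛 L) : GhobadiFree A Ω 𝔛 →ₐ[ℂ] L :=
  FreeAlgebra.lift ℂ fun
    | .s a => g.s a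
    | .t a => g.t a
    | .v x => g.v x
    | .xo x ω => g.xo x ω
    | .ox ω y => g.ox ω y

theorem Gens.map_freeLift (g : Gens A Ω 𝔛 L) : (freeGens A Ω 𝔛).map g.freeLift = g := by
  simp [Gens.map, freeGens, Gens.freeLift]

theorem freeGens_generates : (freeGens A Ω 𝔛).Generates := by
  intro S hs ht hv hxo hox X
  induction X using FreeAlgebra.induction with
  | grade0 r => exact S.algebraMap_mem r
  | grade1 x => cases x <;> simp_all [freeGens]
  | mul a b ha hb => exact S.mul_mem ha hb
  | add a b ha hb => exact S.add_mem ha hb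

theorem Gens.Generates.map {g : Gens A Ω 𝔛 L} (h : g.Generates) (f : L →ₐ[ℂ] L')
    (hf : Function.Surjective f) : (g.map f).Generates := by
  intro S hs ht hv hxo hox X
  obtain ⟨X, rfl⟩ := hf X
  exact h (S.comap f) hs ht hv hxo hox X

end Generates

section Basic

variable {A Ω 𝔛 : Type*} [Ring A] [Algebra ℂ A] [AddCommGroup Ω] [Module ℂ Ω]
  [AddCommGroup 𝔛] [Module ℂ 𝔛] {L L' : Type*} [Ring L] [Algebra ℂ L] [Ring L'] [Algebra ℂ L']

/-- The family `g` satisfies the relations `BasicRel`. -/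
def Gens.Basic (g : Gens A Ω 𝔛 L) : Prop := ∀ ⦃X Y : L⦄, BasicRel g X Y → X = Y

namespace Gens.Basic

variable {g : Gens A Ω 𝔛 L}

theorem s_add (h : g.Basic) (a b : A) : g.s (a + b) = g.s a + g.s b := h (.s_add a b)
theorem s_mul (h : g.Basic) (a b : A) : g.s (a * b) = g.s a * g.s b := h (.s_mul a b)
theorem s_scalar (h : g.Basic) (c : ℂ) : g.s (algebraMap ℂ A c) = algebraMap ℂ L c :=
  h (.s_scalar c)
theorem t_add (h : g.Basic) (a b : A) : g.t (a + b) = g.t a + g.t b := h (.t_add a b)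
theorem t_mul (h : g.Basic) (a b : A) : g.t (a * b) = g.t b * g.t a := h (.t_mul a b)
theorem t_scalar (h : g.Basic) (c : ℂ) : g.t (algebraMap ℂ A c) = algebraMap ℂ L c :=
  h (.t_scalar c)
theorem s_t (h : g.Basic) (a b : A) : g.s a * g.t b = g.t b * g.s a := h (.s_t a b)
theorem v_add (h : g.Basic) (x y : 𝔛) : g.v (x + y) = g.v x + g.v y := h (.v_add x y)
theorem v_smul (h : g.Basic) (c : ℂ) (x : 𝔛) : g.v (c • x) = c • g.v x := h (.v_smul c x)
theorem xo_add_left (h : g.Basic) (x y : 𝔛) (ω : Ω) : g.xo (x + y) ω = g.xo x ω + g.xo y ω :=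
  h (.xo_add_left x y ω)
theorem xo_add_right (h : g.Basic) (x : 𝔛) (ω η : Ω) : g.xo x (ω + η) = g.xo x ω + g.xo x η :=
  h (.xo_add_right x ω η)
theorem xo_smul_left (h : g.Basic) (c : ℂ) (x : 𝔛) (ω : Ω) : g.xo (c • x) ω = c • g.xo x ω :=
  h (.xo_smul_left c x ω)
theorem xo_smul_right (h : g.Basic) (c : ℂ) (x : 𝔛) (ω : Ω) : g.xo x (c • ω) = c • g.xo x ω :=
  h (.xo_smul_right c x ω)
theorem ox_add_left (h : g.Basic) (ω η : Ω) (y : 𝔛) : g.ox (ω + η) y = g.ox ω y + g.ox η y :=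
  h (.ox_add_left ω η y)
theorem ox_add_right (h : g.Basic) (ω : Ω) (x y : 𝔛) : g.ox ω (x + y) = g.ox ω x + g.ox ω y :=
  h (.ox_add_right ω x y)
theorem ox_smul_left (h : g.Basic) (c : ℂ) (ω : Ω) (y : 𝔛) : g.ox (c • ω) y = c • g.ox ω y :=
  h (.ox_smul_left c ω y)
theorem ox_smul_right (h : g.Basic) (c : ℂ) (ω : Ω) (y : 𝔛) : g.ox ω (c • y) = c • g.ox ω y :=
  h (.ox_smul_right c ω y)

theorem s_one (h : g.Basic) : g.s 1 = 1 := by simpa using h.s_scalar 1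
theorem t_one (h : g.Basic) : g.t 1 = 1 := by simpa using h.t_scalar 1

theorem s_smul (h : g.Basic) (c : ℂ) (a : A) : g.s (c • a) = c • g.s a := by
  rw [Algebra.smul_def, h.s_mul, h.s_scalar, ← Algebra.smul_def]

theorem t_smul (h : g.Basic) (c : ℂ) (a : A) : g.t (c • a) = c • g.t a := by
  rw [Algebra.smul_def, h.t_mul, h.t_scalar, ← Algebra.commutes, ← Algebra.smul_def]

theorem v_sum (h : g.Basic) {ι : Type*} (s : Finset ι) (f : ι → 𝔛) :
    g.v (∑ i ∈ s, f i) = ∑ i ∈ s, g.v (f i) :=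
  map_sum (AddMonoidHom.mk' g.v h.v_add) f s

theorem xo_sum_left (h : g.Basic) {ι : Type*} (s : Finset ι) (f : ι → 𝔛) (ω : Ω) :
    g.xo (∑ i ∈ s, f i) ω = ∑ i ∈ s, g.xo (f i) ω :=
  map_sum (AddMonoidHom.mk' (fun x => g.xo x ω) fun x y => h.xo_add_left x y ω) f s

theorem xo_sum_right (h : g.Basic) {ι : Type*} (s : Finset ι) (f : ι → Ω) (x : 𝔛) :
    g.xo x (∑ i ∈ s, f i) = ∑ i ∈ s, g.xo x (f i) :=
  map_sum (AddMonoidHom.mk' (g.xo x) (h.xo_add_right x)) f s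

theorem ox_sum_left (h : g.Basic) {ι : Type*} (s : Finset ι) (f : ι → Ω) (y : 𝔛) :
    g.ox (∑ i ∈ s, f i) y = ∑ i ∈ s, g.ox (f i) y :=
  map_sum (AddMonoidHom.mk' (fun x => g.ox x y) fun ω η => h.ox_add_left ω η y) f s

theorem ox_sum_right (h : g.Basic) {ι : Type*} (s : Finset ι) (f : ι → 𝔛) (ω : Ω) :
    g.ox ω (∑ i ∈ s, f i) = ∑ i ∈ s, g.ox ω (f i) :=
  map_sum (AddMonoidHom.mk' (g.ox ω) (h.ox_add_right ω)) f s

/-- The algebra map `a ↦ g.s a`. -/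
def sHom (h : g.Basic) : A →ₐ[ℂ] L where
  toFun := g.s
  map_one' := h.s_one
  map_mul' := h.s_mul
  map_zero' := by simpa using h.s_smul 0 0
  map_add' := h.s_add
  commutes' := h.s_scalar

/-- The anti-algebra map `a ↦ g.t a`. -/
def tHom (h : g.Basic) : Aᵐᵒᵖ →ₐ[ℂ] L where
  toFun a := g.t a.unop
  map_one' := h.t_one
  map_mul' a b := h.t_mul _ _
  map_zero' := by simpa using h.t_smul 0 0
  map_add' a b := h.t_add _ _
  commutes' := h.t_scalar

end Gens.Basic

theorem BasicRel.map_algHom {g : Gens A Ω 𝔛 L} (f : L →ₐ[ℂ] L')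
    {X Y : L} (h : BasicRel g X Y) : BasicRel (g.map f) (f X) (f Y) := by
  cases h <;> simp only [map_mul, map_add, map_smul, AlgHom.commutes] <;> constructor

/-- Instances of the relations are indexed by elements of A, Ω and 𝔛 alone, so an instance for image
generators is always the image of an instance for the original ones. Hence algebra maps, injective
or not, carry families satisfying the relations to families satisfying them. -/
theorem BasicRel.exists_of_map {g : Gens A Ω 𝔛 L} (f : L →ₐ[ℂ] L')
    {X Y : L'} (h : BasicRel (g.map f) X Y) : ∃ X' Y', BasicRel g X' Y' ∧ f X' = X ∧ f Y' = Y := by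
  cases h with
  | s_add u v => exact ⟨_, _, .s_add u v, by simp [Gens.map], by simp [Gens.map]⟩
  | s_mul u v => exact ⟨_, _, .s_mul u v, by simp [Gens.map], by simp [Gens.map]⟩
  | s_scalar u => exact ⟨_, _, .s_scalar u, by simp [Gens.map], by simp [Gens.map]⟩
  | t_add u v => exact ⟨_, _, .t_add u v, by simp [Gens.map], by simp [Gens.map]⟩
  | t_mul u v => exact ⟨_, _, .t_mul u v, by simp [Gens.map], by simp [Gens.map]⟩
  | t_scalar u => exact ⟨_, _, .t_scalar u, by simp [Gens.map], by simp [Gens.map]⟩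
  | s_t u v => exact ⟨_, _, .s_t u v, by simp [Gens.map], by simp [Gens.map]⟩
  | v_add u v => exact ⟨_, _, .v_add u v, by simp [Gens.map], by simp [Gens.map]⟩
  | v_smul u v => exact ⟨_, _, .v_smul u v, by simp [Gens.map], by simp [Gens.map]⟩
  | xo_add_left u v w => exact ⟨_, _, .xo_add_left u v w, by simp [Gens.map], by simp [Gens.map]⟩
  | xo_add_right u v w => exact ⟨_, _, .xo_add_right u v w, by simp [Gens.map], by simp [Gens.map]⟩
  | xo_smul_left u v w => exact ⟨_, _, .xo_smul_left u v w, by simp [Gens.map], by simp [Gens.map]⟩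
  | xo_smul_right u v w => exact ⟨_, _, .xo_smul_right u v w, by simp [Gens.map], by simp [Gens.map]⟩
  | ox_add_left u v w => exact ⟨_, _, .ox_add_left u v w, by simp [Gens.map], by simp [Gens.map]⟩
  | ox_add_right u v w => exact ⟨_, _, .ox_add_right u v w, by simp [Gens.map], by simp [Gens.map]⟩
  | ox_smul_left u v w => exact ⟨_, _, .ox_smul_left u v w, by simp [Gens.map], by simp [Gens.map]⟩
  | ox_smul_right u v w => exact ⟨_, _, .ox_smul_right u v w, by simp [Gens.map], by simp [Gens.map]⟩

end Basic

/-! ### The relations of the four algebras -/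

section SecondRelations

variable {A Ω 𝔛 : Type*} [Ring A] [Algebra ℂ A]
  [AddCommGroup Ω] [Module ℂ Ω] [Module A Ω] [Module Aᵐᵒᵖ Ω]
  [AddCommGroup 𝔛] [Module ℂ 𝔛] [Module A 𝔛] [Module Aᵐᵒᵖ 𝔛]

section

variable {L : Type*} [Ring L]

/-- The family `g` satisfies the additional relations of `IIL(Ω)`. -/
def Gens.SatIIL (P : PivotalDual A Ω 𝔛) (g : Gens A Ω 𝔛 L) : Prop :=
  ∀ ⦃X Y : L⦄, IILRel P g X Y → X = Y

/-- The family `g` satisfies the additional relations of `IIR(Ω)`. -/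
def Gens.SatIIR (P : PivotalDual A Ω 𝔛) (g : Gens A Ω 𝔛 L) : Prop :=
  ∀ ⦃X Y : L⦄, IIRRel P g X Y → X = Y

namespace Gens.SatIIL

variable {g : Gens A Ω 𝔛 L} {P : PivotalDual A Ω 𝔛}

theorem xo_ox (h : g.SatIIL P) (x : 𝔛) (ω : Ω) :
    ∑ j, g.xo (P.yR j) ω * g.ox (P.ηR j) x = g.t (P.evL x ω) := h (.xo_ox x ω)
theorem ox_xo (h : g.SatIIL P) (ω : Ω) (x : 𝔛) :
    ∑ i, g.ox ω (P.xL i) * g.xo x (P.ωL i) = g.s (P.evR ω x) := h (.ox_xo ω x)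

end Gens.SatIIL

namespace Gens.SatIIR

variable {g : Gens A Ω 𝔛 L} {P : PivotalDual A Ω 𝔛}

theorem ox_xo (h : g.SatIIR P) (x : 𝔛) (ω : Ω) :
    ∑ j, g.ox (P.ηR j) x * g.xo (P.yR j) ω = g.s (P.evL x ω) := h (.ox_xo x ω)
theorem xo_ox (h : g.SatIIR P) (ω : Ω) (x : 𝔛) :
    ∑ i, g.xo x (P.ωL i) * g.ox ω (P.xL i) = g.t (P.evR ω x) := h (.xo_ox ω x)

end Gens.SatIIR

end

variable {L L' : Type*} [Ring L] [Algebra ℂ L] [Ring L'] [Algebra ℂ L']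

theorem IILRel.map_algHom {P : PivotalDual A Ω 𝔛} {g : Gens A Ω 𝔛 L} (f : L →ₐ[ℂ] L')
    {X Y : L} (h : IILRel P g X Y) : IILRel P (g.map f) (f X) (f Y) := by
  cases h <;> simp only [map_mul, map_sum] <;> constructor

theorem IILRel.exists_of_map {P : PivotalDual A Ω 𝔛} {g : Gens A Ω 𝔛 L} (f : L →ₐ[ℂ] L')
    {X Y : L'} (h : IILRel P (g.map f) X Y) : ∃ X' Y', IILRel P g X' Y' ∧ f X' = X ∧ f Y' = Y := by
  cases h with
  | xo_ox u v => exact ⟨_, _, .xo_ox u v, by simp [Gens.map], by simp [Gens.map]⟩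
  | ox_xo u v => exact ⟨_, _, .ox_xo u v, by simp [Gens.map], by simp [Gens.map]⟩

theorem IIRRel.map_algHom {P : PivotalDual A Ω 𝔛} {g : Gens A Ω 𝔛 L} (f : L →ₐ[ℂ] L')
    {X Y : L} (h : IIRRel P g X Y) : IIRRel P (g.map f) (f X) (f Y) := by
  cases h <;> simp only [map_mul, map_sum] <;> constructor

theorem IIRRel.exists_of_map {P : PivotalDual A Ω 𝔛} {g : Gens A Ω 𝔛 L} (f : L →ₐ[ℂ] L')
    {X Y : L'} (h : IIRRel P (g.map f) X Y) : ∃ X' Y', IIRRel P g X' Y' ∧ f X' = X ∧ f Y' = Y := by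
  cases h with
  | xo_ox u v => exact ⟨_, _, .xo_ox u v, by simp [Gens.map], by simp [Gens.map]⟩
  | ox_xo u v => exact ⟨_, _, .ox_xo u v, by simp [Gens.map], by simp [Gens.map]⟩

end SecondRelations

section Relations

variable {A Ω 𝔛 : Type*} [Ring A] [Algebra ℂ A] [StarRing A]
  [AddCommGroup Ω] [Module ℂ Ω] [Module A Ω] [Module Aᵐᵒᵖ Ω] [StarAddMonoid Ω]
  [AddCommGroup 𝔛] [Module ℂ 𝔛] [Module A 𝔛] [Module Aᵐᵒᵖ 𝔛]
  {L L' : Type*} [Ring L] [Algebra ℂ L] [Ring L'] [Algebra ℂ L']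

/-- The family `g` satisfies the relations of `IL(Ω)`. -/
def Gens.SatIL (C : StarFODC A Ω) (P : PivotalDual A Ω 𝔛) (g : Gens A Ω 𝔛 L) : Prop :=
  ∀ ⦃X Y : L⦄, ILRel C P g X Y → X = Y

/-- The family `g` satisfies the relations of `IR(Ω)`. -/
def Gens.SatIR (C : StarFODC A Ω) (P : PivotalDual A Ω 𝔛) (g : Gens A Ω 𝔛 L) : Prop :=
  ∀ ⦃X Y : L⦄, IRRel C P g X Y → X = Y

namespace Gens.SatIL

variable {g : Gens A Ω 𝔛 L} {C : StarFODC A Ω} {P : PivotalDual A Ω 𝔛}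

theorem basic (h : g.SatIL C P) : g.Basic := fun _ _ r => h (.basic r)
theorem s_xo (h : g.SatIL C P) (a : A) (x : 𝔛) (ω : Ω) : g.s a * g.xo x ω = g.xo (a • x) ω :=
  h (.s_xo a x ω)
theorem xo_s (h : g.SatIL C P) (a : A) (x : 𝔛) (ω : Ω) :
    g.xo x ω * g.s a = g.xo (MulOpposite.op a • x) ω := h (.xo_s a x ω)
theorem t_xo (h : g.SatIL C P) (a : A) (x : 𝔛) (ω : Ω) :
    g.t a * g.xo x ω = g.xo x (MulOpposite.op a • ω) := h (.t_xo a x ω)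
theorem xo_t (h : g.SatIL C P) (a : A) (x : 𝔛) (ω : Ω) : g.xo x ω * g.t a = g.xo x (a • ω) :=
  h (.xo_t a x ω)
theorem s_ox (h : g.SatIL C P) (a : A) (ω : Ω) (y : 𝔛) : g.s a * g.ox ω y = g.ox (a • ω) y :=
  h (.s_ox a ω y)
theorem ox_s (h : g.SatIL C P) (a : A) (ω : Ω) (y : 𝔛) :
    g.ox ω y * g.s a = g.ox (MulOpposite.op a • ω) y := h (.ox_s a ω y)
theorem t_ox (h : g.SatIL C P) (a : A) (ω : Ω) (y : 𝔛) :
    g.t a * g.ox ω y = g.ox ω (MulOpposite.op a • y) := h (.t_ox a ω y)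
theorem ox_t (h : g.SatIL C P) (a : A) (ω : Ω) (y : 𝔛) : g.ox ω y * g.t a = g.ox ω (a • y) :=
  h (.ox_t a ω y)
theorem s_v (h : g.SatIL C P) (a : A) (x : 𝔛) : g.s a * g.v x = g.v (a • x) := h (.s_v a x)
theorem v_s (h : g.SatIL C P) (a : A) (x : 𝔛) :
    g.v x * g.s a = g.v (MulOpposite.op a • x) + g.s (P.evL x (C.d a)) := h (.v_s a x)
theorem v_t (h : g.SatIL C P) (a : A) (x : 𝔛) :
    g.v x * g.t a = g.t a * g.v x + g.xo x (C.d a) := h (.v_t a x)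
theorem ox_xo (h : g.SatIL C P) (ω : Ω) (y : 𝔛) :
    ∑ i, g.ox (P.ωL i) y * g.xo (P.xL i) ω = g.t (P.evR ω y) := h (.ox_xo ω y)
theorem xo_ox (h : g.SatIL C P) (x : 𝔛) (ω : Ω) :
    ∑ j, g.xo x (P.ηR j) * g.ox ω (P.yR j) = g.s (P.evL x ω) := h (.xo_ox x ω)

end Gens.SatIL

namespace Gens.SatIR

variable {g : Gens A Ω 𝔛 L} {C : StarFODC A Ω} {P : PivotalDual A Ω 𝔛}

theorem basic (h : g.SatIR C P) : g.Basic := fun _ _ r => h (.basic r)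
theorem s_ox (h : g.SatIR C P) (a : A) (ω : Ω) (y : 𝔛) : g.s a * g.ox ω y = g.ox ω (a • y) :=
  h (.s_ox a ω y)
theorem ox_s (h : g.SatIR C P) (a : A) (ω : Ω) (y : 𝔛) :
    g.ox ω y * g.s a = g.ox ω (MulOpposite.op a • y) := h (.ox_s a ω y)
theorem t_ox (h : g.SatIR C P) (a : A) (ω : Ω) (y : 𝔛) :
    g.t a * g.ox ω y = g.ox (MulOpposite.op a • ω) y := h (.t_ox a ω y)
theorem ox_t (h : g.SatIR C P) (a : A) (ω : Ω) (y : 𝔛) : g.ox ω y * g.t a = g.ox (a • ω) y :=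
  h (.ox_t a ω y)
theorem s_xo (h : g.SatIR C P) (a : A) (x : 𝔛) (ω : Ω) : g.s a * g.xo x ω = g.xo x (a • ω) :=
  h (.s_xo a x ω)
theorem xo_s (h : g.SatIR C P) (a : A) (x : 𝔛) (ω : Ω) :
    g.xo x ω * g.s a = g.xo x (MulOpposite.op a • ω) := h (.xo_s a x ω)
theorem t_xo (h : g.SatIR C P) (a : A) (x : 𝔛) (ω : Ω) :
    g.t a * g.xo x ω = g.xo (MulOpposite.op a • x) ω := h (.t_xo a x ω)
theorem xo_t (h : g.SatIR C P) (a : A) (x : 𝔛) (ω : Ω) : g.xo x ω * g.t a = g.xo (a • x) ω :=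
  h (.xo_t a x ω)
theorem v_s (h : g.SatIR C P) (a : A) (y : 𝔛) : g.v y * g.s a = g.v (MulOpposite.op a • y) :=
  h (.v_s a y)
theorem s_v (h : g.SatIR C P) (a : A) (y : 𝔛) :
    g.s a * g.v y = g.v (a • y) + g.s (P.evR (C.d a) y) := h (.s_v a y)
theorem t_v (h : g.SatIR C P) (a : A) (y : 𝔛) :
    g.t a * g.v y = g.v y * g.t a + g.ox (C.d a) y := h (.t_v a y)
theorem xo_ox (h : g.SatIR C P) (ω : Ω) (y : 𝔛) :
    ∑ i, g.xo (P.xL i) ω * g.ox (P.ωL i) y = g.s (P.evR ω y) := h (.xo_ox ω y)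
theorem ox_xo (h : g.SatIR C P) (x : 𝔛) (ω : Ω) :
    ∑ j, g.ox ω (P.yR j) * g.xo x (P.ηR j) = g.t (P.evL x ω) := h (.ox_xo x ω)

end Gens.SatIR

theorem ILRel.map_algHom {C : StarFODC A Ω} {P : PivotalDual A Ω 𝔛}
    {g : Gens A Ω 𝔛 L} (f : L →ₐ[ℂ] L')
    {X Y : L} (h : ILRel C P g X Y) : ILRel C P (g.map f) (f X) (f Y) := by
  cases h with
  | basic h => exact .basic (h.map_algHom f)
  | s_xo => simp only [map_mul, map_add, map_sum]; exact .s_xo _ _ _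
  | xo_s => simp only [map_mul, map_add, map_sum]; exact .xo_s _ _ _
  | t_xo => simp only [map_mul, map_add, map_sum]; exact .t_xo _ _ _
  | xo_t => simp only [map_mul, map_add, map_sum]; exact .xo_t _ _ _
  | s_ox => simp only [map_mul, map_add, map_sum]; exact .s_ox _ _ _
  | ox_s => simp only [map_mul, map_add, map_sum]; exact .ox_s _ _ _
  | t_ox => simp only [map_mul, map_add, map_sum]; exact .t_ox _ _ _
  | ox_t => simp only [map_mul, map_add, map_sum]; exact .ox_t _ _ _
  | s_v => simp only [map_mul, map_add, map_sum]; exact .s_v _ _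
  | v_s => simp only [map_mul, map_add, map_sum]; exact .v_s _ _
  | v_t => simp only [map_mul, map_add, map_sum]; exact .v_t _ _
  | ox_xo => simp only [map_mul, map_add, map_sum]; exact .ox_xo _ _
  | xo_ox => simp only [map_mul, map_add, map_sum]; exact .xo_ox _ _

theorem ILRel.exists_of_map {C : StarFODC A Ω} {P : PivotalDual A Ω 𝔛}
    {g : Gens A Ω 𝔛 L} (f : L →ₐ[ℂ] L')
    {X Y : L'} (h : ILRel C P (g.map f) X Y) : ∃ X' Y', ILRel C P g X' Y' ∧ f X' = X ∧ f Y' = Y := by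
  cases h with
  | basic h =>
    obtain ⟨X', Y', r, hX, hY⟩ := h.exists_of_map f
    exact ⟨X', Y', .basic r, hX, hY⟩
  | s_xo u v w => exact ⟨_, _, .s_xo u v w, by simp [Gens.map], by simp [Gens.map]⟩
  | xo_s u v w => exact ⟨_, _, .xo_s u v w, by simp [Gens.map], by simp [Gens.map]⟩
  | t_xo u v w => exact ⟨_, _, .t_xo u v w, by simp [Gens.map], by simp [Gens.map]⟩
  | xo_t u v w => exact ⟨_, _, .xo_t u v w, by simp [Gens.map], by simp [Gens.map]⟩
  | s_ox u v w => exact ⟨_, _, .s_ox u v w, by simp [Gens.map], by simp [Gens.map]⟩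
  | ox_s u v w => exact ⟨_, _, .ox_s u v w, by simp [Gens.map], by simp [Gens.map]⟩
  | t_ox u v w => exact ⟨_, _, .t_ox u v w, by simp [Gens.map], by simp [Gens.map]⟩
  | ox_t u v w => exact ⟨_, _, .ox_t u v w, by simp [Gens.map], by simp [Gens.map]⟩
  | s_v u v => exact ⟨_, _, .s_v u v, by simp [Gens.map], by simp [Gens.map]⟩
  | v_s u v => exact ⟨_, _, .v_s u v, by simp [Gens.map], by simp [Gens.map]⟩
  | v_t u v => exact ⟨_, _, .v_t u v, by simp [Gens.map], by simp [Gens.map]⟩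
  | ox_xo u v => exact ⟨_, _, .ox_xo u v, by simp [Gens.map], by simp [Gens.map]⟩
  | xo_ox u v => exact ⟨_, _, .xo_ox u v, by simp [Gens.map], by simp [Gens.map]⟩

theorem IRRel.map_algHom {C : StarFODC A Ω} {P : PivotalDual A Ω 𝔛}
    {g : Gens A Ω 𝔛 L} (f : L →ₐ[ℂ] L')
    {X Y : L} (h : IRRel C P g X Y) : IRRel C P (g.map f) (f X) (f Y) := by
  cases h with
  | basic h => exact .basic (h.map_algHom f)
  | s_ox => simp only [map_mul, map_add, map_sum]; exact .s_ox _ _ _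
  | ox_s => simp only [map_mul, map_add, map_sum]; exact .ox_s _ _ _
  | t_ox => simp only [map_mul, map_add, map_sum]; exact .t_ox _ _ _
  | ox_t => simp only [map_mul, map_add, map_sum]; exact .ox_t _ _ _
  | s_xo => simp only [map_mul, map_add, map_sum]; exact .s_xo _ _ _
  | xo_s => simp only [map_mul, map_add, map_sum]; exact .xo_s _ _ _
  | t_xo => simp only [map_mul, map_add, map_sum]; exact .t_xo _ _ _
  | xo_t => simp only [map_mul, map_add, map_sum]; exact .xo_t _ _ _
  | v_s => simp only [map_mul, map_add, map_sum]; exact .v_s _ _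
  | s_v => simp only [map_mul, map_add, map_sum]; exact .s_v _ _
  | t_v => simp only [map_mul, map_add, map_sum]; exact .t_v _ _
  | xo_ox => simp only [map_mul, map_add, map_sum]; exact .xo_ox _ _
  | ox_xo => simp only [map_mul, map_add, map_sum]; exact .ox_xo _ _

theorem IRRel.exists_of_map {C : StarFODC A Ω} {P : PivotalDual A Ω 𝔛}
    {g : Gens A Ω 𝔛 L} (f : L →ₐ[ℂ] L')
    {X Y : L'} (h : IRRel C P (g.map f) X Y) : ∃ X' Y', IRRel C P g X' Y' ∧ f X' = X ∧ f Y' = Y := by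
  cases h with
  | basic h =>
    obtain ⟨X', Y', r, hX, hY⟩ := h.exists_of_map f
    exact ⟨X', Y', .basic r, hX, hY⟩
  | s_ox u v w => exact ⟨_, _, .s_ox u v w, by simp [Gens.map], by simp [Gens.map]⟩
  | ox_s u v w => exact ⟨_, _, .ox_s u v w, by simp [Gens.map], by simp [Gens.map]⟩
  | t_ox u v w => exact ⟨_, _, .t_ox u v w, by simp [Gens.map], by simp [Gens.map]⟩
  | ox_t u v w => exact ⟨_, _, .ox_t u v w, by simp [Gens.map], by simp [Gens.map]⟩
  | s_xo u v w => exact ⟨_, _, .s_xo u v w, by simp [Gens.map], by simp [Gens.map]⟩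
  | xo_s u v w => exact ⟨_, _, .xo_s u v w, by simp [Gens.map], by simp [Gens.map]⟩
  | t_xo u v w => exact ⟨_, _, .t_xo u v w, by simp [Gens.map], by simp [Gens.map]⟩
  | xo_t u v w => exact ⟨_, _, .xo_t u v w, by simp [Gens.map], by simp [Gens.map]⟩
  | v_s u v => exact ⟨_, _, .v_s u v, by simp [Gens.map], by simp [Gens.map]⟩
  | s_v u v => exact ⟨_, _, .s_v u v, by simp [Gens.map], by simp [Gens.map]⟩
  | t_v u v => exact ⟨_, _, .t_v u v, by simp [Gens.map], by simp [Gens.map]⟩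
  | xo_ox u v => exact ⟨_, _, .xo_ox u v, by simp [Gens.map], by simp [Gens.map]⟩
  | ox_xo u v => exact ⟨_, _, .ox_xo u v, by simp [Gens.map], by simp [Gens.map]⟩

theorem Gens.SatIL.map {C : StarFODC A Ω} {P : PivotalDual A Ω 𝔛}
    {g : Gens A Ω 𝔛 L} (h : g.SatIL C P)
    (f : L →ₐ[ℂ] L') : (g.map f).SatIL C P := by
  intro X Y r
  obtain ⟨X, Y, r', rfl, rfl⟩ := r.exists_of_map f
  exact congrArg f (h r')

theorem Gens.SatIR.map {C : StarFODC A Ω} {P : PivotalDual A Ω 𝔛}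
    {g : Gens A Ω 𝔛 L} (h : g.SatIR C P)
    (f : L →ₐ[ℂ] L') : (g.map f).SatIR C P := by
  intro X Y r
  obtain ⟨X, Y, r', rfl, rfl⟩ := r.exists_of_map f
  exact congrArg f (h r')

/-! ### Universal properties -/

variable (C : StarFODC A Ω) (P : PivotalDual A Ω 𝔛)

theorem ILGens_generates : (ILGens C P).Generates :=
  freeGens_generates.map _ (RingQuot.mkAlgHom_surjective ℂ _)

theorem IILGens_generates : (IILGens C P).Generates :=
  (ILGens_generates C P).map _ (RingQuot.mkAlgHom_surjective ℂ _)

theorem IRGens_generates : (IRGens C P).Generates :=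
  freeGens_generates.map _ (RingQuot.mkAlgHom_surjective ℂ _)

theorem IIRGens_generates : (IIRGens C P).Generates :=
  (IRGens_generates C P).map _ (RingQuot.mkAlgHom_surjective ℂ _)

/-- A relation instance in the quotient lifts to the free algebra, where `RingQuot` imposes it. -/
theorem ILGens_sat : (ILGens C P).SatIL C P := by
  intro X Y r
  obtain ⟨X, Y, r', rfl, rfl⟩ := r.exists_of_map _
  exact RingQuot.mkAlgHom_rel ℂ r'

theorem IRGens_sat : (IRGens C P).SatIR C P := by
  intro X Y r
  obtain ⟨X, Y, r', rfl, rfl⟩ := r.exists_of_map _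
  exact RingQuot.mkAlgHom_rel ℂ r'

theorem IILGens_satIL : (IILGens C P).SatIL C P := (ILGens_sat C P).map _

theorem IIRGens_satIR : (IIRGens C P).SatIR C P := (IRGens_sat C P).map _

theorem IILGens_satIIL : (IILGens C P).SatIIL P := by
  intro X Y r
  obtain ⟨X, Y, r', rfl, rfl⟩ := r.exists_of_map _
  exact RingQuot.mkAlgHom_rel ℂ r'

theorem IIRGens_satIIR : (IIRGens C P).SatIIR P := by
  intro X Y r
  obtain ⟨X, Y, r', rfl, rfl⟩ := r.exists_of_map _
  exact RingQuot.mkAlgHom_rel ℂ r'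

variable {C P}

/-- The universal property of `IL(Ω)`. -/
def IL.lift {g : Gens A Ω 𝔛 L} (h : g.SatIL C P) : IL C P →ₐ[ℂ] L :=
  RingQuot.liftAlgHom ℂ ⟨g.freeLift, fun _ _ r => h (by
    simpa only [Gens.map_freeLift] using r.map_algHom g.freeLift)⟩

theorem IL.map_lift {g : Gens A Ω 𝔛 L} (h : g.SatIL C P) :
    (ILGens C P).map (IL.lift h) = g := by
  conv_rhs => rw [← Gens.map_freeLift g]
  simp [Gens.map, ILGens, IL.lift]

/-- The universal property of `IIL(Ω)`. -/
def IIL.lift {g : Gens A Ω 𝔛 L} (h : g.SatIL C P) (h' : g.SatIIL P) : IIL C P →ₐ[ℂ] L :=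
  RingQuot.liftAlgHom ℂ ⟨IL.lift h, fun _ _ r => h' (by
    simpa only [IL.map_lift] using r.map_algHom (IL.lift h))⟩

theorem IIL.lift_proj {g : Gens A Ω 𝔛 L} (h : g.SatIL C P) (h' : g.SatIIL P) (X : IL C P) :
    IIL.lift h h' (ILProj C P X) = IL.lift h X := by
  simp [IIL.lift, ILProj]

theorem IIL.map_lift {g : Gens A Ω 𝔛 L} (h : g.SatIL C P) (h' : g.SatIIL P) :
    (IILGens C P).map (IIL.lift h h') = g := by
  conv_rhs => rw [← IL.map_lift h]
  simp [Gens.map, IILGens, IIL.lift_proj]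

/-- The universal property of `IR(Ω)`. -/
def IR.lift {g : Gens A Ω 𝔛 L} (h : g.SatIR C P) : IR C P →ₐ[ℂ] L :=
  RingQuot.liftAlgHom ℂ ⟨g.freeLift, fun _ _ r => h (by
    simpa only [Gens.map_freeLift] using r.map_algHom g.freeLift)⟩

theorem IR.map_lift {g : Gens A Ω 𝔛 L} (h : g.SatIR C P) :
    (IRGens C P).map (IR.lift h) = g := by
  conv_rhs => rw [← Gens.map_freeLift g]
  simp [Gens.map, IRGens, IR.lift]

/-- The universal property of `IIR(Ω)`. -/
def IIR.lift {g : Gens A Ω 𝔛 L} (h : g.SatIR C P) (h' : g.SatIIR P) : IIR C P →ₐ[ℂ] L :=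
  RingQuot.liftAlgHom ℂ ⟨IR.lift h, fun _ _ r => h' (by
    simpa only [IR.map_lift] using r.map_algHom (IR.lift h))⟩

theorem IIR.lift_proj {g : Gens A Ω 𝔛 L} (h : g.SatIR C P) (h' : g.SatIIR P) (X : IR C P) :
    IIR.lift h h' (IRProj C P X) = IR.lift h X := by
  simp [IIR.lift, IRProj]

theorem IIR.map_lift {g : Gens A Ω 𝔛 L} (h : g.SatIR C P) (h' : g.SatIIR P) :
    (IIRGens C P).map (IIR.lift h h') = g := by
  conv_rhs => rw [← IR.map_lift h]
  simp [Gens.map, IIRGens, IIR.lift_proj]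

end Relations

/-! ### Balanced maps and coevaluations -/

/-- A biadditive map `F` with `F (m a) n = F m (a n)`. -/
structure IsBalanced (A : Type*) {M N K : Type*} [AddCommGroup M] [AddCommGroup N]
    [AddCommGroup K] [SMul Aᵐᵒᵖ M] [SMul A N] (F : M → N → K) : Prop where
  add_left : ∀ m m' n, F (m + m') n = F m n + F m' n
  add_right : ∀ m n n', F m (n + n') = F m n + F m n'
  smul : ∀ (a : A) m n, F (op a • m) n = F m (a • n)

namespace IsBalanced

variable {A M N K : Type*} [AddCommGroup M] [AddCommGroup N]
  [AddCommGroup K] [SMul Aᵐᵒᵖ M] [SMul A N] {F : M → N → K}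

theorem sum_left (hF : IsBalanced A F) {ι : Type*} (s : Finset ι) (f : ι → M) (n : N) :
    F (∑ i ∈ s, f i) n = ∑ i ∈ s, F (f i) n :=
  map_sum (AddMonoidHom.mk' (fun m => F m n) fun m m' => hF.add_left m m' n) f s

theorem sum_right (hF : IsBalanced A F) {ι : Type*} (s : Finset ι) (f : ι → N) (m : M) :
    F m (∑ i ∈ s, f i) = ∑ i ∈ s, F m (f i) :=
  map_sum (AddMonoidHom.mk' (F m) (hF.add_right m)) f s

end IsBalanced

section Pivotal

variable {A Ω 𝔛 : Type*} [Ring A] [Algebra ℂ A]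
  [AddCommGroup Ω] [Module ℂ Ω] [Module A Ω] [Module Aᵐᵒᵖ Ω]
  [AddCommGroup 𝔛] [Module ℂ 𝔛] [Module A 𝔛] [Module Aᵐᵒᵖ 𝔛]
  (P : PivotalDual A Ω 𝔛) {K : Type*} [AddCommGroup K]

namespace PivotalDual

theorem evL_ext {x y : 𝔛} (h : ∀ ω, P.evL x ω = P.evL y ω) : x = y := by
  rw [← P.snakeL_field x, ← P.snakeL_field y]
  simp only [h]

theorem evR_ext {x y : 𝔛} (h : ∀ ω, P.evR ω x = P.evR ω y) : x = y := by
  rw [← P.snakeR_field x, ← P.snakeR_field y]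
  simp only [h]

/-- A family whose contraction with `𝔛` is `φ` represents the same element of `Ω ⊗_A 𝔛` as
`∑ ωL k ⊗ φ (xL k)`. -/
theorem sum_balanced_left {F : Ω → 𝔛 → K} (hF : IsBalanced A F) {ι : Type*} [Fintype ι]
    (ω : ι → Ω) (x : ι → 𝔛) (φ : 𝔛 → 𝔛) (h : ∀ z, ∑ i, P.evL z (ω i) • x i = φ z) :
    ∑ i, F (ω i) (x i) = ∑ k, F (P.ωL k) (φ (P.xL k)) := by
  calc ∑ i, F (ω i) (x i) = ∑ i, ∑ k, F (P.ωL k) (P.evL (P.xL k) (ω i) • x i) := by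
        refine Finset.sum_congr rfl fun i _ => ?_
        conv_lhs => rw [← P.snakeL_form (ω i), hF.sum_left]
        simp only [hF.smul]
    _ = _ := by
        rw [Finset.sum_comm]
        simp only [← hF.sum_right, h]

/-- A family whose contraction with `Ω` is `φ` represents the same element of `𝔛 ⊗_A Ω` as
`∑ yR k ⊗ φ (ηR k)`. -/
theorem sum_balanced_right {F : 𝔛 → Ω → K} (hF : IsBalanced A F) {ι : Type*} [Fintype ι]
    (y : ι → 𝔛) (ω : ι → Ω) (φ : Ω → Ω) (h : ∀ z, ∑ i, P.evR z (y i) • ω i = φ z) :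
    ∑ i, F (y i) (ω i) = ∑ k, F (P.yR k) (φ (P.ηR k)) := by
  calc ∑ i, F (y i) (ω i) = ∑ i, ∑ k, F (P.yR k) (P.evR (P.ηR k) (y i) • ω i) := by
        refine Finset.sum_congr rfl fun i _ => ?_
        conv_lhs => rw [← P.snakeR_field (y i), hF.sum_left]
        simp only [hF.smul]
    _ = _ := by
        rw [Finset.sum_comm]
        simp only [← hF.sum_right, h]

/-- Contracting a ω_i ⊗ x_i with z gives z a, by balancing and the snake identity; thus coev^L(1)
commutes with A, as the image of 1 under a bimodule map must. -/
theorem coevL_comm {F : Ω → 𝔛 → K} (hF : IsBalanced A F) (a : A) :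
    ∑ i, F (a • P.ωL i) (P.xL i) = ∑ i, F (P.ωL i) (op a • P.xL i) :=
  P.sum_balanced_left hF _ _ (op a • ·) fun z => by
    simp only [← P.evL_mid, P.snakeL_field]

theorem coevR_comm {F : 𝔛 → Ω → K} (hF : IsBalanced A F) (a : A) :
    ∑ j, F (a • P.yR j) (P.ηR j) = ∑ j, F (P.yR j) (op a • P.ηR j) :=
  P.sum_balanced_right hF _ _ (op a • ·) fun z => by
    simp only [← P.evR_mid, P.snakeR_form]

end PivotalDual

end Pivotal

/-! ### The involution ⊛ on vector fields and its effect on the coevaluations -/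

section FieldStar

variable {A Ω 𝔛 : Type*} [Ring A] [Algebra ℂ A] [StarRing A]
  [AddCommGroup Ω] [Module ℂ Ω] [Module A Ω] [Module Aᵐᵒᵖ Ω] [StarAddMonoid Ω]
  [AddCommGroup 𝔛] [Module ℂ 𝔛] [Module A 𝔛] [Module Aᵐᵒᵖ 𝔛]
  (P : PivotalDual A Ω 𝔛) (C : StarFODC A Ω) {K : Type*} [AddCommGroup K]

namespace PivotalDual

theorem fieldStar_add (x y : 𝔛) : P.fieldStar (x + y) = P.fieldStar x + P.fieldStar y := by
  simp [fieldStar, add_smul, Finset.sum_add_distrib]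

theorem fieldStarInv_add (x y : 𝔛) :
    P.fieldStarInv (x + y) = P.fieldStarInv x + P.fieldStarInv y := by
  simp [fieldStarInv, add_smul, Finset.sum_add_distrib]

theorem fieldStar_smul [StarModule ℂ A] [IsScalarTower ℂ Aᵐᵒᵖ 𝔛] (c : ℂ) (x : 𝔛) :
    P.fieldStar (c • x) = star c • P.fieldStar x := by
  simp [fieldStar, Finset.smul_sum]

theorem fieldStarInv_smul [StarModule ℂ A] [IsScalarTower ℂ A 𝔛] (c : ℂ) (x : 𝔛) :
    P.fieldStarInv (c • x) = star c • P.fieldStarInv x := by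
  simp [fieldStarInv, Finset.smul_sum]

include C

/-- The involution on forms exchanges the two actions of A, and the pairing identity that
characterizes ⊛ transfers this to fields, which are separated by their evaluations. -/
theorem fieldStar_left (a : A) (x : 𝔛) :
    P.fieldStar (a • x) = op (star a) • P.fieldStar x :=
  P.evR_ext fun ω => by
    rw [P.evR_right, P.evR_fieldStar C, P.evR_fieldStar C, P.evL_left, star_mul]

theorem fieldStar_right (a : A) (x : 𝔛) :
    P.fieldStar (op a • x) = star a • P.fieldStar x :=
  P.evR_ext fun ω => by
    rw [← P.evR_mid, P.evR_fieldStar C, P.evR_fieldStar C, P.evL_mid, C.star_right, star_star]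

theorem fieldStarInv_left (a : A) (x : 𝔛) :
    P.fieldStarInv (a • x) = op (star a) • P.fieldStarInv x :=
  P.evL_ext fun ω => by
    rw [P.evL_mid, P.evL_fieldStarInv C, P.evL_fieldStarInv C, ← P.evR_mid, C.star_left, star_star]

theorem fieldStarInv_right (a : A) (x : 𝔛) :
    P.fieldStarInv (op a • x) = star a • P.fieldStarInv x :=
  P.evL_ext fun ω => by
    rw [P.evL_left, P.evL_fieldStarInv C, P.evL_fieldStarInv C, P.evR_right, star_mul]

/-- The `*`-image of the right coevaluation is the left coevaluation. -/
theorem coevL_star {F : Ω → 𝔛 → K} (hF : IsBalanced A F) :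
    ∑ j, F (star (P.ηR j)) (P.fieldStarInv (P.yR j)) = ∑ i, F (P.ωL i) (P.xL i) :=
  P.sum_balanced_left hF _ _ id fun z => P.evL_ext fun ω => by
    conv_rhs => rw [id, ← star_star ω, ← P.snakeR_form (star ω)]
    simp only [map_sum, LinearMap.sum_apply, P.evL_left, P.evL_fieldStarInv C, star_sum,
      C.star_left, P.evL_right]

/-- The `*`-image of the left coevaluation is the right coevaluation. -/
theorem coevR_star {F : 𝔛 → Ω → K} (hF : IsBalanced A F) :
    ∑ i, F (P.fieldStar (P.xL i)) (star (P.ωL i)) = ∑ j, F (P.yR j) (P.ηR j) :=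
  P.sum_balanced_right hF _ _ id fun z => by
    conv_rhs => rw [id, ← star_star z, ← P.snakeL_form (star z)]
    simp only [P.evR_fieldStar C, star_sum, C.star_right]

end PivotalDual

end FieldStar

/-! ### The linear anti-isomorphism `Φ` -/

section Phi

variable {A Ω 𝔛 : Type*} [Ring A] [Algebra ℂ A] [StarRing A]
  [AddCommGroup Ω] [Module ℂ Ω] [Module A Ω] [Module Aᵐᵒᵖ Ω] [StarAddMonoid Ω]
  [AddCommGroup 𝔛] [Module ℂ 𝔛] [Module A 𝔛] [Module Aᵐᵒᵖ 𝔛]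
  {C : StarFODC A Ω} (P : PivotalDual A Ω 𝔛)
  {L R : Type*} [Ring L] [Algebra ℂ L] [Ring R] [Algebra ℂ R]

/-- The generators of `IL(Ω)` in the opposite of an algebra with generators of `IR(Ω)`. -/
def Gens.phi (g : Gens A Ω 𝔛 R) : Gens A Ω 𝔛 Rᵐᵒᵖ where
  s a := op (g.t a)
  t a := op (g.s a)
  v x := op (∑ j, g.v (P.yR j) * g.xo x (P.ηR j))
  xo x ω := op (g.xo x ω)
  ox ω y := op (g.ox ω y)

/-- The generators of `IR(Ω)` in the opposite of an algebra with generators of `IL(Ω)`. -/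
def Gens.psi (g : Gens A Ω 𝔛 L) : Gens A Ω 𝔛 Lᵐᵒᵖ where
  s a := op (g.t a)
  t a := op (g.s a)
  v y := op (∑ i, g.ox (P.ωL i) y * g.v (P.xL i))
  xo x ω := op (g.xo x ω)
  ox ω y := op (g.ox ω y)

variable {P}

/-- This makes Φ(x) depend only on the class of coev^R(1) in 𝔛 ⊗_A Ω, so that the centrality of the
coevaluation can be applied to it. -/
theorem Gens.SatIR.balanced_v_xo {g : Gens A Ω 𝔛 R} (h : g.SatIR C P) (x : 𝔛) :
    IsBalanced A fun (y : 𝔛) (η : Ω) => g.v y * g.xo x η where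
  add_left := by simp [h.basic.v_add, add_mul]
  add_right := by simp [h.basic.xo_add_right, mul_add]
  smul a y η := by rw [← h.v_s, ← h.s_xo, mul_assoc]

theorem Gens.SatIL.balanced_ox_v {g : Gens A Ω 𝔛 L} (h : g.SatIL C P) (y : 𝔛) :
    IsBalanced A fun (ω : Ω) (x : 𝔛) => g.ox ω y * g.v x where
  add_left := by simp [h.basic.ox_add_left, add_mul]
  add_right := by simp [h.basic.v_add, mul_add]
  smul a ω x := by rw [← h.ox_s, ← h.s_v, mul_assoc]

/-- Only the relations with a field are not immediate. In `v_s`, moving the target past y_j leaves ∑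
(da, y_j)(x, η_j), which an invertibility relation turns into ev^L(x, da). In `v_t`, centrality of
coev^R moves a to the other side, and the derivation term collapses to (x, da) by the snake
identity. -/
theorem Gens.SatIR.phi {g : Gens A Ω 𝔛 R} (h : g.SatIR C P) : (g.phi P).SatIL C P := by
  have hb := h.basic
  intro X Y r
  cases r with
  | basic r =>
    apply MulOpposite.unop_injective
    cases r with
    | s_t => simp [Gens.phi, hb.s_t]
    | _ => simp [Gens.phi, hb.s_add, hb.s_mul, hb.s_scalar, hb.t_add, hb.t_mul, hb.t_scalar, hb.s_t,
        hb.xo_add_left, hb.xo_add_right, hb.xo_smul_left, hb.xo_smul_right, hb.ox_add_left,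
        hb.ox_add_right, hb.ox_smul_left, hb.ox_smul_right, mul_add, Finset.sum_add_distrib,
        Finset.smul_sum]
  | v_s a x =>
    apply MulOpposite.unop_injective
    simp [Gens.phi, Finset.mul_sum, ← mul_assoc, h.t_v, add_mul, Finset.sum_add_distrib, h.ox_xo]
    simp [mul_assoc, h.t_xo]
  | v_t a x =>
    apply MulOpposite.unop_injective
    have := P.coevR_comm (h.balanced_v_xo x) a
    simp [Gens.phi, Finset.mul_sum, ← mul_assoc, h.s_v, add_mul, Finset.sum_add_distrib, h.s_xo,
      this, ← hb.xo_sum_right, P.snakeR_form, ← h.xo_s, Finset.sum_mul]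
  | s_v a x =>
    apply MulOpposite.unop_injective
    simp [Gens.phi, Finset.sum_mul, mul_assoc, h.xo_t]
  | ox_xo ω y =>
    apply MulOpposite.unop_injective
    simp [Gens.phi, h.xo_ox]
  | xo_ox ω y =>
    apply MulOpposite.unop_injective
    simp [Gens.phi, h.ox_xo]
  | _ =>
    simp [Gens.phi, ← MulOpposite.op_mul, h.s_xo, h.xo_s, h.t_xo, h.xo_t, h.s_ox, h.ox_s, h.t_ox,
      h.ox_t]

theorem Gens.SatIIR.phi {g : Gens A Ω 𝔛 R} (h : g.SatIIR P) : (g.phi P).SatIIL P := by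
  intro X Y r
  apply MulOpposite.unop_injective
  cases r <;> simp [Gens.phi, h.xo_ox, h.ox_xo]

/-- Mirror image of `Gens.SatIR.phi`: now coev^L is the central element, and the derivation terms of
`v_t` and `v_s` supply those of `s_v` and `t_v` respectively. -/
theorem Gens.SatIL.psi {g : Gens A Ω 𝔛 L} (h : g.SatIL C P) : (g.psi P).SatIR C P := by
  have hb := h.basic
  intro X Y r
  cases r with
  | basic r =>
    apply MulOpposite.unop_injective
    cases r with
    | s_t => simp [Gens.psi, hb.s_t]
    | _ => simp [Gens.psi, hb.s_add, hb.s_mul, hb.s_scalar, hb.t_add, hb.t_mul, hb.t_scalar, hb.s_t,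
        hb.xo_add_left, hb.xo_add_right, hb.xo_smul_left, hb.xo_smul_right, hb.ox_add_left,
        hb.ox_add_right, hb.ox_smul_left, hb.ox_smul_right, add_mul, Finset.sum_add_distrib,
        Finset.smul_sum]
  | v_s a y =>
    apply MulOpposite.unop_injective
    simp [Gens.psi, Finset.mul_sum, ← mul_assoc, h.t_ox]
  | s_v a y =>
    apply MulOpposite.unop_injective
    simp [Gens.psi, Finset.sum_mul, mul_assoc, h.v_t, mul_add, Finset.sum_add_distrib, h.ox_xo]
    simp [← mul_assoc, h.ox_t]
  | t_v a y =>
    apply MulOpposite.unop_injective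
    have := P.coevL_comm (h.balanced_ox_v y) a
    simp [Gens.psi, Finset.sum_mul, mul_assoc, h.v_s, mul_add, Finset.sum_add_distrib, ← this]
    simp [Finset.mul_sum, ← mul_assoc, h.s_ox, h.ox_s, ← hb.ox_sum_left, P.snakeL_form]
  | ox_xo ω y =>
    apply MulOpposite.unop_injective
    simp [Gens.psi, h.xo_ox]
  | xo_ox ω y =>
    apply MulOpposite.unop_injective
    simp [Gens.psi, h.ox_xo]
  | _ =>
    simp [Gens.psi, ← MulOpposite.op_mul, h.s_xo, h.xo_s, h.t_xo, h.xo_t, h.s_ox, h.ox_s, h.t_ox,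
      h.ox_t]

theorem Gens.SatIIL.psi {g : Gens A Ω 𝔛 L} (h : g.SatIIL P) : (g.psi P).SatIIR P := by
  intro X Y r
  apply MulOpposite.unop_injective
  cases r <;> simp [Gens.psi, h.xo_ox, h.ox_xo]

end Phi

/-! ### The opposite algebra with conjugate scalars -/

/-- The opposite of an algebra, with `c ∈ ℂ` acting by the complex conjugate. -/
def ConjOp (R : Type*) : Type _ := Rᵐᵒᵖ

namespace ConjOp

variable {R : Type*} [Ring R] [Algebra ℂ R]

instance : Ring (ConjOp R) := inferInstanceAs (Ring Rᵐᵒᵖ)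

/-- The canonical map to the conjugate opposite. -/
def mk (r : R) : ConjOp R := op r

/-- The canonical map from the conjugate opposite. -/
def out (r : ConjOp R) : R := unop r

/-- With conjugated scalars an antilinear anti-multiplicative map into R becomes a ℂ-algebra map
into `ConjOp R`, so the universal properties apply to ⊛. -/
instance : Algebra ℂ (ConjOp R) :=
  RingHom.toAlgebra' ((algebraMap ℂ Rᵐᵒᵖ).comp (starRingEnd ℂ)) fun c x =>
    Algebra.commutes (A := Rᵐᵒᵖ) (star c) x

@[simp] theorem out_mk (r : R) : (mk r).out = r := rfl
@[simp] theorem out_add (x y : ConjOp R) : (x + y).out = x.out + y.out := rfl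
@[simp] theorem out_mul (x y : ConjOp R) : (x * y).out = y.out * x.out := rfl
@[simp] theorem out_one : (1 : ConjOp R).out = 1 := rfl
@[simp] theorem out_algebraMap (c : ℂ) :
    (algebraMap ℂ (ConjOp R) c).out = algebraMap ℂ R (star c) := rfl
@[simp] theorem out_smul (c : ℂ) (x : ConjOp R) : (c • x).out = star c • x.out := by
  rw [Algebra.smul_def, Algebra.smul_def, out_mul, out_algebraMap, Algebra.commutes]

@[simp] theorem out_sum {ι : Type*} (s : Finset ι) (f : ι → ConjOp R) :
    (∑ i ∈ s, f i).out = ∑ i ∈ s, (f i).out :=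
  map_sum (AddMonoidHom.mk' (out : ConjOp R → R) out_add) f s

theorem out_injective : Function.Injective (out : ConjOp R → R) := MulOpposite.unop_injective

end ConjOp

/-! ### Induction on generators -/

section Induction

variable {A Ω 𝔛 : Type*} [Ring A] [Algebra ℂ A] [AddCommGroup Ω] [Module ℂ Ω]
  [AddCommGroup 𝔛] [Module ℂ 𝔛] {L L' : Type*} [Ring L] [Algebra ℂ L] [Ring L'] [Algebra ℂ L']

/-- Scalars need no case of their own because they already lie among the source elements. -/
theorem Gens.Generates.induction {g : Gens A Ω 𝔛 L} (hg : g.Generates) (hb : g.Basic)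
    {p : L → Prop} (s : ∀ a, p (g.s a)) (t : ∀ a, p (g.t a)) (v : ∀ x, p (g.v x))
    (xo : ∀ x ω, p (g.xo x ω)) (ox : ∀ ω y, p (g.ox ω y))
    (add : ∀ X Y, p X → p Y → p (X + Y)) (mul : ∀ X Y, p X → p Y → p (X * Y)) (X : L) : p X :=
  hg
    { carrier := {X | p X}
      mul_mem' := fun hX hY => mul _ _ hX hY
      add_mem' := fun hX hY => add _ _ hX hY
      algebraMap_mem' := fun c => by
        show p _
        rw [← hb.s_scalar]
        exact s _ } s t v xo ox X

end Induction

/-! ### The maps `Φ` and `⊛` -/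

section Maps

variable {A Ω 𝔛 : Type*} [Ring A] [Algebra ℂ A] [StarRing A]
  [AddCommGroup Ω] [Module ℂ Ω] [Module A Ω] [Module Aᵐᵒᵖ Ω] [StarAddMonoid Ω]
  [AddCommGroup 𝔛] [Module ℂ 𝔛] [Module A 𝔛] [Module Aᵐᵒᵖ 𝔛]
  {C : StarFODC A Ω} {P : PivotalDual A Ω 𝔛}
  {L R : Type*} [Ring L] [Algebra ℂ L] [Ring R] [Algebra ℂ R]

/-- This is Φ ∘ Φ⁻¹ = id on a field: the sum over i contracts to ev^R(η_j, y) by an invertibility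
relation, and the snake identity reassembles y. The next lemma does the same for Φ⁻¹ ∘ Φ. -/
theorem Gens.SatIR.sum_psi_phi {h : Gens A Ω 𝔛 R} (hR : h.SatIR C P) (y : 𝔛) :
    ∑ i, (∑ j, h.v (P.yR j) * h.xo (P.xL i) (P.ηR j)) * h.ox (P.ωL i) y = h.v y := by
  simp only [Finset.sum_mul]
  rw [Finset.sum_comm]
  simp only [mul_assoc, ← Finset.mul_sum, hR.xo_ox, hR.v_s]
  rw [← hR.basic.v_sum, P.snakeR_field]

theorem Gens.SatIL.sum_phi_psi {g : Gens A Ω 𝔛 L} (hL : g.SatIL C P) (x : 𝔛) :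
    ∑ j, g.xo x (P.ηR j) * (∑ i, g.ox (P.ωL i) (P.yR j) * g.v (P.xL i)) = g.v x := by
  simp only [Finset.mul_sum]
  rw [Finset.sum_comm]
  simp only [← mul_assoc, ← Finset.sum_mul, hL.xo_ox, hL.s_v]
  rw [← hL.basic.v_sum, P.snakeL_field]

/-- The linear anti-isomorphism determined by mutually inverse maps on generators. -/
theorem exists_phi {g : Gens A Ω 𝔛 L} {h : Gens A Ω 𝔛 R} (hL : g.SatIL C P) (hR : h.SatIR C P)
    (hg : g.Generates) (hh : h.Generates) (f : L →ₐ[ℂ] Rᵐᵒᵖ) (hf : g.map f = h.phi P)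
    (k : R →ₐ[ℂ] Lᵐᵒᵖ) (hk : h.map k = g.psi P) :
    ∃ Φ : L ≃ₗ[ℂ] R, (Φ 1 = 1 ∧ ∀ X Y, Φ (X * Y) = Φ Y * Φ X) ∧ IsGhobadiPhi P g h Φ := by
  have fs : ∀ a, f (g.s a) = op (h.t a) := congrFun (congrArg Gens.s hf)
  have ft : ∀ a, f (g.t a) = op (h.s a) := congrFun (congrArg Gens.t hf)
  have fv : ∀ x, f (g.v x) = op (∑ j, h.v (P.yR j) * h.xo x (P.ηR j)) :=
    congrFun (congrArg Gens.v hf)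
  have fxo : ∀ x ω, f (g.xo x ω) = op (h.xo x ω) :=
    fun x => congrFun (congrFun (congrArg Gens.xo hf) x)
  have fox : ∀ ω y, f (g.ox ω y) = op (h.ox ω y) :=
    fun x => congrFun (congrFun (congrArg Gens.ox hf) x)
  have ks : ∀ a, k (h.s a) = op (g.t a) := congrFun (congrArg Gens.s hk)
  have kt : ∀ a, k (h.t a) = op (g.s a) := congrFun (congrArg Gens.t hk)
  have kv : ∀ y, k (h.v y) = op (∑ i, g.ox (P.ωL i) y * g.v (P.xL i)) :=
    congrFun (congrArg Gens.v hk)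
  have kxo : ∀ x ω, k (h.xo x ω) = op (g.xo x ω) :=
    fun x => congrFun (congrFun (congrArg Gens.xo hk) x)
  have kox : ∀ ω y, k (h.ox ω y) = op (g.ox ω y) :=
    fun x => congrFun (congrFun (congrArg Gens.ox hk) x)
  -- A composite of two anti-multiplicative maps is multiplicative, so it may be compared with the
  -- identity on generators; only fields need an argument.
  have hkf : ∀ X, k (f X).unop = op X := by
    refine hg.induction hL.basic ?_ ?_ ?_ ?_ ?_ ?_ ?_
    · simp [fs, kt]
    · simp [ft, ks]
    · intro x
      simp only [fv, MulOpposite.unop_op, map_sum, map_mul, kv, kxo, ← MulOpposite.op_mul,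
        ← Finset.op_sum, hL.sum_phi_psi]
    · simp [fxo, kxo]
    · simp [fox, kox]
    · intro X Y hX hY; simp [hX, hY]
    · intro X Y hX hY; simp [hX, hY]
  have hfk : ∀ X, f (k X).unop = op X := by
    refine hh.induction hR.basic ?_ ?_ ?_ ?_ ?_ ?_ ?_
    · simp [ft, ks]
    · simp [fs, kt]
    · intro y
      simp only [kv, MulOpposite.unop_op, map_sum, map_mul, fv, fox, ← MulOpposite.op_mul,
        ← Finset.op_sum, hR.sum_psi_phi]
    · simp [fxo, kxo]
    · simp [fox, kox]
    · intro X Y hX hY; simp [hX, hY]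
    · intro X Y hX hY; simp [hX, hY]
  let Φ : L ≃ₗ[ℂ] R :=
    { toFun := fun X => (f X).unop
      invFun := fun Y => (k Y).unop
      map_add' := by simp
      map_smul' := by simp
      left_inv := fun X => by simp [hkf]
      right_inv := fun X => by simp [hfk] }
  have hΦ : ∀ X, Φ X = (f X).unop := fun _ => rfl
  refine ⟨Φ, ⟨by simp [hΦ], by simp [hΦ]⟩, ?_, ?_, ?_, ?_, ?_⟩
  · intro a b
    simp [hΦ, fs, ft, hR.basic.s_t]
  · simp [hΦ, fxo]
  · simp [hΦ, fox]
  · intro y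
    simp only [hΦ, map_sum, map_mul, fv, fox, ← MulOpposite.op_mul,
        ← Finset.op_sum, hR.sum_psi_phi, MulOpposite.unop_op]
  · simp [hΦ, fv]

/-- The generators of `IL(Ω)` in the conjugate opposite of an algebra with generators of
`IR(Ω)`. -/
def Gens.star (P : PivotalDual A Ω 𝔛) (h : Gens A Ω 𝔛 R) : Gens A Ω 𝔛 (ConjOp R) where
  s a := .mk (h.s (Star.star a))
  t a := .mk (h.t (Star.star a))
  v x := .mk (h.v (P.fieldStar x))
  xo x ω := .mk (h.ox (Star.star ω) (P.fieldStar x))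
  ox ω y := .mk (h.xo (P.fieldStarInv y) (Star.star ω))

/-- The four balanced products here are the shapes in which coevaluations occur in the ⊛-images of
the invertibility relations. Balancedness is what allows the starred coevaluation to be replaced by
the other one. -/
theorem Gens.SatIR.balanced_ox_xo {h : Gens A Ω 𝔛 R} (hR : h.SatIR C P) (x : 𝔛) (ω : Ω) :
    IsBalanced A fun (y : 𝔛) (η : Ω) => h.ox ω y * h.xo x η where
  add_left := by simp [hR.basic.ox_add_right, add_mul]
  add_right := by simp [hR.basic.xo_add_right, mul_add]
  smul a y η := by rw [← hR.ox_s, ← hR.s_xo, mul_assoc]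

theorem Gens.SatIR.balanced_xo_ox {h : Gens A Ω 𝔛 R} (hR : h.SatIR C P) (y : 𝔛) (ω : Ω) :
    IsBalanced A fun (η : Ω) (x : 𝔛) => h.xo x ω * h.ox η y where
  add_left := by simp [hR.basic.ox_add_left, mul_add]
  add_right := by simp [hR.basic.xo_add_left, add_mul]
  smul a η x := by rw [← hR.t_ox, ← hR.xo_t, mul_assoc]

theorem Gens.SatIR.balanced_ox_xo' {h : Gens A Ω 𝔛 R} (hR : h.SatIR C P) (x : 𝔛) (ω : Ω) :
    IsBalanced A fun (y : 𝔛) (η : Ω) => h.ox η x * h.xo y ω where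
  add_left := by simp [hR.basic.xo_add_left, mul_add]
  add_right := by simp [hR.basic.ox_add_left, add_mul]
  smul a y η := by rw [← hR.ox_t, ← hR.t_xo, mul_assoc]

theorem Gens.SatIR.balanced_xo_ox' {h : Gens A Ω 𝔛 R} (hR : h.SatIR C P) (y : 𝔛) (ω : Ω) :
    IsBalanced A fun (η : Ω) (x : 𝔛) => h.xo y η * h.ox ω x where
  add_left := by simp [hR.basic.xo_add_right, add_mul]
  add_right := by simp [hR.basic.ox_add_right, mul_add]
  smul a η x := by rw [← hR.xo_s, ← hR.s_ox, mul_assoc]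

/-- Since * exchanges the left and right actions on forms and fields and commutes with d, the
bimodule and Leibniz relations of IL become those of IR. The invertibility relations match because ⊛
sends the left coevaluation to the right one and ⊛⁻¹ sends the right one to the left one, as is
needed here. -/
theorem Gens.SatIR.star [StarModule ℂ A] [StarModule ℂ Ω] [IsScalarTower ℂ A 𝔛]
    [IsScalarTower ℂ Aᵐᵒᵖ 𝔛] {h : Gens A Ω 𝔛 R} (hR : h.SatIR C P) :
    (h.star P).SatIL C P := by
  have hb := hR.basic
  intro X Y r
  apply ConjOp.out_injective
  cases r with
  | basic r =>
    cases r with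
    | s_t => simp [Gens.star, hb.s_t]
    | s_scalar c =>
      simp only [Gens.star, ConjOp.out_mk, ConjOp.out_algebraMap, ← hb.s_scalar, algebraMap_star_comm]
    | t_scalar c =>
      simp only [Gens.star, ConjOp.out_mk, ConjOp.out_algebraMap, ← hb.t_scalar, algebraMap_star_comm]
    | _ => simp [Gens.star, hb.s_add, hb.s_mul, hb.s_scalar, hb.t_add, hb.t_mul, hb.t_scalar,
        hb.xo_add_left, hb.xo_add_right, hb.xo_smul_left, hb.xo_smul_right, hb.ox_add_left,
        hb.ox_add_right, hb.ox_smul_left, hb.ox_smul_right, hb.v_add, hb.v_smul, P.fieldStar_add,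
        P.fieldStarInv_add, P.fieldStar_smul, P.fieldStarInv_smul]
  | ox_xo ω y =>
    have := P.coevR_star C (hR.balanced_ox_xo (P.fieldStarInv y) (Star.star ω))
    simp only [Gens.star, ConjOp.out_mul, ConjOp.out_sum, ConjOp.out_mk, this, hR.ox_xo,
      P.evL_fieldStarInv C, star_star]
  | xo_ox x ω =>
    have := P.coevL_star C (hR.balanced_xo_ox (P.fieldStar x) (Star.star ω))
    simp only [Gens.star, ConjOp.out_mul, ConjOp.out_sum, ConjOp.out_mk, this, hR.xo_ox,
      P.evR_fieldStar C, star_star]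
  | _ => simp [Gens.star, P.fieldStar_left C, P.fieldStar_right C, P.fieldStarInv_left C,
      P.fieldStarInv_right C, C.star_left, C.star_right, hR.s_ox, hR.ox_s, hR.t_ox, hR.ox_t,
      hR.s_xo, hR.xo_s, hR.t_xo, hR.xo_t, hR.s_v, hR.v_s, hR.t_v, P.evR_fieldStar C, ← C.star_d,
      -MulOpposite.op_star]

/-- In the additional relations ⊛ and ⊛⁻¹ fall on the opposite coevaluations: ⊛ is applied to the
y_j and ⊛⁻¹ to the x_i. The coevaluations are exchanged only if the two maps on fields agree, which
is the compatibility hypothesis. -/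
theorem Gens.SatIIR.star {h : Gens A Ω 𝔛 R} (hR : h.SatIR C P) (hR' : h.SatIIR P)
    (hP : P.fieldStar = P.fieldStarInv) : (h.star P).SatIIL P := by
  intro X Y r
  apply ConjOp.out_injective
  cases r with
  | xo_ox x ω =>
    have := P.coevL_star C (hR.balanced_xo_ox' (P.fieldStar x) (Star.star ω))
    simp only [Gens.star, ConjOp.out_mul, ConjOp.out_sum, ConjOp.out_mk, hP] at this ⊢
    rw [this, hR'.xo_ox, ← hP, P.evR_fieldStar C, star_star]
  | ox_xo ω x =>
    have := P.coevR_star C (hR.balanced_ox_xo' (P.fieldStarInv x) (Star.star ω))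
    simp only [Gens.star, ConjOp.out_mul, ConjOp.out_sum, ConjOp.out_mk, ← hP] at this ⊢
    rw [this, hR'.ox_xo, hP, P.evL_fieldStarInv C, star_star]

theorem Gens.SatIL.balanced_xo_ox {g : Gens A Ω 𝔛 L} (h : g.SatIL C P) (x : 𝔛) (ω : Ω) :
    IsBalanced A fun (y : 𝔛) (η : Ω) => g.xo x η * g.ox ω y where
  add_left := by simp [h.basic.ox_add_right, mul_add]
  add_right := by simp [h.basic.xo_add_right, add_mul]
  smul a y η := by rw [← h.xo_t, ← h.t_ox, mul_assoc]

theorem IsGhobadiPhi.phi_s {g : Gens A Ω 𝔛 L} {h : Gens A Ω 𝔛 R} {Φ : L → R}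
    (H : IsGhobadiPhi P g h Φ) (hg : g.Basic) (hh : h.Basic) (a : A) : Φ (g.s a) = h.t a := by
  simpa [hg.t_one, hh.s_one] using H.phi_st a 1

theorem IsGhobadiPhi.phi_t {g : Gens A Ω 𝔛 L} {h : Gens A Ω 𝔛 R} {Φ : L → R}
    (H : IsGhobadiPhi P g h Φ) (hg : g.Basic) (hh : h.Basic) (a : A) : Φ (g.t a) = h.s a := by
  simpa [hg.s_one, hh.t_one] using H.phi_st 1 a

/-- The antilinear anti-isomorphism `⊛`, and its compatibility with `Φ`. -/
theorem exists_star {g : Gens A Ω 𝔛 L} {h : Gens A Ω 𝔛 R} (hL : g.SatIL C P) (hR : h.SatIR C P)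
    (hg : g.Generates) (f : L →ₐ[ℂ] ConjOp R) (hf : g.map f = h.star P)
    (Φ : L ≃ₗ[ℂ] R) (hΦm : ∀ X Y, Φ (X * Y) = Φ Y * Φ X)
    (hΦ : IsGhobadiPhi P g h Φ) :
    ∃ st : L ≃ₛₗ[starRingEnd ℂ] R, (st 1 = 1 ∧ ∀ X Y, st (X * Y) = st Y * st X) ∧
      IsGhobadiStar P g h st ∧ ∀ X, Φ.symm (st X) = st.symm (Φ X) := by
  have fs : ∀ a, (f (g.s a)).out = (h.s (star a)) := fun a =>
    congrArg ConjOp.out (congrFun (congrArg Gens.s hf) a)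
  have ft : ∀ a, (f (g.t a)).out = (h.t (star a)) := fun a =>
    congrArg ConjOp.out (congrFun (congrArg Gens.t hf) a)
  have fv : ∀ x, (f (g.v x)).out = h.v (P.fieldStar x) := fun a =>
    congrArg ConjOp.out (congrFun (congrArg Gens.v hf) a)
  have fxo : ∀ x ω, (f (g.xo x ω)).out = h.ox (star ω) (P.fieldStar x) := fun x ω =>
    congrArg ConjOp.out (congrFun (congrFun (congrArg Gens.xo hf) x) ω)
  have fox : ∀ ω y, (f (g.ox ω y)).out = h.xo (P.fieldStarInv y) (star ω) := fun x ω =>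
    congrArg ConjOp.out (congrFun (congrFun (congrArg Gens.ox hf) x) ω)
  have sm : ∀ X Y, Φ.symm (X * Y) = Φ.symm Y * Φ.symm X := fun X Y => Φ.injective (by
    simp [hΦm])
  have ss : ∀ a, Φ.symm (h.s a) = g.t a := fun a => by
    rw [← hΦ.phi_t hL.basic hR.basic, Φ.symm_apply_apply]
  have st : ∀ a, Φ.symm (h.t a) = g.s a := fun a => by
    rw [← hΦ.phi_s hL.basic hR.basic, Φ.symm_apply_apply]
  have sv : ∀ y, Φ.symm (h.v y) = ∑ i, g.ox (P.ωL i) y * g.v (P.xL i) := fun a => by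
    rw [← hΦ.phi_ox_v, Φ.symm_apply_apply]
  have sxo : ∀ x ω, Φ.symm (h.xo x ω) = g.xo x ω := fun x ω => by
    rw [← hΦ.phi_xo, Φ.symm_apply_apply]
  have sox : ∀ ω y, Φ.symm (h.ox ω y) = g.ox ω y := fun x ω => by
    rw [← hΦ.phi_ox, Φ.symm_apply_apply]
  -- The identity (Φ⁻¹ ∘ ⊛)² = id. The composite is multiplicative although antilinear, so
  -- generators suffice; on a field it is the invertibility relation for the starred coevaluation
  -- followed by the snake identity.
  have inv : ∀ X, Φ.symm (f (Φ.symm (f X).out)).out = X := by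
    refine hg.induction hL.basic ?_ ?_ ?_ ?_ ?_ ?_ ?_
    · simp [fs, ss, ft, st]
    · simp [ft, st, fs, ss]
    · intro x
      have key : ∀ ω, ∑ i, g.xo x (star (P.ωL i)) * g.ox ω (P.fieldStar (P.xL i)) =
          g.s (P.evL x ω) := fun ω => by
        rw [P.coevR_star C (hL.balanced_xo_ox x ω), hL.xo_ox]
      simp only [fv, sv, map_sum, map_mul, ConjOp.out_sum, ConjOp.out_mul, fox, sm, sxo,
        P.fieldStarInv_fieldStar C, Finset.mul_sum, ← mul_assoc]
      rw [Finset.sum_comm]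
      simp only [← Finset.sum_mul, key, hL.s_v]
      rw [← hL.basic.v_sum, P.snakeL_field]
    · simp [fxo, sox, fox, sxo, P.fieldStarInv_fieldStar C]
    · simp [fox, sxo, fxo, sox, P.fieldStar_fieldStarInv C]
    · intro X Y hX hY; simp [hX, hY]
    · intro X Y hX hY; simp [hX, hY, sm]
  -- The inverse is forced to be Φ⁻¹ ∘ ⊛ ∘ Φ⁻¹, which also makes the compatibility of ⊛ with Φ hold
  -- by construction.
  let e : L ≃ₛₗ[starRingEnd ℂ] R :=
    { toFun := fun X => (f X).out
      invFun := fun Y => Φ.symm (f (Φ.symm Y)).out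
      map_add' := by simp
      map_smul' := by simp
      left_inv := inv
      right_inv := fun Y => by
        apply Φ.symm.injective
        exact inv _ }
  have he : ∀ X, e X = (f X).out := fun _ => rfl
  have hem : ∀ X Y, e (X * Y) = e Y * e X := by simp [he]
  refine ⟨e, ⟨by simp [he], hem⟩, ⟨fs, ft, fv, fun a x => ?_, fxo, fox⟩, fun X => ?_⟩
  · rw [hem, he, he, ft, fv]
  · show _ = Φ.symm (f (Φ.symm (Φ X))).out
    rw [Φ.symm_apply_apply, he]

end Maps

/-! ### Idealizers of right ideals -/

section Idealizer

variable {B : Type*} [Ring B] [Algebra ℂ B] (I : Submodule ℂ B)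

/-- The submodule `I` is a right ideal. -/
def Submodule.IsRightIdeal : Prop := ∀ i ∈ I, ∀ b, i * b ∈ I

/-- The subalgebra of all `b` with `b I ⊆ I`. -/
def Submodule.idealizer : Subalgebra ℂ B where
  carrier := {b | ∀ i ∈ I, b * i ∈ I}
  mul_mem' hb hc i hi := by rw [mul_assoc]; exact hb _ (hc _ hi)
  add_mem' hb hc i hi := by rw [add_mul]; exact I.add_mem (hb _ hi) (hc _ hi)
  algebraMap_mem' c i hi := by rw [← Algebra.smul_def]; exact I.smul_mem _ hi

/-- The action of the idealizer on the quotient by left multiplication. -/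
def Submodule.idealizerAct : I.idealizer →ₐ[ℂ] Module.End ℂ (B ⧸ I) where
  toFun b := I.mapQ I (LinearMap.mulLeft ℂ (b : B)) b.2
  map_one' := by ext v; exact congrArg I.mkQ (one_mul v)
  map_mul' b c := by ext v; exact congrArg I.mkQ (mul_assoc (b : B) c v)
  map_zero' := by ext v; exact congrArg I.mkQ (zero_mul v)
  map_add' b c := by ext v; exact congrArg I.mkQ (add_mul (b : B) c v)
  commutes' c := by ext v; exact congrArg I.mkQ (Algebra.smul_def c v).symm

variable {I}

@[simp] theorem Submodule.idealizerAct_mkQ (b : I.idealizer) (v : B) :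
    I.idealizerAct b (I.mkQ v) = I.mkQ (b * v) := rfl

theorem Submodule.IsRightIdeal.mkQ_mul (hI : I.IsRightIdeal) {b c : B} (h : I.mkQ b = I.mkQ c)
    (v : B) : I.mkQ (b * v) = I.mkQ (c * v) := by
  simp only [Submodule.mkQ_apply, Submodule.Quotient.eq] at h ⊢
  rw [← sub_mul]
  exact hI _ h _

theorem Submodule.mkQ_mul_of_mem {b : B} (hb : b ∈ I.idealizer) {v w : B} (h : I.mkQ v = I.mkQ w) :
    I.mkQ (b * v) = I.mkQ (b * w) := by
  simp only [Submodule.mkQ_apply, Submodule.Quotient.eq] at h ⊢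
  rw [← mul_sub]
  exact hb _ h

theorem Submodule.IsRightIdeal.mem_idealizer_of_mkQ_eq (hI : I.IsRightIdeal) {b c : B}
    (hb : b ∈ I.idealizer) (h : I.mkQ c = I.mkQ b) : c ∈ I.idealizer := fun i hi => by
  have := hI.mkQ_mul h i
  have h0 : I.mkQ (b * i) = 0 := (Submodule.Quotient.mk_eq_zero _).2 (hb i hi)
  exact (Submodule.Quotient.mk_eq_zero _).1 (this.trans h0)

/-- If b − c lies in the right ideal I, so does (b − c)v for every v. This is why a relation between
elements of the idealizer that holds only modulo I becomes a true equation between the operators. -/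
theorem Submodule.IsRightIdeal.idealizerAct_eq (hI : I.IsRightIdeal) {b c : I.idealizer}
    (h : I.mkQ (b : B) = I.mkQ (c : B)) : I.idealizerAct b = I.idealizerAct c := by
  ext v
  exact hI.mkQ_mul h v

theorem Submodule.isRightIdeal_span {S : Set B}
    (h : ∀ z ∈ S, ∀ b, z * b ∈ Submodule.span ℂ S) : (Submodule.span ℂ S).IsRightIdeal := by
  intro i hi b
  induction hi using Submodule.span_induction with
  | mem z hz => exact h z hz b
  | zero => simp
  | add x y _ _ hx hy => rw [add_mul]; exact Submodule.add_mem _ hx hy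
  | smul c x _ hx => rw [smul_mul_assoc]; exact Submodule.smul_mem _ c hx

theorem Submodule.mem_idealizer_span {S : Set B} {b : B}
    (h : ∀ z ∈ S, b * z ∈ Submodule.span ℂ S) : b ∈ (Submodule.span ℂ S).idealizer := by
  intro i hi
  induction hi using Submodule.span_induction with
  | mem z hz => exact h z hz
  | zero => simp
  | add x y _ _ hx hy => rw [mul_add]; exact Submodule.add_mem _ hx hy
  | smul c x _ hx => rw [mul_smul_comm]; exact Submodule.smul_mem _ c hx

/-- An algebra map to `End (B ⧸ I)` all of whose values come from the idealizer. -/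
theorem Submodule.IsRightIdeal.act_mkQ (hI : I.IsRightIdeal) {f : Module.End ℂ (B ⧸ I)}
    (hf : f ∈ I.idealizerAct.range) {u : B} (hu : I.mkQ u = f (I.mkQ 1)) (v : B) :
    f (I.mkQ v) = I.mkQ (u * v) := by
  obtain ⟨b, rfl⟩ := hf
  have : I.mkQ u = I.mkQ (b : B) := hu.trans (congrArg I.mkQ (mul_one (b : B)))
  exact (hI.mkQ_mul this v).symm

theorem Submodule.IsRightIdeal.mem_idealizer (hI : I.IsRightIdeal) {f : Module.End ℂ (B ⧸ I)}
    (hf : f ∈ I.idealizerAct.range) {u : B} (hu : I.mkQ u = f (I.mkQ 1)) :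
    u ∈ I.idealizer := by
  obtain ⟨b, rfl⟩ := hf
  exact hI.mem_idealizer_of_mkQ_eq b.2 (hu.trans (congrArg I.mkQ (mul_one (b : B))))

end Idealizer

/-! ### Balanced tensor products as quotients by right ideals -/

section BalSub

variable {A M N : Type*} [Ring M] [Algebra ℂ M] [Ring N] [Algebra ℂ N]
  {r : A → M →ₗ[ℂ] M} {l : A → N →ₗ[ℂ] N}

theorem balSub_mkQ {M N : Type*} [AddCommGroup M] [Module ℂ M] [AddCommGroup N] [Module ℂ N]
    (r : A → M →ₗ[ℂ] M) (l : A → N →ₗ[ℂ] N) (a : A) (m : M) (n : N) :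
    (balSub r l).mkQ (r a m ⊗ₜ[ℂ] n) = (balSub r l).mkQ (m ⊗ₜ[ℂ] l a n) :=
  (Submodule.Quotient.eq _).2 (Submodule.subset_span ⟨a, m, n, rfl⟩)

theorem isRightIdeal_balSub (hr : ∀ a m m', r a (m * m') = r a m * m')
    (hl : ∀ a n n', l a (n * n') = l a n * n') : (balSub r l).IsRightIdeal := by
  refine Submodule.isRightIdeal_span ?_
  rintro _ ⟨a, m, n, rfl⟩ b
  induction b using TensorProduct.induction_on with
  | zero => simp
  | add x y hx hy => rw [mul_add]; exact Submodule.add_mem _ hx hy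
  | tmul x y =>
    refine Submodule.subset_span ⟨a, m * x, n * y, ?_⟩
    simp [sub_mul, hr, hl]

/-- The generator of the relations attached to a, m, n is the one attached to a, 1, 1 multiplied on
the right by m ⊗ n, so only the latter has to be tested. -/
theorem mem_idealizer_balSub (hr : ∀ a m m', r a (m * m') = r a m * m')
    (hl : ∀ a n n', l a (n * n') = l a n * n') {b : M ⊗[ℂ] N}
    (h : ∀ a, (balSub r l).mkQ (b * (r a 1 ⊗ₜ[ℂ] 1)) = (balSub r l).mkQ (b * (1 ⊗ₜ[ℂ] l a 1))) :
    b ∈ (balSub r l).idealizer := by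
  refine Submodule.mem_idealizer_span ?_
  rintro _ ⟨a, m, n, rfl⟩
  have h1 := (Submodule.Quotient.eq _).1 ((isRightIdeal_balSub hr hl).mkQ_mul (h a) (m ⊗ₜ n))
  change _ ∈ balSub r l
  simpa [mul_assoc, ← mul_sub, ← hr, ← hl] using h1

theorem mkQ_mul_tmul {b : M ⊗[ℂ] N} (hb : b ∈ (balSub r l).idealizer)
    (a : A) : (balSub r l).mkQ (b * (r a 1 ⊗ₜ[ℂ] 1)) = (balSub r l).mkQ (b * (1 ⊗ₜ[ℂ] l a 1)) :=
  Submodule.mkQ_mul_of_mem hb (balSub_mkQ r l a 1 1)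

end BalSub

/-! ### Left bialgebroids from actions -/

section Left

variable {A L : Type*} [Ring A] [Algebra ℂ A] [Ring L] [Algebra ℂ L]

theorem leftActR_mul (t : Aᵐᵒᵖ →ₐ[ℂ] L) (a : A) (m m' : L) :
    leftActR t a (m * m') = leftActR t a m * m' := by simp [leftActR, mul_assoc]

theorem leftActL_mul (s : A →ₐ[ℂ] L) (a : A) (m m' : L) :
    leftActL s a (m * m') = leftActL s a m * m' := by simp [leftActL, mul_assoc]

theorem isRightIdeal_left (s : A →ₐ[ℂ] L) (t : Aᵐᵒᵖ →ₐ[ℂ] L) :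
    (balSub (leftActR t) (leftActL s)).IsRightIdeal :=
  isRightIdeal_balSub (leftActR_mul t) (leftActL_mul s)

/-- The idealizer is the preimage in L ⊗ L of the Takeuchi product; one axiom of a bialgebroid is
thus equivalent to the existence of the left multiplication action. -/
theorem mem_idealizer_left {s : A →ₐ[ℂ] L} {t : Aᵐᵒᵖ →ₐ[ℂ] L} {b : L ⊗[ℂ] L} :
    b ∈ (balSub (leftActR t) (leftActL s)).idealizer ↔
      ∀ a, (balSub (leftActR t) (leftActL s)).mkQ (b * (t (op a) ⊗ₜ[ℂ] 1)) =
        (balSub (leftActR t) (leftActL s)).mkQ (b * (1 ⊗ₜ[ℂ] s a)) := by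
  refine ⟨fun h a => ?_, fun h => mem_idealizer_balSub (leftActR_mul t) (leftActL_mul s) ?_⟩
  · simpa [leftActR, leftActL] using mkQ_mul_tmul h a
  · simpa [leftActR, leftActL] using h

theorem mkQ_left (s : A →ₐ[ℂ] L) (t : Aᵐᵒᵖ →ₐ[ℂ] L) (a : A) (m n : L) :
    (balSub (leftActR t) (leftActL s)).mkQ ((t (op a) * m) ⊗ₜ[ℂ] n) =
      (balSub (leftActR t) (leftActL s)).mkQ (m ⊗ₜ[ℂ] (s a * n)) :=
  balSub_mkQ (leftActR t) (leftActL s) a m n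

/-- The coproduct and the counit of a left bialgebroid given as actions of `L` on `L ⊗_A L` and
on `A`, before coassociativity and counitality are known. -/
structure LeftActionData (A L : Type*) [Ring A] [Algebra ℂ A] [Ring L] [Algebra ℂ L] where
  s : A →ₐ[ℂ] L
  t : Aᵐᵒᵖ →ₐ[ℂ] L
  s_t_comm : ∀ a b, s a * t b = t b * s a
  act : L →ₐ[ℂ] Module.End ℂ (BalTensor (leftActR t) (leftActL s))
  act_mem : ∀ X, act X ∈ (balSub (leftActR t) (leftActL s)).idealizerAct.range
  act_s : ∀ a, act (s a) ((balSub _ _).mkQ 1) = (balSub _ _).mkQ (s a ⊗ₜ[ℂ] 1)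
  act_t : ∀ a, act (t a) ((balSub _ _).mkQ 1) = (balSub _ _).mkQ (1 ⊗ₜ[ℂ] t a)
  eval : L →ₐ[ℂ] Module.End ℂ A
  eval_s : ∀ a b, eval (s a) b = a * b
  eval_t : ∀ a b, eval (t (op a)) b = b * a

namespace LeftActionData

variable (D : LeftActionData A L)

/-- The relations of `L ⊗_A L`. -/
abbrev rel : Submodule ℂ (L ⊗[ℂ] L) := balSub (leftActR D.t) (leftActL D.s)

/-- The coproduct. -/
def comul : L →ₗ[ℂ] BalTensor (leftActR D.t) (leftActL D.s) :=
  (LinearMap.applyₗ (D.rel.mkQ 1)) ∘ₗ D.act.toLinearMap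

/-- The counit. -/
def counit : L →ₗ[ℂ] A := (LinearMap.applyₗ (1 : A)) ∘ₗ D.eval.toLinearMap

theorem comul_apply (X : L) : D.comul X = D.act X (D.rel.mkQ 1) := rfl

theorem counit_apply (X : L) : D.counit X = D.eval X 1 := rfl

theorem exists_rep (X : L) : ∃ u, D.rel.mkQ u = D.comul X := Submodule.mkQ_surjective _ _

variable {D}

/-- An operator coming from the idealizer commutes with right multiplications, hence is determined
by its value at the class of 1. Multiplicativity of the coproduct is then just multiplicativity of
the action. -/
theorem act_mkQ {X : L} {u : L ⊗[ℂ] L} (hu : D.rel.mkQ u = D.comul X) (v : L ⊗[ℂ] L) :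
    D.act X (D.rel.mkQ v) = D.rel.mkQ (u * v) :=
  (isRightIdeal_left D.s D.t).act_mkQ (D.act_mem X) hu v

theorem mem_idealizer {X : L} {u : L ⊗[ℂ] L} (hu : D.rel.mkQ u = D.comul X) :
    u ∈ D.rel.idealizer :=
  (isRightIdeal_left D.s D.t).mem_idealizer (D.act_mem X) hu

theorem comul_mul {X Y : L} {u v : L ⊗[ℂ] L} (hu : D.rel.mkQ u = D.comul X)
    (hv : D.rel.mkQ v = D.comul Y) : D.rel.mkQ (u * v) = D.comul (X * Y) := by
  rw [← D.act_mkQ hu, hv, comul_apply, comul_apply, map_mul]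
  rfl

theorem takeuchi {X : L} {u : L ⊗[ℂ] L} (hu : D.rel.mkQ u = D.comul X) (a : A) :
    D.rel.mkQ (u * (D.t (op a) ⊗ₜ[ℂ] 1)) = D.rel.mkQ (u * (1 ⊗ₜ[ℂ] D.s a)) :=
  mem_idealizer_left.1 (mem_idealizer hu) a

variable (D)

theorem comul_one : D.rel.mkQ 1 = D.comul 1 := by simp [comul_apply]

theorem comul_s (a : A) : D.rel.mkQ (D.s a ⊗ₜ[ℂ] 1) = D.comul (D.s a) := (D.act_s a).symm

theorem comul_t (a : Aᵐᵒᵖ) : D.rel.mkQ (1 ⊗ₜ[ℂ] D.t a) = D.comul (D.t a) := (D.act_t a).symm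

/-- In the representation on A one has ε(XY) = X·(Y·1), and both s(b) and t(b) send 1 to b. -/
theorem eval_counit_s (X Y : L) : D.counit (X * Y) = D.counit (X * D.s (D.counit Y)) := by
  simp [counit_apply, D.eval_s]

theorem eval_counit_t (X Y : L) : D.counit (X * Y) = D.counit (X * D.t (op (D.counit Y))) := by
  simp [counit_apply, D.eval_t]

theorem counit_s_mul (a : A) (X : L) : D.counit (D.s a * X) = a * D.counit X := by
  simp [counit_apply, D.eval_s]

theorem counit_t_mul (a : A) (X : L) : D.counit (D.t (op a) * X) = D.counit X * a := by
  simp [counit_apply, D.eval_t]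

/-! #### Counitality -/

/-- The map `X ⊗ Y ↦ s(ε(X)) Y`. -/
def contractL : L ⊗[ℂ] L →ₗ[ℂ] L :=
  LinearMap.mul' ℂ L ∘ₗ TensorProduct.map (D.s.toLinearMap ∘ₗ D.counit) LinearMap.id

/-- The map `X ⊗ Y ↦ t(ε(Y)) X`. -/
def contractR : L ⊗[ℂ] L →ₗ[ℂ] L :=
  LinearMap.mul' ℂ L ∘ₗ (TensorProduct.comm ℂ L L).toLinearMap ∘ₗ TensorProduct.map LinearMap.id
      (D.t.toLinearMap ∘ₗ (MulOpposite.opLinearEquiv ℂ).toLinearMap ∘ₗ D.counit)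

@[simp] theorem contractL_tmul (X Y : L) : D.contractL (X ⊗ₜ Y) = D.s (D.counit X) * Y := rfl

@[simp] theorem contractR_tmul (X Y : L) : D.contractR (X ⊗ₜ Y) = D.t (op (D.counit Y)) * X := rfl

variable {D}

theorem contractL_eq {u v : L ⊗[ℂ] L} (h : D.rel.mkQ u = D.rel.mkQ v) :
    D.contractL u = D.contractL v := by
  have : D.rel ≤ LinearMap.ker D.contractL := by
    refine Submodule.span_le.2 ?_
    rintro _ ⟨a, m, n, rfl⟩
    simp [leftActR, leftActL, D.counit_t_mul, mul_assoc]
  exact sub_eq_zero.1 (by rw [← map_sub]; exact this ((Submodule.Quotient.eq _).1 h))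

theorem contractR_eq {u v : L ⊗[ℂ] L} (h : D.rel.mkQ u = D.rel.mkQ v) :
    D.contractR u = D.contractR v := by
  have : D.rel ≤ LinearMap.ker D.contractR := by
    refine Submodule.span_le.2 ?_
    rintro _ ⟨a, m, n, rfl⟩
    simp [leftActR, leftActL, D.counit_s_mul, mul_assoc]
  exact sub_eq_zero.1 (by rw [← map_sub]; exact this ((Submodule.Quotient.eq _).1 h))

theorem contractL_mul_one_tmul (u : L ⊗[ℂ] L) (q : L) :
    D.contractL (u * (1 ⊗ₜ q)) = D.contractL u * q := by
  induction u using TensorProduct.induction_on with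
  | zero => simp
  | add x y hx hy => simp [add_mul, hx, hy]
  | tmul x y => simp [mul_assoc]

theorem contractR_mul_tmul_one (u : L ⊗[ℂ] L) (q : L) :
    D.contractR (u * (q ⊗ₜ 1)) = D.contractR u * q := by
  induction u using TensorProduct.induction_on with
  | zero => simp
  | add x y hx hy => simp [add_mul, hx, hy]
  | tmul x y => simp [mul_assoc]

/-- Inside the counit of a product, p may be replaced by t(ε(p)). The Takeuchi property of u moves
this to the second factor as s(ε(p)), where it can be split off on the right. Hence the counit axiom
passes from two elements to their product. -/
theorem contractL_mul {u : L ⊗[ℂ] L} (hu : u ∈ D.rel.idealizer) (v : L ⊗[ℂ] L) :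
    D.contractL (u * v) = D.contractL u * D.contractL v := by
  induction v using TensorProduct.induction_on with
  | zero => simp
  | add x y hx hy => simp [mul_add, hx, hy]
  | tmul p q =>
    have h1 : ∀ w : L ⊗[ℂ] L, D.contractL (w * (p ⊗ₜ 1)) =
        D.contractL (w * (D.t (op (D.counit p)) ⊗ₜ 1)) := fun w => by
      induction w using TensorProduct.induction_on with
      | zero => simp
      | add x y hx hy => rw [add_mul, add_mul, map_add, map_add, hx, hy]
      | tmul x y => simp [D.eval_counit_t x p]
    calc D.contractL (u * (p ⊗ₜ q)) = D.contractL (u * (p ⊗ₜ 1) * (1 ⊗ₜ q)) := by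
          simp [mul_assoc]
      _ = D.contractL (u * (1 ⊗ₜ D.s (D.counit p))) * q := by
          rw [contractL_mul_one_tmul, h1, contractL_eq (mem_idealizer_left.1 hu _)]
      _ = _ := by rw [contractL_mul_one_tmul, mul_assoc, contractL_tmul]

theorem contractR_mul {u : L ⊗[ℂ] L} (hu : u ∈ D.rel.idealizer) (v : L ⊗[ℂ] L) :
    D.contractR (u * v) = D.contractR u * D.contractR v := by
  induction v using TensorProduct.induction_on with
  | zero => simp
  | add x y hx hy => simp [mul_add, hx, hy]
  | tmul p q =>
    have h1 : ∀ w : L ⊗[ℂ] L, D.contractR (w * (1 ⊗ₜ q)) =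
        D.contractR (w * (1 ⊗ₜ D.s (D.counit q))) := fun w => by
      induction w using TensorProduct.induction_on with
      | zero => simp
      | add x y hx hy => rw [add_mul, add_mul, map_add, map_add, hx, hy]
      | tmul x y => simp [D.eval_counit_s y q]
    calc D.contractR (u * (p ⊗ₜ q)) = D.contractR (u * (1 ⊗ₜ q) * (p ⊗ₜ 1)) := by
          simp [mul_assoc]
      _ = D.contractR (u * (D.t (op (D.counit q)) ⊗ₜ 1)) * p := by
          rw [contractR_mul_tmul_one, h1, contractR_eq (mem_idealizer_left.1 hu _)]
      _ = _ := by rw [contractR_mul_tmul_one, mul_assoc, contractR_tmul]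

variable (D) in
/-- The counit axioms hold for `X`. -/
def CounitalAt (X : L) : Prop :=
  ∀ u, D.rel.mkQ u = D.comul X → D.contractL u = X ∧ D.contractR u = X

theorem CounitalAt.of_rep {X : L} {u : L ⊗[ℂ] L} (hu : D.rel.mkQ u = D.comul X)
    (hl : D.contractL u = X) (hr : D.contractR u = X) : D.CounitalAt X := fun _ hv =>
  ⟨(contractL_eq (hv.trans hu.symm)).trans hl, (contractR_eq (hv.trans hu.symm)).trans hr⟩

theorem CounitalAt.add {X Y : L} (hX : D.CounitalAt X) (hY : D.CounitalAt Y) :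
    D.CounitalAt (X + Y) := by
  obtain ⟨u, hu⟩ := D.exists_rep X
  obtain ⟨v, hv⟩ := D.exists_rep Y
  refine .of_rep (u := u + v) (by rw [map_add, map_add, hu, hv]) ?_ ?_
  · rw [map_add, (hX u hu).1, (hY v hv).1]
  · rw [map_add, (hX u hu).2, (hY v hv).2]

theorem CounitalAt.mul {X Y : L} (hX : D.CounitalAt X) (hY : D.CounitalAt Y) :
    D.CounitalAt (X * Y) := by
  obtain ⟨u, hu⟩ := D.exists_rep X
  obtain ⟨v, hv⟩ := D.exists_rep Y
  refine .of_rep (comul_mul hu hv) ?_ ?_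
  · rw [contractL_mul (mem_idealizer hu), (hX u hu).1, (hY v hv).1]
  · rw [contractR_mul (mem_idealizer hu), (hX u hu).2, (hY v hv).2]

/-! #### Coassociativity -/

variable (D) in
/-- The relations of `L ⊗_A L ⊗_A L`. -/
abbrev rel₃ : Submodule ℂ (L ⊗[ℂ] (L ⊗[ℂ] L)) := balSub3 (leftActR D.t) (leftActL D.s)

theorem balAssocL_mkQ {A M : Type*} [AddCommGroup M] [Module ℂ M] (r l : A → M →ₗ[ℂ] M)
    (w : M ⊗[ℂ] M) (z : M) : balAssocL r l ((balSub r l).mkQ w ⊗ₜ z) =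
      (balSub3 r l).mkQ (TensorProduct.assoc ℂ M M M (w ⊗ₜ z)) := rfl

theorem balAssocR_mkQ {A M : Type*} [AddCommGroup M] [Module ℂ M] (r l : A → M →ₗ[ℂ] M)
    (w : M ⊗[ℂ] M) (z : M) : balAssocR r l (z ⊗ₜ (balSub r l).mkQ w) =
      (balSub3 r l).mkQ (z ⊗ₜ w) := rfl

variable (D) in
theorem isRightIdeal_rel₃ : D.rel₃.IsRightIdeal := by
  refine Submodule.isRightIdeal_span ?_
  rintro w hw b
  induction b using TensorProduct.induction_on with
  | zero => simp
  | add x y hx hy => rw [mul_add]; exact Submodule.add_mem _ hx hy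
  | tmul p c =>
    induction c using TensorProduct.induction_on with
    | zero => simp
    | add x y hx hy => rw [TensorProduct.tmul_add, mul_add]; exact Submodule.add_mem _ hx hy
    | tmul q r =>
      rcases hw with ⟨a, x, y, z, rfl⟩ | ⟨a, x, y, z, rfl⟩
      · exact Submodule.subset_span (Or.inl ⟨a, x * p, y * q, z * r, by
          simp [sub_mul, leftActR, leftActL, mul_assoc]⟩)
      · exact Submodule.subset_span (Or.inr ⟨a, x * p, y * q, z * r, by
          simp [sub_mul, leftActR, leftActL, mul_assoc]⟩)

theorem mem_idealizer_rel₃ {b : L ⊗[ℂ] (L ⊗[ℂ] L)}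
    (h1 : ∀ a, D.rel₃.mkQ (b * (D.t (op a) ⊗ₜ 1)) = D.rel₃.mkQ (b * (1 ⊗ₜ (D.s a ⊗ₜ 1))))
    (h2 : ∀ a, D.rel₃.mkQ (b * (1 ⊗ₜ (D.t (op a) ⊗ₜ 1))) =
      D.rel₃.mkQ (b * (1 ⊗ₜ (1 ⊗ₜ D.s a)))) : b ∈ D.rel₃.idealizer := by
  refine Submodule.mem_idealizer_span ?_
  rintro w (⟨a, x, y, z, rfl⟩ | ⟨a, x, y, z, rfl⟩)
  · have := (Submodule.Quotient.eq _).1 (D.isRightIdeal_rel₃.mkQ_mul (h1 a) (x ⊗ₜ (y ⊗ₜ z)))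
    rw [mul_assoc, mul_assoc, ← mul_sub] at this
    change _ ∈ D.rel₃
    simpa [leftActR, leftActL] using this
  · have := (Submodule.Quotient.eq _).1 (D.isRightIdeal_rel₃.mkQ_mul (h2 a) (x ⊗ₜ (y ⊗ₜ z)))
    rw [mul_assoc, mul_assoc, ← mul_sub] at this
    change _ ∈ D.rel₃
    simpa [leftActR, leftActL] using this

variable (D) in
-- A linear section of the quotient map exists over a field. It provides representatives of all
-- coproducts at once, linearly in X, without any multiplicativity.
theorem exists_lift_comul : ∃ δ : L →ₗ[ℂ] L ⊗[ℂ] L, ∀ X, D.rel.mkQ (δ X) = D.comul X := by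
  obtain ⟨σ, hσ⟩ := LinearMap.exists_rightInverse_of_surjective D.rel.mkQ
    (LinearMap.range_eq_top.2 (Submodule.mkQ_surjective _))
  exact ⟨σ ∘ₗ D.comul, fun X => LinearMap.congr_fun hσ (D.comul X)⟩

variable (D) in
/-- `(Δ ⊗ id) u` -/
def splitL : L ⊗[ℂ] L →ₗ[ℂ] BalTensor3 (leftActR D.t) (leftActL D.s) :=
  balAssocL _ _ ∘ₗ TensorProduct.map D.comul LinearMap.id

variable (D) in
/-- `(id ⊗ Δ) u` -/
def splitR : L ⊗[ℂ] L →ₗ[ℂ] BalTensor3 (leftActR D.t) (leftActL D.s) :=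
  balAssocR _ _ ∘ₗ TensorProduct.map LinearMap.id D.comul

theorem splitL_tmul {X : L} {u : L ⊗[ℂ] L} (hu : D.rel.mkQ u = D.comul X) (Y : L) :
    D.splitL (X ⊗ₜ Y) = D.rel₃.mkQ (TensorProduct.assoc ℂ L L L (u ⊗ₜ Y)) := by
  rw [← balAssocL_mkQ, hu]
  rfl

theorem splitR_tmul {Y : L} {u : L ⊗[ℂ] L} (hu : D.rel.mkQ u = D.comul Y) (X : L) :
    D.splitR (X ⊗ₜ Y) = D.rel₃.mkQ (X ⊗ₜ u) := by
  rw [← balAssocR_mkQ, hu]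
  rfl

/-- The coproduct is right A-linear with t(a) acting on its second factor, so a relation of L ⊗_A L
becomes a relation between the last two factors of the triple product. -/
theorem splitL_eq {u v : L ⊗[ℂ] L} (h : D.rel.mkQ u = D.rel.mkQ v) :
    D.splitL u = D.splitL v := by
  have : D.rel ≤ LinearMap.ker D.splitL := by
    refine Submodule.span_le.2 ?_
    rintro _ ⟨a, m, n, rfl⟩
    obtain ⟨w, hw⟩ := D.exists_rep m
    have h1 : D.rel.mkQ ((1 ⊗ₜ D.t (op a)) * w) = D.comul (leftActR D.t a m) :=
      comul_mul (D.comul_t _) hw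
    simp only [SetLike.mem_coe, LinearMap.mem_ker, map_sub]
    rw [splitL_tmul h1, splitL_tmul hw, sub_eq_zero]
    clear h1 hw
    induction w using TensorProduct.induction_on with
    | zero => simp
    | add x y hx hy => simp only [mul_add, TensorProduct.add_tmul, map_add, hx, hy]
    | tmul x y =>
      refine (Submodule.Quotient.eq _).2 (Submodule.subset_span (Or.inr ⟨a, x, y, n, ?_⟩))
      simp [leftActR]
  exact sub_eq_zero.1 (by rw [← map_sub]; exact this ((Submodule.Quotient.eq _).1 h))

theorem splitR_eq {u v : L ⊗[ℂ] L} (h : D.rel.mkQ u = D.rel.mkQ v) :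
    D.splitR u = D.splitR v := by
  have : D.rel ≤ LinearMap.ker D.splitR := by
    refine Submodule.span_le.2 ?_
    rintro _ ⟨a, m, n, rfl⟩
    obtain ⟨w, hw⟩ := D.exists_rep n
    have h1 : D.rel.mkQ ((D.s a ⊗ₜ 1) * w) = D.comul (leftActL D.s a n) :=
      comul_mul (D.comul_s _) hw
    simp only [SetLike.mem_coe, LinearMap.mem_ker, map_sub]
    rw [splitR_tmul h1, splitR_tmul hw, sub_eq_zero]
    clear h1 hw
    induction w using TensorProduct.induction_on with
    | zero => simp
    | add x y hx hy => simp only [mul_add, TensorProduct.tmul_add, map_add, hx, hy]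
    | tmul x y =>
      refine (Submodule.Quotient.eq _).2 (Submodule.subset_span (Or.inl ⟨a, m, x, y, ?_⟩))
      simp [leftActL]
  exact sub_eq_zero.1 (by rw [← map_sub]; exact this ((Submodule.Quotient.eq _).1 h))

variable (D) in
/-- Coassociativity holds for `X`. -/
def CoassocAt (X : L) : Prop := ∀ u, D.rel.mkQ u = D.comul X → D.splitL u = D.splitR u

theorem CoassocAt.of_rep {X : L} {u : L ⊗[ℂ] L} (hu : D.rel.mkQ u = D.comul X)
    (h : D.splitL u = D.splitR u) : D.CoassocAt X := fun v hv => by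
  rw [splitL_eq (hv.trans hu.symm), h, splitR_eq (hv.trans hu.symm)]

theorem CoassocAt.add {X Y : L} (hX : D.CoassocAt X) (hY : D.CoassocAt Y) :
    D.CoassocAt (X + Y) := by
  obtain ⟨u, hu⟩ := D.exists_rep X
  obtain ⟨v, hv⟩ := D.exists_rep Y
  refine .of_rep (u := u + v) (by rw [map_add, map_add, hu, hv]) ?_
  rw [map_add, map_add, hX u hu, hY v hv]

theorem assoc_mul (u v : (L ⊗[ℂ] L) ⊗[ℂ] L) : TensorProduct.assoc ℂ L L L (u * v) =
    TensorProduct.assoc ℂ L L L u * TensorProduct.assoc ℂ L L L v :=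
  map_mul (Algebra.TensorProduct.assoc ℂ ℂ ℂ L L L) u v

/-- With lifts l and r of Δ ⊗ id and id ⊗ Δ, the claim is l(u) l(v) ≡ r(u) r(v) modulo the triple
relations. Replacing l(u) by r(u) on the left only uses that the relations form a right ideal;
replacing l(v) by r(v) on the right requires l(u) to be in their idealizer. -/
theorem CoassocAt.mul {X Y : L} (hX : D.CoassocAt X) (hY : D.CoassocAt Y) :
    D.CoassocAt (X * Y) := by
  obtain ⟨u, hu⟩ := D.exists_rep X
  obtain ⟨v, hv⟩ := D.exists_rep Y
  obtain ⟨δ, hδ⟩ := D.exists_lift_comul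
  let l : L ⊗[ℂ] L →ₗ[ℂ] L ⊗[ℂ] (L ⊗[ℂ] L) :=
    (TensorProduct.assoc ℂ L L L).toLinearMap ∘ₗ TensorProduct.map δ LinearMap.id
  let r : L ⊗[ℂ] L →ₗ[ℂ] L ⊗[ℂ] (L ⊗[ℂ] L) := TensorProduct.map LinearMap.id δ
  have lt : ∀ p q, l (p ⊗ₜ q) = TensorProduct.assoc ℂ L L L (δ p ⊗ₜ q) := fun _ _ => rfl
  have rt : ∀ p q, r (p ⊗ₜ q) = p ⊗ₜ δ q := fun _ _ => rfl
  have hl : ∀ w, D.splitL w = D.rel₃.mkQ (l w) := fun w => by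
    induction w using TensorProduct.induction_on with
    | zero => simp only [map_zero]
    | add x y hx hy => simp only [map_add, hx, hy]
    | tmul x y => exact splitL_tmul (hδ x) y
  have hr : ∀ w, D.splitR w = D.rel₃.mkQ (r w) := fun w => by
    induction w using TensorProduct.induction_on with
    | zero => simp only [map_zero]
    | add x y hx hy => simp only [map_add, hx, hy]
    | tmul x y => exact splitR_tmul (hδ y) x
  have lmul : ∀ w w', D.splitL (w * w') = D.rel₃.mkQ (l w * l w') := fun w w' => by
    induction w using TensorProduct.induction_on with
    | zero => simp only [map_zero, zero_mul]
    | add x y hx hy => simp only [map_add, add_mul, hx, hy]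
    | tmul x y =>
      induction w' using TensorProduct.induction_on with
      | zero => simp only [map_zero, mul_zero]
      | add x y hx hy => simp only [map_add, mul_add, hx, hy]
      | tmul x' y' =>
        rw [Algebra.TensorProduct.tmul_mul_tmul, splitL_tmul (comul_mul (hδ x) (hδ x')), lt, lt,
          ← assoc_mul, Algebra.TensorProduct.tmul_mul_tmul]
  have rmul : ∀ w w', D.splitR (w * w') = D.rel₃.mkQ (r w * r w') := fun w w' => by
    induction w using TensorProduct.induction_on with
    | zero => simp only [map_zero, zero_mul]
    | add x y hx hy => simp only [map_add, add_mul, hx, hy]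
    | tmul x y =>
      induction w' using TensorProduct.induction_on with
      | zero => simp only [map_zero, mul_zero]
      | add x y hx hy => simp only [map_add, mul_add, hx, hy]
      | tmul x' y' =>
        rw [Algebra.TensorProduct.tmul_mul_tmul, splitR_tmul (comul_mul (hδ y) (hδ y')), rt, rt,
          Algebra.TensorProduct.tmul_mul_tmul]
  have hlr : D.rel₃.mkQ (l u) = D.rel₃.mkQ (r u) := by rw [← hl, ← hr, hX u hu]
  have I₃ := D.isRightIdeal_rel₃
  -- The two Takeuchi conditions concern the first and the last pair of factors. The first follows
  -- from the Takeuchi property of the coproducts used to build l(u).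
  have mem : l u ∈ D.rel₃.idealizer := by
    refine mem_idealizer_rel₃ (fun a => ?_) (fun a => ?_)
    · generalize u = w
      induction w using TensorProduct.induction_on with
      | zero => simp only [map_zero, zero_mul]
      | add x y hx hy => simp only [map_add, add_mul, hx, hy]
      | tmul x y =>
        have h := congrArg (fun z => balAssocL (leftActR D.t) (leftActL D.s) (z ⊗ₜ y))
          (takeuchi (hδ x) a)
        have e1 : D.t (op a) ⊗ₜ[ℂ] (1 : L ⊗[ℂ] L) = TensorProduct.assoc ℂ L L L
          ((D.t (op a) ⊗ₜ 1) ⊗ₜ 1) := rfl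
        have e2 : (1 : L) ⊗ₜ[ℂ] (D.s a ⊗ₜ[ℂ] (1 : L)) = TensorProduct.assoc ℂ L L L
          ((1 ⊗ₜ D.s a) ⊗ₜ 1) := rfl
        rw [lt, e1, e2, ← assoc_mul, ← assoc_mul, Algebra.TensorProduct.tmul_mul_tmul,
          Algebra.TensorProduct.tmul_mul_tmul, mul_one]
        exact h
    -- For the last pair, coassociativity of u allows passing to r(u), whose last two factors form a
    -- coproduct.
    · rw [I₃.mkQ_mul hlr, I₃.mkQ_mul hlr]
      generalize u = w
      induction w using TensorProduct.induction_on with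
      | zero => simp only [map_zero, zero_mul]
      | add x y hx hy => simp only [map_add, add_mul, hx, hy]
      | tmul x y =>
        have h := congrArg (fun z => balAssocR (leftActR D.t) (leftActL D.s) (x ⊗ₜ z))
          (takeuchi (hδ y) a)
        rw [rt, Algebra.TensorProduct.tmul_mul_tmul, Algebra.TensorProduct.tmul_mul_tmul, mul_one]
        exact h
  refine .of_rep (comul_mul hu hv) ?_
  rw [lmul, rmul, ← I₃.mkQ_mul hlr]
  exact Submodule.mkQ_mul_of_mem mem (by rw [← hl, ← hr, hY v hv])

/-- The left bialgebroid with given actions of `L` on `L ⊗_A L` and on `A`. -/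
def toLeftBialgebroid (D : LeftActionData A L) (hco : ∀ X, D.CoassocAt X)
    (hcu : ∀ X, D.CounitalAt X) : LeftBialgebroid A L where
  s := D.s
  t := D.t
  s_t_comm := D.s_t_comm
  comul := D.comul
  counit := D.counit
  comul_bimod a b X u hu := by
    have h : D.rel.mkQ (D.s a ⊗ₜ D.t (op b)) = D.comul (D.s a * D.t (op b)) := by
      simpa using comul_mul (D.comul_s a) (D.comul_t (op b))
    exact (comul_mul h hu).symm
  counit_bimod a b X := by rw [mul_assoc, D.counit_s_mul, D.counit_t_mul, mul_assoc]
  coassoc X u hu := hco X u hu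
  counit_left X u hu := (hcu X u hu).1
  counit_right X u hu := (hcu X u hu).2
  takeuchi a X u hu := takeuchi hu a
  comul_one := D.comul_one.symm
  comul_mul X Y u v hu hv := (comul_mul hu hv).symm
  counit_one := by simp [counit_apply]
  counit_mul_s := D.eval_counit_s
  counit_mul_t := D.eval_counit_t

end LeftActionData

end Left

/-! ### The coproduct of `IIL(Ω)` -/

section Comul

variable {A Ω 𝔛 : Type*} [Ring A] [Algebra ℂ A] [StarRing A]
  [AddCommGroup Ω] [Module ℂ Ω] [Module A Ω] [Module Aᵐᵒᵖ Ω] [StarAddMonoid Ω]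
  [AddCommGroup 𝔛] [Module ℂ 𝔛] [Module A 𝔛] [Module Aᵐᵒᵖ 𝔛]
  {C : StarFODC A Ω} {P : PivotalDual A Ω 𝔛}
  {L : Type*} [Ring L] [Algebra ℂ L]

section Act

variable {B : Type*} [Ring B] [Algebra ℂ B] {I : Submodule ℂ B}

/-- A relation between the operators lifts to a relation between their symbols in the idealizer, so
it suffices to verify that one modulo I, in the ambient algebra. -/
theorem Submodule.IsRightIdeal.satIL_act (hI : I.IsRightIdeal) {U : Gens A Ω 𝔛 I.idealizer}
    (h : ∀ X Y, ILRel C P (U.map I.idealizer.val) X Y → I.mkQ X = I.mkQ Y) :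
    (U.map I.idealizerAct).SatIL C P := by
  intro X Y r
  obtain ⟨X, Y, r', rfl, rfl⟩ := r.exists_of_map I.idealizerAct
  exact hI.idealizerAct_eq (h _ _ (r'.map_algHom I.idealizer.val))

theorem Submodule.IsRightIdeal.satIIL_act (hI : I.IsRightIdeal) {U : Gens A Ω 𝔛 I.idealizer}
    (h : ∀ X Y, IILRel P (U.map I.idealizer.val) X Y → I.mkQ X = I.mkQ Y) :
    (U.map I.idealizerAct).SatIIL P := by
  intro X Y r
  obtain ⟨X, Y, r', rfl, rfl⟩ := r.exists_of_map I.idealizerAct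
  exact hI.idealizerAct_eq (h _ _ (r'.map_algHom I.idealizer.val))

end Act

theorem sum_comm₃ {ι κ μ M : Type*} [Fintype ι] [Fintype κ] [Fintype μ] [AddCommMonoid M]
    (f : ι → κ → μ → M) : ∑ i, ∑ j, ∑ k, f i j k = ∑ k, ∑ j, ∑ i, f i j k := by
  rw [Finset.sum_comm, Finset.sum_comm (γ := μ)]
  exact Finset.sum_congr rfl fun j _ => Finset.sum_comm

namespace Gens

variable {g : Gens A Ω 𝔛 L}

/-- The values of the coproduct on generators, in `L ⊗ L`. -/
def delta (P : PivotalDual A Ω 𝔛) (g : Gens A Ω 𝔛 L) : Gens A Ω 𝔛 (L ⊗[ℂ] L) where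
  s a := g.s a ⊗ₜ 1
  t a := 1 ⊗ₜ g.t a
  v x := g.v x ⊗ₜ 1 + ∑ i, g.xo x (P.ωL i) ⊗ₜ g.v (P.xL i)
  xo x ω := ∑ i, g.xo x (P.ωL i) ⊗ₜ g.xo (P.xL i) ω
  ox ω y := ∑ j, g.ox ω (P.yR j) ⊗ₜ g.ox (P.ηR j) y

namespace SatIL

/-- The relations of `L ⊗_A L`. -/
abbrev rel (h : g.SatIL C P) : Submodule ℂ (L ⊗[ℂ] L) :=
  balSub (leftActR h.basic.tHom) (leftActL h.basic.sHom)

theorem mkQ_rel (h : g.SatIL C P) (a : A) (m n : L) :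
    h.rel.mkQ ((g.t a * m) ⊗ₜ n) = h.rel.mkQ (m ⊗ₜ (g.s a * n)) :=
  mkQ_left h.basic.sHom h.basic.tHom a m n

theorem mkQ_rel_t (h : g.SatIL C P) (a : A) (n : L) :
    h.rel.mkQ (g.t a ⊗ₜ n) = h.rel.mkQ (1 ⊗ₜ (g.s a * n)) := by
  simpa using h.mkQ_rel a 1 n

theorem mkQ_rel_s (h : g.SatIL C P) (a : A) (m : L) :
    h.rel.mkQ (m ⊗ₜ g.s a) = h.rel.mkQ ((g.t a * m) ⊗ₜ 1) := by
  simpa using (h.mkQ_rel a m 1).symm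

theorem balanced_mkQ_xo_v (h : g.SatIL C P) (x : 𝔛) :
    IsBalanced A fun (ω : Ω) (y : 𝔛) => h.rel.mkQ (g.xo x ω ⊗ₜ g.v y) where
  add_left m m' n := by rw [h.basic.xo_add_right, TensorProduct.add_tmul, map_add]
  add_right m n n' := by rw [h.basic.v_add, TensorProduct.tmul_add, map_add]
  smul a m n := by rw [← h.t_xo, h.mkQ_rel, h.s_v]

theorem balanced_mkQ_xo_xo (h : g.SatIL C P) (x : 𝔛) (η : Ω) :
    IsBalanced A fun (ω : Ω) (y : 𝔛) => h.rel.mkQ (g.xo x ω ⊗ₜ g.xo y η) where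
  add_left m m' n := by rw [h.basic.xo_add_right, TensorProduct.add_tmul, map_add]
  add_right m n n' := by rw [h.basic.xo_add_left, TensorProduct.tmul_add, map_add]
  smul a m n := by rw [← h.t_xo, h.mkQ_rel, h.s_xo]

theorem balanced_mkQ_ox_ox (h : g.SatIL C P) (ω : Ω) (y : 𝔛) :
    IsBalanced A fun (x : 𝔛) (η : Ω) => h.rel.mkQ (g.ox ω x ⊗ₜ g.ox η y) where
  add_left m m' n := by rw [h.basic.ox_add_right, TensorProduct.add_tmul, map_add]
  add_right m n n' := by rw [h.basic.ox_add_left, TensorProduct.tmul_add, map_add]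
  smul a m n := by rw [← h.t_ox, h.mkQ_rel, h.s_ox]

theorem sum_mkQ_xo_smul_v (h : g.SatIL C P) (x : 𝔛) (a : A) :
    ∑ i, h.rel.mkQ (g.xo x (a • P.ωL i) ⊗ₜ g.v (P.xL i)) =
      ∑ i, h.rel.mkQ (g.xo x (P.ωL i) ⊗ₜ g.v (op a • P.xL i)) :=
  P.coevL_comm (h.balanced_mkQ_xo_v x) a

theorem sum_mkQ_xo_smul_xo (h : g.SatIL C P) (x : 𝔛) (η : Ω) (a : A) :
    ∑ i, h.rel.mkQ (g.xo x (a • P.ωL i) ⊗ₜ g.xo (P.xL i) η) =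
      ∑ i, h.rel.mkQ (g.xo x (P.ωL i) ⊗ₜ g.xo (op a • P.xL i) η) :=
  P.coevL_comm (h.balanced_mkQ_xo_xo x η) a

theorem sum_mkQ_ox_smul_ox (h : g.SatIL C P) (ω : Ω) (y : 𝔛) (a : A) :
    ∑ j, h.rel.mkQ (g.ox ω (a • P.yR j) ⊗ₜ g.ox (P.ηR j) y) =
      ∑ j, h.rel.mkQ (g.ox ω (P.yR j) ⊗ₜ g.ox (op a • P.ηR j) y) :=
  P.coevR_comm (h.balanced_mkQ_ox_ox ω y) a

theorem mem_idealizer_iff (h : g.SatIL C P) {b : L ⊗[ℂ] L} : b ∈ h.rel.idealizer ↔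
    ∀ a, h.rel.mkQ (b * (g.t a ⊗ₜ 1)) = h.rel.mkQ (b * (1 ⊗ₜ g.s a)) :=
  mem_idealizer_left

theorem delta_s_mem (h : g.SatIL C P) (a : A) : (g.delta P).s a ∈ h.rel.idealizer := by
  refine h.mem_idealizer_iff.2 fun b => ?_
  simp only [delta, Algebra.TensorProduct.tmul_mul_tmul, mul_one, one_mul, h.mkQ_rel_s,
    h.basic.s_t]

theorem delta_t_mem (h : g.SatIL C P) (a : A) : (g.delta P).t a ∈ h.rel.idealizer := by
  refine h.mem_idealizer_iff.2 fun b => ?_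
  simp only [delta, Algebra.TensorProduct.tmul_mul_tmul, mul_one, one_mul, h.mkQ_rel_t,
    h.basic.s_t]

/-- Moving t(b) past x in the first factor produces (x, db) ⊗ 1. Moving s(b) past the x_i in the
second produces ∑ (x, ω_i) ⊗ ev^L(x_i, db), and this is again (x, db) ⊗ 1 by the snake identity. -/
theorem delta_v_mem (h : g.SatIL C P) (x : 𝔛) : (g.delta P).v x ∈ h.rel.idealizer := by
  refine h.mem_idealizer_iff.2 fun b => ?_
  have hs : ∑ i, h.rel.mkQ ((g.t (P.evL (P.xL i) (C.d b)) * g.xo x (P.ωL i)) ⊗ₜ 1) =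
      h.rel.mkQ (g.xo x (C.d b) ⊗ₜ 1) := by
    simp only [h.t_xo]
    rw [← map_sum, ← TensorProduct.sum_tmul, ← h.basic.xo_sum_right, P.snakeL_form]
  simp only [delta, add_mul, Finset.sum_mul, Algebra.TensorProduct.tmul_mul_tmul, mul_one, one_mul,
    h.v_t, h.xo_t, h.v_s, TensorProduct.add_tmul, TensorProduct.tmul_add, map_add, map_sum,
    Finset.sum_add_distrib, h.sum_mkQ_xo_smul_v, h.mkQ_rel_s, hs]
  abel

theorem delta_xo_mem (h : g.SatIL C P) (x : 𝔛) (ω : Ω) :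
    (g.delta P).xo x ω ∈ h.rel.idealizer := by
  refine h.mem_idealizer_iff.2 fun b => ?_
  simp only [delta, Finset.sum_mul, Algebra.TensorProduct.tmul_mul_tmul, mul_one, h.xo_t, h.xo_s,
    map_sum, h.sum_mkQ_xo_smul_xo]

theorem delta_ox_mem (h : g.SatIL C P) (ω : Ω) (y : 𝔛) :
    (g.delta P).ox ω y ∈ h.rel.idealizer := by
  refine h.mem_idealizer_iff.2 fun b => ?_
  simp only [delta, Finset.sum_mul, Algebra.TensorProduct.tmul_mul_tmul, mul_one, h.ox_t, h.ox_s,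
    map_sum, h.sum_mkQ_ox_smul_ox]

/-- The values of the coproduct on generators, in the idealizer. -/
def deltaIdealizer (h : g.SatIL C P) : Gens A Ω 𝔛 h.rel.idealizer where
  s a := ⟨_, h.delta_s_mem a⟩
  t a := ⟨_, h.delta_t_mem a⟩
  v x := ⟨_, h.delta_v_mem x⟩
  xo x ω := ⟨_, h.delta_xo_mem x ω⟩
  ox ω y := ⟨_, h.delta_ox_mem ω y⟩

theorem isRightIdeal_rel (h : g.SatIL C P) : h.rel.IsRightIdeal := isRightIdeal_left _ _

theorem delta_basic (h : g.SatIL C P) {X Y : L ⊗[ℂ] L} (r : BasicRel (g.delta P) X Y) : X = Y := by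
  have hb := h.basic
  cases r with
  | s_scalar c => simp [delta, hb.s_scalar, Algebra.TensorProduct.algebraMap_apply]
  | t_scalar c =>
    change 1 ⊗ₜ[ℂ] g.t _ = _
    rw [hb.t_scalar, Algebra.TensorProduct.algebraMap_apply']
  | _ =>
    simp only [delta, hb.s_add, hb.s_mul, hb.t_add, hb.t_mul,
      hb.xo_add_left, hb.xo_add_right, hb.xo_smul_left, hb.xo_smul_right, hb.ox_add_left,
      hb.ox_add_right, hb.ox_smul_left, hb.ox_smul_right, hb.v_add, hb.v_smul,
      TensorProduct.add_tmul, TensorProduct.tmul_add, Finset.sum_add_distrib, mul_one, one_mul,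
      Algebra.TensorProduct.tmul_mul_tmul, Finset.smul_sum, smul_add, TensorProduct.smul_tmul',
      TensorProduct.tmul_smul] <;> abel

/-- The pattern for all four invertibility relations: expand the product, contract the sum carrying
the given coevaluation in one tensor factor to a source or target element, move that element across
the tensor sign, reassemble by the snake identity, and contract the remaining sum. -/
theorem delta_ox_xo (h : g.SatIL C P) (ω : Ω) (y : 𝔛) :
    h.rel.mkQ (∑ i, (g.delta P).ox (P.ωL i) y * (g.delta P).xo (P.xL i) ω) =
      h.rel.mkQ ((g.delta P).t (P.evR ω y)) := by
  calc _ = ∑ k, ∑ j, h.rel.mkQ ((∑ i, g.ox (P.ωL i) (P.yR j) * g.xo (P.xL i) (P.ωL k)) ⊗ₜ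
        (g.ox (P.ηR j) y * g.xo (P.xL k) ω)) := by
        simp only [delta, Finset.sum_mul_sum, Algebra.TensorProduct.tmul_mul_tmul, map_sum,
          TensorProduct.sum_tmul]
        exact sum_comm₃ _
    _ = _ := by
        simp only [h.ox_xo, h.mkQ_rel_t, ← mul_assoc, h.s_ox]
        simp only [← map_sum, ← TensorProduct.tmul_sum, ← Finset.sum_mul, ← h.basic.ox_sum_left,
          P.snakeR_form, h.ox_xo]
        rfl

theorem delta_xo_ox (h : g.SatIL C P) (x : 𝔛) (ω : Ω) :
    h.rel.mkQ (∑ j, (g.delta P).xo x (P.ηR j) * (g.delta P).ox ω (P.yR j)) =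
      h.rel.mkQ ((g.delta P).s (P.evL x ω)) := by
  calc _ = ∑ k, ∑ i, h.rel.mkQ ((g.xo x (P.ωL i) * g.ox ω (P.yR k)) ⊗ₜ
        (∑ j, g.xo (P.xL i) (P.ηR j) * g.ox (P.ηR k) (P.yR j))) := by
        simp only [delta, Finset.sum_mul_sum, Algebra.TensorProduct.tmul_mul_tmul, map_sum,
          TensorProduct.tmul_sum]
        exact sum_comm₃ _
    _ = _ := by
        simp only [h.xo_ox, h.mkQ_rel_s, ← mul_assoc, h.t_xo]
        simp only [← map_sum, ← TensorProduct.sum_tmul, ← Finset.sum_mul, ← h.basic.xo_sum_right,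
          P.snakeL_form, h.xo_ox]
        rfl

theorem delta_iil_xo_ox (h : g.SatIL C P) (h' : g.SatIIL P) (x : 𝔛) (ω : Ω) :
    h.rel.mkQ (∑ j, (g.delta P).xo (P.yR j) ω * (g.delta P).ox (P.ηR j) x) =
      h.rel.mkQ ((g.delta P).t (P.evL x ω)) := by
  calc _ = ∑ k, ∑ i, h.rel.mkQ ((∑ j, g.xo (P.yR j) (P.ωL i) * g.ox (P.ηR j) (P.yR k)) ⊗ₜ
        (g.xo (P.xL i) ω * g.ox (P.ηR k) x)) := by
        simp only [delta, Finset.sum_mul_sum, Algebra.TensorProduct.tmul_mul_tmul, map_sum,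
          TensorProduct.sum_tmul]
        exact sum_comm₃ _
    _ = _ := by
        simp only [h'.xo_ox, h.mkQ_rel_t, ← mul_assoc, h.s_xo]
        simp only [← map_sum, ← TensorProduct.tmul_sum, ← Finset.sum_mul, ← h.basic.xo_sum_left,
          P.snakeL_field, h'.xo_ox]
        rfl

theorem delta_iil_ox_xo (h : g.SatIL C P) (h' : g.SatIIL P) (ω : Ω) (x : 𝔛) :
    h.rel.mkQ (∑ i, (g.delta P).ox ω (P.xL i) * (g.delta P).xo x (P.ωL i)) =
      h.rel.mkQ ((g.delta P).s (P.evR ω x)) := by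
  calc _ = ∑ k, ∑ j, h.rel.mkQ ((g.ox ω (P.yR j) * g.xo x (P.ωL k)) ⊗ₜ
        (∑ i, g.ox (P.ηR j) (P.xL i) * g.xo (P.xL k) (P.ωL i))) := by
        simp only [delta, Finset.sum_mul_sum, Algebra.TensorProduct.tmul_mul_tmul, map_sum,
          TensorProduct.tmul_sum]
        exact sum_comm₃ _
    _ = _ := by
        simp only [h'.ox_xo, h.mkQ_rel_s, ← mul_assoc, h.t_ox]
        simp only [← map_sum, ← TensorProduct.sum_tmul, ← Finset.sum_mul, ← h.basic.ox_sum_right,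
          P.snakeR_field, h'.ox_xo]
        rfl

theorem delta_rel (h : g.SatIL C P) {X Y : L ⊗[ℂ] L} (r : ILRel C P (g.delta P) X Y) :
    h.rel.mkQ X = h.rel.mkQ Y := by
  cases r with
  | basic r => rw [h.delta_basic r]
  | v_s a x =>
    simp only [delta, add_mul, Finset.sum_mul, Algebra.TensorProduct.tmul_mul_tmul, h.v_s, h.xo_s,
      mul_one, TensorProduct.add_tmul]
    congr 1
    abel
  | v_t a x =>
    simp only [delta, add_mul, mul_add, Finset.sum_mul, Finset.mul_sum, one_mul, mul_one,
      Algebra.TensorProduct.tmul_mul_tmul, h.v_t, TensorProduct.tmul_add, Finset.sum_add_distrib]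
    congr 1
    abel
  | ox_xo ω y => exact h.delta_ox_xo ω y
  | xo_ox x ω => exact h.delta_xo_ox x ω
  | _ => simp only [delta, Finset.sum_mul, Finset.mul_sum, Algebra.TensorProduct.tmul_mul_tmul,
      mul_one, one_mul, mul_add, add_mul, h.s_xo, h.xo_s, h.t_xo, h.xo_t, h.s_ox, h.ox_s, h.t_ox,
      h.ox_t, h.s_v]

theorem delta_rel' (h : g.SatIL C P) (h' : g.SatIIL P) {X Y : L ⊗[ℂ] L}
    (r : IILRel P (g.delta P) X Y) : h.rel.mkQ X = h.rel.mkQ Y := by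
  cases r with
  | xo_ox x ω => exact h.delta_iil_xo_ox h' x ω
  | ox_xo ω x => exact h.delta_iil_ox_xo h' ω x

theorem satIL_deltaAct (h : g.SatIL C P) :
    (h.deltaIdealizer.map h.rel.idealizerAct).SatIL C P :=
  h.isRightIdeal_rel.satIL_act fun _ _ r => h.delta_rel r

theorem satIIL_deltaAct (h : g.SatIL C P) (h' : g.SatIIL P) :
    (h.deltaIdealizer.map h.rel.idealizerAct).SatIIL P :=
  h.isRightIdeal_rel.satIIL_act fun _ _ r => h.delta_rel' h' r

end SatIL

/-- The action of the generators on `A` that defines the counit. -/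
def eval (C : StarFODC A Ω) (P : PivotalDual A Ω 𝔛) [IsScalarTower ℂ A Ω] [IsScalarTower ℂ A 𝔛] :
    Gens A Ω 𝔛 (Module.End ℂ A) where
  s a := LinearMap.mulLeft ℂ a
  t a := LinearMap.mulRight ℂ a
  v x := P.evL x ∘ₗ C.d
  xo x ω := P.evL x ∘ₗ (LinearMap.toSpanSingleton A Ω ω).restrictScalars ℂ
  ox ω y := P.evR ω ∘ₗ (LinearMap.toSpanSingleton A 𝔛 y).restrictScalars ℂ

section Eval

variable [IsScalarTower ℂ A Ω] [IsScalarTower ℂ A 𝔛]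

@[simp] theorem eval_s_apply (a b : A) : (eval C P).s a b = a * b := rfl
@[simp] theorem eval_t_apply (a b : A) : (eval C P).t a b = b * a := rfl
@[simp] theorem eval_v_apply (x : 𝔛) (b : A) : (eval C P).v x b = P.evL x (C.d b) := rfl
@[simp] theorem eval_xo_apply (x : 𝔛) (ω : Ω) (b : A) :
    (eval C P).xo x ω b = P.evL x (b • ω) := rfl
@[simp] theorem eval_ox_apply (ω : Ω) (y : 𝔛) (b : A) :
    (eval C P).ox ω y b = P.evR ω (b • y) := rfl

/-- The two relations moving a field past A are the Leibniz rule, and the invertibility relations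
are the snake identities. -/
theorem satIL_eval [SMulCommClass A Aᵐᵒᵖ Ω] [SMulCommClass A Aᵐᵒᵖ 𝔛] : (eval C P).SatIL C P := by
  intro X Y r
  refine LinearMap.ext fun b => ?_
  cases r with
  | basic r =>
    cases r with
    | s_scalar c => simp [← Algebra.smul_def]
    | t_scalar c => simp [← Algebra.smul_def, ← Algebra.commutes]
    | xo_smul_right c x ω =>
      change P.evL x (b • c • ω) = c • P.evL x (b • ω)
      rw [smul_algebra_smul_comm c b ω, map_smul]
    | ox_smul_right c ω y =>
      change P.evR ω (b • c • y) = c • P.evR ω (b • y)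
      rw [smul_algebra_smul_comm c b y, map_smul]
    | _ => simp [add_mul, mul_add, mul_assoc]
  | v_s a x =>
    simp only [LinearMap.add_apply, Module.End.mul_apply, eval_v_apply, eval_s_apply, C.leibniz,
      map_add, P.evL_right, P.evL_mid]
    rw [add_comm]
  | v_t a x =>
    simp only [LinearMap.add_apply, Module.End.mul_apply, eval_v_apply, eval_t_apply, C.leibniz,
      map_add, P.evL_right, eval_xo_apply]
  | ox_xo ω y =>
    simp only [LinearMap.sum_apply, Module.End.mul_apply, eval_ox_apply, eval_xo_apply,
      eval_t_apply, ← P.evR_mid]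
    simp only [← LinearMap.sum_apply, ← map_sum, P.snakeL_form, P.evR_left]
  | xo_ox x ω =>
    simp only [LinearMap.sum_apply, Module.End.mul_apply, eval_ox_apply, eval_xo_apply,
      eval_s_apply, ← P.evR_mid, ← map_sum, P.snakeR_form, P.evL_right]
  | _ => simp [P.evL_left, P.evL_mid, P.evL_right, P.evR_left, P.evR_mid, P.evR_right, mul_assoc,
      smul_smul, smul_comm]

theorem satIIL_eval : (eval C P).SatIIL P := by
  intro X Y r
  refine LinearMap.ext fun b => ?_
  cases r with
  | xo_ox x ω =>
    simp only [LinearMap.sum_apply, Module.End.mul_apply, eval_ox_apply, eval_xo_apply,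
      eval_t_apply, ← P.evL_mid]
    simp only [← LinearMap.sum_apply, ← map_sum, P.snakeR_field, P.evL_left]
  | ox_xo ω x =>
    simp only [LinearMap.sum_apply, Module.End.mul_apply, eval_ox_apply, eval_xo_apply,
      eval_s_apply, ← P.evL_mid, ← map_sum, P.snakeL_field, P.evR_right]

end Eval

end Gens

end Comul

/-! ### The left bialgebroid `IIL(Ω)` -/

section LeftBialgebroid

variable {A Ω 𝔛 : Type*} [Ring A] [Algebra ℂ A] [StarRing A]
  [AddCommGroup Ω] [Module ℂ Ω] [Module A Ω] [Module Aᵐᵒᵖ Ω] [StarAddMonoid Ω]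
  [AddCommGroup 𝔛] [Module ℂ 𝔛] [Module A 𝔛] [Module Aᵐᵒᵖ 𝔛]
  [IsScalarTower ℂ A Ω] [IsScalarTower ℂ A 𝔛]
  {C : StarFODC A Ω} {P : PivotalDual A Ω 𝔛} {L : Type*} [Ring L] [Algebra ℂ L]

/-- The coproduct and counit determined by their values on generators. -/
def Gens.leftActionData {g : Gens A Ω 𝔛 L} (hL : g.SatIL C P) (hg : g.Generates)
    (f : L →ₐ[ℂ] Module.End ℂ (BalTensor (leftActR hL.basic.tHom) (leftActL hL.basic.sHom)))
    (hf : g.map f = hL.deltaIdealizer.map hL.rel.idealizerAct)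
    (k : L →ₐ[ℂ] Module.End ℂ A) (hk : g.map k = Gens.eval C P) : LeftActionData A L where
  s := hL.basic.sHom
  t := hL.basic.tHom
  s_t_comm a b := hL.basic.s_t a b.unop
  act := f
  act_mem := hg (hL.rel.idealizerAct.range.comap f)
    (fun a => ⟨_, (congrFun (congrArg Gens.s hf) a).symm⟩)
    (fun a => ⟨_, (congrFun (congrArg Gens.t hf) a).symm⟩)
    (fun a => ⟨_, (congrFun (congrArg Gens.v hf) a).symm⟩)
    (fun a b => ⟨_, (congrFun (congrFun (congrArg Gens.xo hf) a) b).symm⟩)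
    (fun a b => ⟨_, (congrFun (congrFun (congrArg Gens.ox hf) a) b).symm⟩)
  act_s a := by
    rw [show f (hL.basic.sHom a) = _ from congrFun (congrArg Gens.s hf) a]
    exact congrArg hL.rel.mkQ (mul_one _)
  act_t a := by
    rw [show f (hL.basic.tHom a) = _ from congrFun (congrArg Gens.t hf) a.unop]
    exact congrArg hL.rel.mkQ (mul_one _)
  eval := k
  eval_s a b := by
    rw [show k (hL.basic.sHom a) = _ from congrFun (congrArg Gens.s hk) a]
    rfl
  eval_t a b := by
    rw [show k (hL.basic.tHom (op a)) = _ from congrFun (congrArg Gens.t hk) a]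
    rfl

/-- Coassociativity and counitality are stable under products, so only generators remain. There
coassociativity is a rearrangement of finite sums, and the counit axioms are immediate or snake
identities. -/
theorem exists_leftBialgebroid {g : Gens A Ω 𝔛 L} (hL : g.SatIL C P) (hg : g.Generates)
    (f : L →ₐ[ℂ] Module.End ℂ (BalTensor (leftActR hL.basic.tHom) (leftActL hL.basic.sHom)))
    (hf : g.map f = hL.deltaIdealizer.map hL.rel.idealizerAct)
    (k : L →ₐ[ℂ] Module.End ℂ A) (hk : g.map k = Gens.eval C P) :
    ∃ H : LeftBialgebroid A L, IsGhobadiLeft P g H := by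
  let D := Gens.leftActionData hL hg f hf k hk
  have ds : ∀ a, D.rel.mkQ (g.s a ⊗ₜ 1) = D.comul (g.s a) := D.comul_s
  have dt : ∀ a, D.rel.mkQ (1 ⊗ₜ g.t a) = D.comul (g.t a) := fun a => D.comul_t (op a)
  have dv : ∀ x, D.rel.mkQ (g.v x ⊗ₜ[ℂ] 1 + ∑ i, g.xo x (P.ωL i) ⊗ₜ[ℂ] g.v (P.xL i)) =
      D.comul (g.v x) := fun x => by
    change _ = f (g.v x) _
    rw [show f (g.v x) = _ from congrFun (congrArg Gens.v hf) x]
    exact congrArg D.rel.mkQ (mul_one _).symm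
  have dxo : ∀ x ω, D.rel.mkQ (∑ i, g.xo x (P.ωL i) ⊗ₜ[ℂ] g.xo (P.xL i) ω) =
      D.comul (g.xo x ω) := fun x ω => by
    change _ = f (g.xo x ω) _
    rw [show f (g.xo x ω) = _ from congrFun (congrFun (congrArg Gens.xo hf) x) ω]
    exact congrArg D.rel.mkQ (mul_one _).symm
  have dox : ∀ ω y, D.rel.mkQ (∑ j, g.ox ω (P.yR j) ⊗ₜ[ℂ] g.ox (P.ηR j) y) =
      D.comul (g.ox ω y) := fun ω y => by
    change _ = f (g.ox ω y) _
    rw [show f (g.ox ω y) = _ from congrFun (congrFun (congrArg Gens.ox hf) ω) y]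
    exact congrArg D.rel.mkQ (mul_one _).symm
  have es : ∀ a, D.counit (g.s a) = a := fun a => by
    change k (g.s a) 1 = _
    rw [show k (g.s a) = _ from congrFun (congrArg Gens.s hk) a, Gens.eval_s_apply, mul_one]
  have et : ∀ a, D.counit (g.t a) = a := fun a => by
    change k (g.t a) 1 = _
    rw [show k (g.t a) = _ from congrFun (congrArg Gens.t hk) a, Gens.eval_t_apply, one_mul]
  -- The counit of a field is ev^L(x, d1), and the Leibniz rule forces d1 = 0.
  have d1 : C.d 1 = 0 := by simpa using C.leibniz 1 1
  have ev : ∀ x, D.counit (g.v x) = 0 := fun a => by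
    change k (g.v a) 1 = _
    rw [show k (g.v a) = _ from congrFun (congrArg Gens.v hk) a, Gens.eval_v_apply, d1, map_zero]
  have exo : ∀ x ω, D.counit (g.xo x ω) = P.evL x ω := fun x ω => by
    change k (g.xo x ω) 1 = _
    rw [show k (g.xo x ω) = _ from congrFun (congrFun (congrArg Gens.xo hk) x) ω,
      Gens.eval_xo_apply, one_smul]
  have eox : ∀ ω y, D.counit (g.ox ω y) = P.evR ω y := fun x ω => by
    change k (g.ox x ω) 1 = _
    rw [show k (g.ox x ω) = _ from congrFun (congrFun (congrArg Gens.ox hk) x) ω,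
      Gens.eval_ox_apply, one_smul]
  have hb := hL.basic
  have Ds : ∀ a, D.s a = g.s a := fun _ => rfl
  have Dt : ∀ a, D.t (op a) = g.t a := fun _ => rfl
  have cu : ∀ X, D.CounitalAt X := by
    refine hg.induction hb ?_ ?_ ?_ ?_ ?_ (fun _ _ => .add) (fun _ _ => .mul)
    · intro a
      refine .of_rep (ds a) ?_ ?_
      · simp [es, Ds]
      · have : D.counit 1 = 1 := by simpa [hb.s_one] using es 1
        simp [this]
    · intro a
      refine .of_rep (dt a) ?_ ?_
      · have : D.counit 1 = 1 := by simpa [hb.s_one] using es 1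
        simp [this]
      · simp [et, Dt]
    · intro x
      have : D.counit 1 = 1 := by simpa [hb.s_one] using es 1
      refine .of_rep (dv x) ?_ ?_
      · have h0 : g.s 0 = 0 := map_zero hb.sHom
        simp only [map_add, LeftActionData.contractL_tmul, ev, map_sum, exo, Ds, hL.s_v,
          ← hb.v_sum, P.snakeL_field, h0, zero_mul, zero_add]
      · simp [ev, this]
    · intro x ω
      refine .of_rep (dxo x ω) ?_ ?_
      · simp only [LeftActionData.contractL_tmul, map_sum, exo, Ds, hL.s_xo,
          ← hb.xo_sum_left, P.snakeL_field]
      · simp only [LeftActionData.contractR_tmul, map_sum, exo, Dt, hL.t_xo,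
          ← hb.xo_sum_right, P.snakeL_form]
    · intro ω y
      refine .of_rep (dox ω y) ?_ ?_
      · simp only [LeftActionData.contractL_tmul, map_sum, eox, Ds, hL.s_ox,
          ← hb.ox_sum_left, P.snakeR_form]
      · simp only [LeftActionData.contractR_tmul, map_sum, eox, Dt, hL.t_ox,
          ← hb.ox_sum_right, P.snakeR_field]
  have co : ∀ X, D.CoassocAt X := by
    have a1 : ∀ w z : L, TensorProduct.assoc ℂ L L L ((w ⊗ₜ[ℂ] (1 : L)) ⊗ₜ[ℂ] z) =
      w ⊗ₜ (1 ⊗ₜ z) := fun _ _ => rfl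
    refine hg.induction hb ?_ ?_ ?_ ?_ ?_ (fun _ _ => .add) (fun _ _ => .mul)
    · intro a
      refine .of_rep (ds a) ?_
      rw [LeftActionData.splitL_tmul (ds a), LeftActionData.splitR_tmul D.comul_one]
      rfl
    · intro a
      refine .of_rep (dt a) ?_
      rw [LeftActionData.splitL_tmul D.comul_one, LeftActionData.splitR_tmul (dt a)]
      rfl
    · intro x
      refine .of_rep (dv x) ?_
      simp only [map_add, map_sum, LeftActionData.splitL_tmul (dv _),
        LeftActionData.splitL_tmul (dxo _ _), LeftActionData.splitR_tmul D.comul_one,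
        LeftActionData.splitR_tmul (dv _), TensorProduct.add_tmul, TensorProduct.sum_tmul,
        TensorProduct.tmul_add, TensorProduct.tmul_sum, TensorProduct.assoc_tmul,
        Finset.sum_add_distrib, Algebra.TensorProduct.one_def, add_assoc]
      rw [Finset.sum_comm]
    · intro x ω
      refine .of_rep (dxo x ω) ?_
      simp only [map_sum, LeftActionData.splitL_tmul (dxo _ _),
        LeftActionData.splitR_tmul (dxo _ _), TensorProduct.sum_tmul,
        TensorProduct.tmul_sum, TensorProduct.assoc_tmul]
      rw [Finset.sum_comm]
    · intro ω y
      refine .of_rep (dox ω y) ?_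
      simp only [map_sum, LeftActionData.splitL_tmul (dox _ _),
        LeftActionData.splitR_tmul (dox _ _), TensorProduct.sum_tmul,
        TensorProduct.tmul_sum, TensorProduct.assoc_tmul]
      rw [Finset.sum_comm]
  exact ⟨D.toLeftBialgebroid co cu, fun _ => rfl, fun _ => rfl, fun a => (ds a).symm,
    fun a => (dt a).symm, fun x => (dv x).symm, fun x ω => (dxo x ω).symm,
    fun ω y => (dox ω y).symm, es, et, ev, exo, eox⟩

end LeftBialgebroid

/-! ### The translation map of `IIL(Ω)` -/

section OpRel

variable {A L : Type*} [Ring A] [Algebra ℂ A] [Ring L] [Algebra ℂ L]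

/-- The relations `X t(a) ⊗ Y = X ⊗ t(a) Y`, as a right ideal of `L^op ⊗ L`. -/
def opRel (t : Aᵐᵒᵖ →ₐ[ℂ] L) : Submodule ℂ (Lᵐᵒᵖ ⊗[ℂ] L) :=
  balSub (fun a : A => LinearMap.mulLeft ℂ (op (t (op a))))
    (fun a : A => LinearMap.mulLeft ℂ (t (op a)))

theorem isRightIdeal_opRel (t : Aᵐᵒᵖ →ₐ[ℂ] L) : (opRel t).IsRightIdeal :=
  isRightIdeal_balSub (by simp [mul_assoc]) (by simp [mul_assoc])

theorem mkQ_opRel (t : Aᵐᵒᵖ →ₐ[ℂ] L) (a : A) (m n : L) :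
    (opRel t).mkQ (op (m * t (op a)) ⊗ₜ n) = (opRel t).mkQ (op m ⊗ₜ (t (op a) * n)) :=
  balSub_mkQ (fun a : A => LinearMap.mulLeft ℂ (op (t (op a))))
    (fun a : A => LinearMap.mulLeft ℂ (t (op a))) a (op m) n

theorem mem_idealizer_opRel (t : Aᵐᵒᵖ →ₐ[ℂ] L) {b : Lᵐᵒᵖ ⊗[ℂ] L}
    (h : ∀ a, (opRel t).mkQ (b * (op (t (op a)) ⊗ₜ[ℂ] 1)) =
      (opRel t).mkQ (b * (1 ⊗ₜ[ℂ] t (op a)))) : b ∈ (opRel t).idealizer :=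
  mem_idealizer_balSub (by simp [mul_assoc]) (by simp [mul_assoc]) (by
    intro a
    rw [LinearMap.mulLeft_apply, LinearMap.mulLeft_apply, mul_one, mul_one]
    exact h a)

end OpRel

section Translation

variable {A Ω 𝔛 : Type*} [Ring A] [Algebra ℂ A] [StarRing A]
  [AddCommGroup Ω] [Module ℂ Ω] [Module A Ω] [Module Aᵐᵒᵖ Ω] [StarAddMonoid Ω]
  [AddCommGroup 𝔛] [Module ℂ 𝔛] [Module A 𝔛] [Module Aᵐᵒᵖ 𝔛]
  {C : StarFODC A Ω} {P : PivotalDual A Ω 𝔛}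
  {L : Type*} [Ring L] [Algebra ℂ L]

section Act

variable {B : Type*} [Ring B] [Algebra ℂ B] {I : Submodule ℂ B}

theorem Submodule.IsRightIdeal.satIL_act_op (hI : I.IsRightIdeal)
    {U : Gens A Ω 𝔛 I.idealizerᵐᵒᵖ}
    (h : ∀ X Y, ILRel C P (U.map (AlgHom.op I.idealizer.val)) X Y →
      I.mkQ (unop X) = I.mkQ (unop Y)) :
    (U.map (AlgHom.op I.idealizerAct)).SatIL C P := by
  intro X Y r
  obtain ⟨X, Y, r', rfl, rfl⟩ := r.exists_of_map (AlgHom.op I.idealizerAct)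
  exact congrArg op (hI.idealizerAct_eq (h _ _ (r'.map_algHom (AlgHom.op I.idealizer.val))))

theorem Submodule.IsRightIdeal.satIIL_act_op (hI : I.IsRightIdeal)
    {U : Gens A Ω 𝔛 I.idealizerᵐᵒᵖ}
    (h : ∀ X Y, IILRel P (U.map (AlgHom.op I.idealizer.val)) X Y →
      I.mkQ (unop X) = I.mkQ (unop Y)) :
    (U.map (AlgHom.op I.idealizerAct)).SatIIL P := by
  intro X Y r
  obtain ⟨X, Y, r', rfl, rfl⟩ := r.exists_of_map (AlgHom.op I.idealizerAct)
  exact congrArg op (hI.idealizerAct_eq (h _ _ (r'.map_algHom (AlgHom.op I.idealizer.val))))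

end Act

namespace Gens

variable {g : Gens A Ω 𝔛 L}

/-- The image of a vector field under `Φ⁻¹`. -/
def psiV (P : PivotalDual A Ω 𝔛) (g : Gens A Ω 𝔛 L) (y : 𝔛) : L :=
  ∑ i, g.ox (P.ωL i) y * g.v (P.xL i)

/-- The values of the translation map on generators, in `(L^op ⊗ L)^op`. -/
def gamma (P : PivotalDual A Ω 𝔛) (g : Gens A Ω 𝔛 L) : Gens A Ω 𝔛 (Lᵐᵒᵖ ⊗[ℂ] L)ᵐᵒᵖ where
  s a := op (op (g.s a) ⊗ₜ 1)
  t a := op (1 ⊗ₜ g.s a)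
  v x := op (op (g.v x) ⊗ₜ 1 - ∑ j, op (g.xo x (P.ηR j)) ⊗ₜ g.psiV P (P.yR j))
  xo x ω := op (∑ j, op (g.xo x (P.ηR j)) ⊗ₜ g.ox ω (P.yR j))
  ox ω y := op (∑ i, op (g.ox ω (P.xL i)) ⊗ₜ g.xo y (P.ωL i))

namespace SatIL

/-- This lemma and the next three are relations of IR read in L^op, where `psiV` is the field
generator. -/
theorem psiV_add (h : g.SatIL C P) (x y : 𝔛) : g.psiV P (x + y) = g.psiV P x + g.psiV P y :=
  MulOpposite.op_injective (h.psi.basic.v_add x y)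

theorem t_psiV (h : g.SatIL C P) (a : A) (y : 𝔛) : g.t a * g.psiV P y = g.psiV P (op a • y) :=
  MulOpposite.op_injective (h.psi.v_s a y)

theorem psiV_t (h : g.SatIL C P) (a : A) (y : 𝔛) :
    g.psiV P y * g.t a = g.psiV P (a • y) + g.t (P.evR (C.d a) y) :=
  MulOpposite.op_injective (h.psi.s_v a y)

theorem psiV_s (h : g.SatIL C P) (a : A) (y : 𝔛) :
    g.psiV P y * g.s a = g.s a * g.psiV P y + g.ox (C.d a) y :=
  MulOpposite.op_injective (h.psi.t_v a y)

/-- The relations of `L ⊗_{A^op} L`. -/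
abbrev opRel (h : g.SatIL C P) : Submodule ℂ (Lᵐᵒᵖ ⊗[ℂ] L) := _root_.opRel h.basic.tHom

theorem mkQ_opRel (h : g.SatIL C P) (a : A) (m n : L) :
    h.opRel.mkQ (op (m * g.t a) ⊗ₜ n) = h.opRel.mkQ (op m ⊗ₜ (g.t a * n)) :=
  _root_.mkQ_opRel h.basic.tHom a m n

theorem mkQ_opRel_right (h : g.SatIL C P) (a : A) (m : L) :
    h.opRel.mkQ (op m ⊗ₜ g.t a) = h.opRel.mkQ (op (m * g.t a) ⊗ₜ 1) := by
  simpa using (h.mkQ_opRel a m 1).symm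

theorem mkQ_opRel_left (h : g.SatIL C P) (a : A) (n : L) :
    h.opRel.mkQ (op (g.t a) ⊗ₜ n) = h.opRel.mkQ (1 ⊗ₜ (g.t a * n)) := by
  simpa using h.mkQ_opRel a 1 n

theorem balanced_opRel_xo_ox (h : g.SatIL C P) (x : 𝔛) (ω : Ω) :
    IsBalanced A fun (y : 𝔛) (η : Ω) => h.opRel.mkQ (op (g.xo x η) ⊗ₜ g.ox ω y) where
  add_left m m' n := by rw [h.basic.ox_add_right, TensorProduct.tmul_add, map_add]
  add_right m n n' := by
    rw [h.basic.xo_add_right, MulOpposite.op_add, TensorProduct.add_tmul, map_add]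
  smul a m n := by rw [← h.t_ox, ← h.mkQ_opRel, h.xo_t]

theorem balanced_opRel_xo_psiV (h : g.SatIL C P) (x : 𝔛) :
    IsBalanced A fun (y : 𝔛) (η : Ω) => h.opRel.mkQ (op (g.xo x η) ⊗ₜ g.psiV P y) where
  add_left m m' n := by rw [h.psiV_add, TensorProduct.tmul_add, map_add]
  add_right m n n' := by
    rw [h.basic.xo_add_right, MulOpposite.op_add, TensorProduct.add_tmul, map_add]
  smul a m n := by rw [← h.t_psiV, ← h.mkQ_opRel, h.xo_t]

theorem balanced_opRel_ox_xo (h : g.SatIL C P) (ω : Ω) (y : 𝔛) :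
    IsBalanced A fun (η : Ω) (x : 𝔛) => h.opRel.mkQ (op (g.ox ω x) ⊗ₜ g.xo y η) where
  add_left m m' n := by rw [h.basic.xo_add_right, TensorProduct.tmul_add, map_add]
  add_right m n n' := by
    rw [h.basic.ox_add_right, MulOpposite.op_add, TensorProduct.add_tmul, map_add]
  smul a m n := by rw [← h.t_xo, ← h.mkQ_opRel, h.ox_t]

theorem sum_opRel_xo_ox (h : g.SatIL C P) (x : 𝔛) (ω : Ω) (a : A) :
    ∑ j, h.opRel.mkQ (op (g.xo x (P.ηR j)) ⊗ₜ g.ox ω (a • P.yR j)) =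
      ∑ j, h.opRel.mkQ (op (g.xo x (op a • P.ηR j)) ⊗ₜ g.ox ω (P.yR j)) :=
  P.coevR_comm (h.balanced_opRel_xo_ox x ω) a

theorem sum_opRel_xo_psiV (h : g.SatIL C P) (x : 𝔛) (a : A) :
    ∑ j, h.opRel.mkQ (op (g.xo x (P.ηR j)) ⊗ₜ g.psiV P (a • P.yR j)) =
      ∑ j, h.opRel.mkQ (op (g.xo x (op a • P.ηR j)) ⊗ₜ g.psiV P (P.yR j)) :=
  P.coevR_comm (h.balanced_opRel_xo_psiV x) a

theorem sum_opRel_ox_xo (h : g.SatIL C P) (ω : Ω) (y : 𝔛) (a : A) :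
    ∑ i, h.opRel.mkQ (op (g.ox ω (P.xL i)) ⊗ₜ g.xo y (a • P.ωL i)) =
      ∑ i, h.opRel.mkQ (op (g.ox ω (op a • P.xL i)) ⊗ₜ g.xo y (P.ωL i)) :=
  P.coevL_comm (h.balanced_opRel_ox_xo ω y) a

theorem mem_idealizer_opRel (h : g.SatIL C P) {b : Lᵐᵒᵖ ⊗[ℂ] L}
    (hb : ∀ a, h.opRel.mkQ (b * (op (g.t a) ⊗ₜ[ℂ] 1)) =
      h.opRel.mkQ (b * (1 ⊗ₜ[ℂ] g.t a))) : b ∈ h.opRel.idealizer :=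
  _root_.mem_idealizer_opRel h.basic.tHom hb

theorem gamma_s_mem (h : g.SatIL C P) (a : A) : unop ((g.gamma P).s a) ∈ h.opRel.idealizer := by
  refine h.mem_idealizer_opRel fun b => ?_
  simp only [gamma, MulOpposite.unop_op, Algebra.TensorProduct.tmul_mul_tmul, mul_one, one_mul,
    h.mkQ_opRel_right, ← MulOpposite.op_mul, h.basic.s_t]

theorem gamma_t_mem (h : g.SatIL C P) (a : A) : unop ((g.gamma P).t a) ∈ h.opRel.idealizer := by
  refine h.mem_idealizer_opRel fun b => ?_
  simp only [gamma, MulOpposite.unop_op, Algebra.TensorProduct.tmul_mul_tmul, mul_one, one_mul,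
    h.mkQ_opRel_left, h.basic.s_t]

/-- The two terms of the translation of x have opposite defects. The first contributes (x, db) ⊗ 1
through x • t(b); the second contributes its negative through ∑ (x, ev^R(db, y_j) η_j) and the snake
identity. -/
theorem gamma_v_mem (h : g.SatIL C P) (x : 𝔛) : unop ((g.gamma P).v x) ∈ h.opRel.idealizer := by
  refine h.mem_idealizer_opRel fun b => ?_
  have hs : ∑ j, h.opRel.mkQ (op (g.xo x (P.evR (C.d b) (P.yR j) • P.ηR j)) ⊗ₜ 1) =
      h.opRel.mkQ (op (g.xo x (C.d b)) ⊗ₜ 1) := by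
    rw [← map_sum, ← TensorProduct.sum_tmul, ← Finset.op_sum, ← h.basic.xo_sum_right,
      P.snakeR_form]
  simp only [gamma, MulOpposite.unop_op, sub_mul, Finset.sum_mul, mul_one, one_mul, map_sub,
    Algebra.TensorProduct.tmul_mul_tmul, ← MulOpposite.op_mul, map_sum, h.t_xo, h.psiV_t,
    TensorProduct.tmul_add, map_add, Finset.sum_add_distrib, h.sum_opRel_xo_psiV,
    h.mkQ_opRel_right, h.xo_t, hs, h.v_t, MulOpposite.op_add, TensorProduct.add_tmul]
  abel

theorem gamma_xo_mem (h : g.SatIL C P) (x : 𝔛) (ω : Ω) :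
    unop ((g.gamma P).xo x ω) ∈ h.opRel.idealizer := by
  refine h.mem_idealizer_opRel fun b => ?_
  simp only [gamma, MulOpposite.unop_op, Finset.sum_mul, Algebra.TensorProduct.tmul_mul_tmul,
    mul_one, ← MulOpposite.op_mul, map_sum, h.t_xo, h.ox_t, h.sum_opRel_xo_ox]

theorem gamma_ox_mem (h : g.SatIL C P) (ω : Ω) (y : 𝔛) :
    unop ((g.gamma P).ox ω y) ∈ h.opRel.idealizer := by
  refine h.mem_idealizer_opRel fun b => ?_
  simp only [gamma, MulOpposite.unop_op, Finset.sum_mul, Algebra.TensorProduct.tmul_mul_tmul,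
    mul_one, ← MulOpposite.op_mul, map_sum, h.t_ox, h.xo_t, h.sum_opRel_ox_xo]

/-- The values of the translation map on generators, in the idealizer. -/
def gammaIdealizer (h : g.SatIL C P) : Gens A Ω 𝔛 h.opRel.idealizerᵐᵒᵖ where
  s a := op ⟨_, h.gamma_s_mem a⟩
  t a := op ⟨_, h.gamma_t_mem a⟩
  v x := op ⟨_, h.gamma_v_mem x⟩
  xo x ω := op ⟨_, h.gamma_xo_mem x ω⟩
  ox ω y := op ⟨_, h.gamma_ox_mem ω y⟩

theorem gamma_basic (h : g.SatIL C P) {X Y : (Lᵐᵒᵖ ⊗[ℂ] L)ᵐᵒᵖ}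
    (r : BasicRel (g.gamma P) X Y) : X = Y := by
  have hb := h.basic
  have hsmul : ∀ (c : ℂ) y, g.psiV P (c • y) = c • g.psiV P y := fun c y =>
    MulOpposite.op_injective (h.psi.basic.v_smul c y)
  apply MulOpposite.unop_injective
  cases r with
  | s_scalar c =>
    change op (g.s _) ⊗ₜ[ℂ] 1 = algebraMap ℂ (Lᵐᵒᵖ ⊗[ℂ] L) c
    rw [hb.s_scalar, Algebra.TensorProduct.algebraMap_apply]
    rfl
  | t_scalar c =>
    change 1 ⊗ₜ[ℂ] g.s _ = algebraMap ℂ (Lᵐᵒᵖ ⊗[ℂ] L) c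
    rw [hb.s_scalar, Algebra.TensorProduct.algebraMap_apply']
  | _ =>
    simp only [gamma, hb.s_add, hb.s_mul, MulOpposite.unop_op, MulOpposite.unop_mul,
      MulOpposite.unop_add, MulOpposite.unop_smul, ← MulOpposite.op_mul, MulOpposite.op_add,
      MulOpposite.op_smul, h.psiV_add, hsmul, Finset.sum_neg_distrib, sub_eq_add_neg, smul_neg,
      hb.xo_add_left, hb.xo_add_right, hb.xo_smul_left, hb.xo_smul_right, hb.ox_add_left,
      hb.ox_add_right, hb.ox_smul_left, hb.ox_smul_right, hb.v_add, hb.v_smul,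
      TensorProduct.add_tmul, TensorProduct.tmul_add, Finset.sum_add_distrib, mul_one, one_mul,
      Algebra.TensorProduct.tmul_mul_tmul, Finset.smul_sum, smul_add, TensorProduct.smul_tmul',
      TensorProduct.tmul_smul] <;> abel

/-- The translation map mixes the two kinds of invertibility: preserving a relation of IL already
requires one of the additional relations of IIL, and conversely. The contraction pattern is that of
`delta_ox_xo`, in L^op ⊗ L. -/
theorem gamma_ox_xo (h : g.SatIL C P) (h' : g.SatIIL P) (ω : Ω) (y : 𝔛) :
    h.opRel.mkQ (unop (∑ i, (g.gamma P).ox (P.ωL i) y * (g.gamma P).xo (P.xL i) ω)) =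
      h.opRel.mkQ (unop ((g.gamma P).t (P.evR ω y))) := by
  calc _ = ∑ j, ∑ k, h.opRel.mkQ (op (∑ i, g.ox (P.ωL i) (P.xL k) * g.xo (P.xL i) (P.ηR j)) ⊗ₜ
        (g.ox ω (P.yR j) * g.xo y (P.ωL k))) := by
        simp only [gamma, Finset.unop_sum, MulOpposite.unop_mul, MulOpposite.unop_op,
          Finset.sum_mul_sum, Algebra.TensorProduct.tmul_mul_tmul, map_sum, Finset.op_sum,
          TensorProduct.sum_tmul, ← MulOpposite.op_mul]
        exact sum_comm₃ _
    _ = _ := by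
        rw [Finset.sum_comm]
        simp only [h.ox_xo, h.mkQ_opRel_left, ← mul_assoc, h.t_ox]
        simp only [← map_sum, ← TensorProduct.tmul_sum, ← Finset.sum_mul, ← h.basic.ox_sum_right,
          P.snakeR_field, h'.ox_xo]
        rfl

theorem gamma_xo_ox (h : g.SatIL C P) (h' : g.SatIIL P) (x : 𝔛) (ω : Ω) :
    h.opRel.mkQ (unop (∑ j, (g.gamma P).xo x (P.ηR j) * (g.gamma P).ox ω (P.yR j))) =
      h.opRel.mkQ (unop ((g.gamma P).s (P.evL x ω))) := by
  calc _ = ∑ k, ∑ i, h.opRel.mkQ (op (g.xo x (P.ηR k) * g.ox ω (P.xL i)) ⊗ₜ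
        (∑ j, g.xo (P.yR j) (P.ωL i) * g.ox (P.ηR j) (P.yR k))) := by
        simp only [gamma, Finset.unop_sum, MulOpposite.unop_mul, MulOpposite.unop_op,
          Finset.sum_mul_sum, Algebra.TensorProduct.tmul_mul_tmul, map_sum,
          TensorProduct.tmul_sum, ← MulOpposite.op_mul]
        exact sum_comm₃ _
    _ = _ := by
        simp only [h'.xo_ox, h.mkQ_opRel_right, mul_assoc, h.ox_t]
        simp only [← map_sum, ← TensorProduct.sum_tmul, ← Finset.op_sum, ← Finset.mul_sum,
          ← h.basic.ox_sum_right, P.snakeL_field, h.xo_ox]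
        rfl

theorem gamma_iil_xo_ox (h : g.SatIL C P) (h' : g.SatIIL P) (x : 𝔛) (ω : Ω) :
    h.opRel.mkQ (unop (∑ j, (g.gamma P).xo (P.yR j) ω * (g.gamma P).ox (P.ηR j) x)) =
      h.opRel.mkQ (unop ((g.gamma P).t (P.evL x ω))) := by
  calc _ = ∑ i, ∑ k, h.opRel.mkQ (op (∑ j, g.xo (P.yR j) (P.ηR k) * g.ox (P.ηR j) (P.xL i)) ⊗ₜ
        (g.xo x (P.ωL i) * g.ox ω (P.yR k))) := by
        simp only [gamma, Finset.unop_sum, MulOpposite.unop_mul, MulOpposite.unop_op,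
          Finset.sum_mul_sum, Algebra.TensorProduct.tmul_mul_tmul, map_sum, Finset.op_sum,
          TensorProduct.sum_tmul, ← MulOpposite.op_mul]
        exact sum_comm₃ _
    _ = _ := by
        rw [Finset.sum_comm]
        simp only [h'.xo_ox, h.mkQ_opRel_left, ← mul_assoc, h.t_xo]
        simp only [← map_sum, ← TensorProduct.tmul_sum, ← Finset.sum_mul, ← h.basic.xo_sum_right,
          P.snakeL_form, h.xo_ox]
        rfl

theorem gamma_iil_ox_xo (h : g.SatIL C P) (h' : g.SatIIL P) (ω : Ω) (x : 𝔛) :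
    h.opRel.mkQ (unop (∑ i, (g.gamma P).ox ω (P.xL i) * (g.gamma P).xo x (P.ωL i))) =
      h.opRel.mkQ (unop ((g.gamma P).s (P.evR ω x))) := by
  calc _ = ∑ k, ∑ j, h.opRel.mkQ (op (g.ox ω (P.xL k) * g.xo x (P.ηR j)) ⊗ₜ
        (∑ i, g.ox (P.ωL i) (P.yR j) * g.xo (P.xL i) (P.ωL k))) := by
        simp only [gamma, Finset.unop_sum, MulOpposite.unop_mul, MulOpposite.unop_op,
          Finset.sum_mul_sum, Algebra.TensorProduct.tmul_mul_tmul, map_sum,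
          TensorProduct.tmul_sum, ← MulOpposite.op_mul]
        exact sum_comm₃ _
    _ = _ := by
        simp only [h.ox_xo, h.mkQ_opRel_right, mul_assoc, h.xo_t]
        simp only [← map_sum, ← TensorProduct.sum_tmul, ← Finset.op_sum, ← Finset.mul_sum,
          ← h.basic.xo_sum_right, P.snakeR_form, h'.ox_xo]
        rfl

theorem gamma_rel (h : g.SatIL C P) (h' : g.SatIIL P) {X Y : (Lᵐᵒᵖ ⊗[ℂ] L)ᵐᵒᵖ}
    (r : ILRel C P (g.gamma P) X Y) : h.opRel.mkQ (unop X) = h.opRel.mkQ (unop Y) := by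
  cases r with
  | basic r => rw [h.gamma_basic r]
  | v_s a x =>
    simp only [gamma, MulOpposite.unop_mul, MulOpposite.unop_op, MulOpposite.unop_add, mul_sub,
      Finset.mul_sum, Algebra.TensorProduct.tmul_mul_tmul, ← MulOpposite.op_mul, h.v_s, h.xo_s,
      mul_one, one_mul, MulOpposite.op_add, TensorProduct.add_tmul]
    congr 1
    abel
  | v_t a x =>
    simp only [gamma, MulOpposite.unop_mul, MulOpposite.unop_op, MulOpposite.unop_add, mul_sub,
      sub_mul, Finset.mul_sum, Finset.sum_mul, Algebra.TensorProduct.tmul_mul_tmul, h.psiV_s,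
      mul_one, one_mul, TensorProduct.tmul_add, Finset.sum_add_distrib]
    congr 1
    abel
  | ox_xo ω y => exact h.gamma_ox_xo h' ω y
  | xo_ox x ω => exact h.gamma_xo_ox h' x ω
  | s_v a x =>
    simp only [gamma, MulOpposite.unop_mul, MulOpposite.unop_op, sub_mul,
      Finset.sum_mul, Algebra.TensorProduct.tmul_mul_tmul, ← MulOpposite.op_mul, h.s_v, h.s_xo,
      mul_one]
  | _ => simp only [gamma, MulOpposite.unop_mul, MulOpposite.unop_op, Finset.sum_mul,
      Finset.mul_sum, Algebra.TensorProduct.tmul_mul_tmul, ← MulOpposite.op_mul,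
      mul_one, one_mul, h.s_xo, h.xo_s, h.t_xo, h.xo_t, h.s_ox, h.ox_s, h.t_ox, h.ox_t]

theorem gamma_rel' (h : g.SatIL C P) (h' : g.SatIIL P) {X Y : (Lᵐᵒᵖ ⊗[ℂ] L)ᵐᵒᵖ}
    (r : IILRel P (g.gamma P) X Y) : h.opRel.mkQ (unop X) = h.opRel.mkQ (unop Y) := by
  cases r with
  | xo_ox x ω => exact h.gamma_iil_xo_ox h' x ω
  | ox_xo ω x => exact h.gamma_iil_ox_xo h' ω x

theorem satIL_gammaAct (h : g.SatIL C P) (h' : g.SatIIL P) :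
    (h.gammaIdealizer.map (AlgHom.op h.opRel.idealizerAct)).SatIL C P :=
  (isRightIdeal_opRel _).satIL_act_op fun _ _ r => h.gamma_rel h' r

theorem satIIL_gammaAct (h : g.SatIL C P) (h' : g.SatIIL P) :
    (h.gammaIdealizer.map (AlgHom.op h.opRel.idealizerAct)).SatIIL P :=
  (isRightIdeal_opRel _).satIIL_act_op fun _ _ r => h.gamma_rel' h' r

end SatIL

end Gens

end Translation

/-! ### The left Hopf condition -/

section RightMul

variable {B : Type*} [Ring B] [Algebra ℂ B] {I : Submodule ℂ B}

/-- Right multiplication on the quotient by a right ideal. -/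
def Submodule.IsRightIdeal.rmul (hI : I.IsRightIdeal) : B →ₗ[ℂ] Module.End ℂ (B ⧸ I) where
  toFun b := I.mapQ I (LinearMap.mulRight ℂ b) fun i hi => hI i hi b
  map_add' b c := by ext v; exact congrArg I.mkQ (mul_add v b c)
  map_smul' c b := by ext v; exact congrArg I.mkQ (mul_smul_comm c v b)

@[simp] theorem Submodule.IsRightIdeal.rmul_mkQ (hI : I.IsRightIdeal) (b v : B) :
    hI.rmul b (I.mkQ v) = I.mkQ (v * b) := rfl

theorem Submodule.IsRightIdeal.act_rmul (hI : I.IsRightIdeal) {f : Module.End ℂ (B ⧸ I)}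
    (hf : f ∈ I.idealizerAct.range) (b : B) (v : B ⧸ I) : f (hI.rmul b v) = hI.rmul b (f v) := by
  obtain ⟨c, rfl⟩ := hf
  obtain ⟨v, rfl⟩ := I.mkQ_surjective v
  exact congrArg I.mkQ (mul_assoc (c : B) v b).symm

end RightMul

namespace LeftBialgebroid

variable {A L : Type*} [Ring A] [Algebra ℂ A] [Ring L] [Algebra ℂ L] (H : LeftBialgebroid A L)

/-- The relations of `L ⊗_A L`. -/
abbrev rel : Submodule ℂ (L ⊗[ℂ] L) := balSub (leftActR H.t) (leftActL H.s)

theorem isRightIdeal_rel : H.rel.IsRightIdeal := isRightIdeal_left H.s H.t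

theorem exists_rep (X : L) : ∃ u, H.proj u = H.comul X := Submodule.mkQ_surjective _ _

theorem comul_t (a : A) : H.comul (H.t (op a)) = H.proj (1 ⊗ₜ H.t (op a)) := by
  simpa using H.comul_bimod 1 a 1 1 H.comul_one.symm

variable {H} in
theorem mem_idealizer {X : L} {u : L ⊗[ℂ] L} (hu : H.proj u = H.comul X) :
    u ∈ H.rel.idealizer :=
  mem_idealizer_left.2 fun a => H.takeuchi a X u hu

/-- The map `X ⊗ Y ↦ X₁ ⊗ X₂ Y` on `L ⊗ L`. -/
def galois : L ⊗[ℂ] L →ₗ[ℂ] H.Tens :=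
  TensorProduct.lift ((H.isRightIdeal_rel.rmul ∘ₗ TensorProduct.mk ℂ L L 1).flip ∘ₗ H.comul)

variable {H}

theorem galois_tmul {X : L} {u : L ⊗[ℂ] L} (hu : H.proj u = H.comul X) (Y : L) :
    H.galois (X ⊗ₜ Y) = H.proj (u * (1 ⊗ₜ Y)) := by
  change H.isRightIdeal_rel.rmul (1 ⊗ₜ Y) (H.comul X) = _
  rw [← hu, Submodule.IsRightIdeal.rmul_mkQ]

theorem galois_mul_one_tmul (z : L ⊗[ℂ] L) (Y : L) :
    H.galois (z * (1 ⊗ₜ Y)) = H.isRightIdeal_rel.rmul (1 ⊗ₜ Y) (H.galois z) := by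
  induction z using TensorProduct.induction_on with
  | zero => simp
  | add x y hx hy => simp only [add_mul, map_add, hx, hy]
  | tmul p q =>
    obtain ⟨u, hu⟩ := H.exists_rep p
    rw [Algebra.TensorProduct.tmul_mul_tmul, mul_one, galois_tmul hu, galois_tmul hu,
      Submodule.IsRightIdeal.rmul_mkQ, mul_assoc, Algebra.TensorProduct.tmul_mul_tmul, mul_one]

theorem galois_tmul_one_mul {X : L} {u : L ⊗[ℂ] L} (hu : H.proj u = H.comul X) (z : L ⊗[ℂ] L) :
    H.galois ((X ⊗ₜ 1) * z) = H.rel.idealizerAct ⟨u, mem_idealizer hu⟩ (H.galois z) := by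
  induction z using TensorProduct.induction_on with
  | zero => simp
  | add x y hx hy => simp only [mul_add, map_add, hx, hy]
  | tmul p q =>
    obtain ⟨v, hv⟩ := H.exists_rep p
    rw [Algebra.TensorProduct.tmul_mul_tmul, one_mul, galois_tmul hv,
      galois_tmul (H.comul_mul X p u v hu hv).symm, Submodule.idealizerAct_mkQ, mul_assoc]

/-- If w is sent to Y ⊗ 1, then (p ⊗ 1) w (1 ⊗ q) is sent to Δ(p)(Y ⊗ q), which is the image of p ⊗
q multiplied by Y ⊗ 1. Consequently the elements X for which X ⊗ 1 is hit are closed under products.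
-/
theorem rmul_galois_mem {Y : L} (hY : H.proj (Y ⊗ₜ 1) ∈ LinearMap.range H.galois)
    (z : L ⊗[ℂ] L) : H.isRightIdeal_rel.rmul (Y ⊗ₜ 1) (H.galois z) ∈ LinearMap.range H.galois := by
  induction z using TensorProduct.induction_on with
  | zero => simp
  | add x y hx hy => rw [map_add, map_add]; exact Submodule.add_mem _ hx hy
  | tmul p q =>
    obtain ⟨u, hu⟩ := H.exists_rep p
    obtain ⟨w, hw⟩ := hY
    refine ⟨(p ⊗ₜ 1) * w * (1 ⊗ₜ q), ?_⟩
    rw [galois_mul_one_tmul, galois_tmul_one_mul hu, hw, galois_tmul hu,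
      Submodule.idealizerAct_mkQ, Submodule.IsRightIdeal.rmul_mkQ,
      Submodule.IsRightIdeal.rmul_mkQ, mul_assoc, mul_assoc,
      Algebra.TensorProduct.tmul_mul_tmul, Algebra.TensorProduct.tmul_mul_tmul]
    simp

theorem tmul_one_mul_mem_range_galois {X Y : L}
    (hX : H.proj (X ⊗ₜ 1) ∈ LinearMap.range H.galois)
    (hY : H.proj (Y ⊗ₜ 1) ∈ LinearMap.range H.galois) :
    H.proj ((X * Y) ⊗ₜ 1) ∈ LinearMap.range H.galois := by
  obtain ⟨z, hz⟩ := hX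
  have := rmul_galois_mem hY z
  rw [hz, Submodule.IsRightIdeal.rmul_mkQ, Algebra.TensorProduct.tmul_mul_tmul, mul_one] at this
  exact this

/-- The range is stable under right multiplication by 1 ⊗ q, so the elements p ⊗ 1 generate
everything. -/
theorem galois_surjective (h : ∀ X, H.proj (X ⊗ₜ 1) ∈ LinearMap.range H.galois) :
    Function.Surjective H.galois := by
  rw [← LinearMap.range_eq_top, eq_top_iff]
  rintro v -
  obtain ⟨v, rfl⟩ := H.rel.mkQ_surjective v
  induction v using TensorProduct.induction_on with
  | zero => simp
  | add x y hx hy => rw [map_add]; exact Submodule.add_mem _ hx hy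
  | tmul p q =>
    obtain ⟨z, hz⟩ := h p
    refine ⟨z * (1 ⊗ₜ q), ?_⟩
    rw [galois_mul_one_tmul, hz, Submodule.IsRightIdeal.rmul_mkQ,
      Algebra.TensorProduct.tmul_mul_tmul, mul_one, one_mul]

variable (H) in
theorem opSub_le_ker_galois : H.opSub ≤ LinearMap.ker H.galois := by
  refine Submodule.span_le.2 ?_
  rintro _ ⟨a, m, n, rfl⟩
  obtain ⟨u, hu⟩ := H.exists_rep m
  have h1 := (H.comul_mul m _ u _ hu (H.comul_t a).symm).symm
  simp only [SetLike.mem_coe, LinearMap.mem_ker, map_sub, LinearMap.mulRight_apply,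
    LinearMap.mulLeft_apply]
  rw [galois_tmul h1, galois_tmul hu, mul_assoc, Algebra.TensorProduct.tmul_mul_tmul, mul_one,
    sub_self]

/-! #### Translation maps -/

section Translation

variable {t : Aᵐᵒᵖ →ₐ[ℂ] L} (ht : H.t = t)
  (ρ : L →ₐ[ℂ] (Module.End ℂ ((Lᵐᵒᵖ ⊗[ℂ] L) ⧸ opRel t))ᵐᵒᵖ)

/-- The map `X ⊗ Y ↦ τ(X) Y` for a translation map `τ` given as an action. -/
def transl : L ⊗[ℂ] L →ₗ[ℂ] (Lᵐᵒᵖ ⊗[ℂ] L) ⧸ opRel t :=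
  TensorProduct.lift ((LinearMap.lcomp ℂ _ ((opRel t).mkQ ∘ₗ TensorProduct.mk ℂ Lᵐᵒᵖ L 1)) ∘ₗ
    (MulOpposite.opLinearEquiv ℂ).symm.toLinearMap ∘ₗ ρ.toLinearMap)

theorem transl_tmul (X Y : L) :
    transl ρ (X ⊗ₜ Y) = (ρ X).unop ((opRel t).mkQ (1 ⊗ₜ Y)) := rfl

variable {ρ} (hρ : ∀ X, (ρ X).unop ∈ (opRel t).idealizerAct.range)
include hρ

theorem transl_mul_one_tmul (u : L ⊗[ℂ] L) (Y : L) :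
    transl ρ (u * (1 ⊗ₜ Y)) = (isRightIdeal_opRel t).rmul (1 ⊗ₜ Y) (transl ρ u) := by
  induction u using TensorProduct.induction_on with
  | zero => simp
  | add x y hx hy => simp only [add_mul, map_add, hx, hy]
  | tmul p q =>
    rw [Algebra.TensorProduct.tmul_mul_tmul, mul_one, transl_tmul, transl_tmul,
      ← (isRightIdeal_opRel t).act_rmul (hρ p), Submodule.IsRightIdeal.rmul_mkQ,
      Algebra.TensorProduct.tmul_mul_tmul, mul_one]

/-- Anti-multiplicativity of τ gives τ(X₁Y₁) X₂Y₂ = τ(Y₁)(τ(X₁)X₂)Y₂. The inner factor is X ⊗ 1, and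
the operators for τ commute with right multiplications, so X can be pulled out. Thus the identity
τ(X₁)X₂ = X ⊗ 1 is stable under products. -/
theorem transl_mul (u v : L ⊗[ℂ] L) {X : L} (hu : transl ρ u = (opRel t).mkQ (op X ⊗ₜ 1)) :
    transl ρ (u * v) = (isRightIdeal_opRel t).rmul (op X ⊗ₜ 1) (transl ρ v) := by
  have key : ∀ (p q : L) (w : L ⊗[ℂ] L), transl ρ (w * (p ⊗ₜ q)) =
      (ρ p).unop ((isRightIdeal_opRel t).rmul (1 ⊗ₜ q) (transl ρ w)) := fun p q w => by
    induction w using TensorProduct.induction_on with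
    | zero => simp
    | add x y hx hy => simp only [add_mul, map_add, hx, hy]
    | tmul x y =>
      rw [Algebra.TensorProduct.tmul_mul_tmul, transl_tmul, transl_tmul, map_mul,
        MulOpposite.unop_mul, Module.End.mul_apply, ← (isRightIdeal_opRel t).act_rmul (hρ x),
        Submodule.IsRightIdeal.rmul_mkQ, Algebra.TensorProduct.tmul_mul_tmul, mul_one]
  induction v using TensorProduct.induction_on with
  | zero => simp
  | add x y hx hy => simp only [mul_add, map_add, hx, hy]
  | tmul p q =>
    rw [key, hu, transl_tmul, ← (isRightIdeal_opRel t).act_rmul (hρ p),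
      Submodule.IsRightIdeal.rmul_mkQ, Submodule.IsRightIdeal.rmul_mkQ]
    simp

/-- The translation map inverts the canonical map at `X`. -/
theorem transl_comul_mul {X Y : L}
    (hX : ∀ u, H.proj u = H.comul X → transl ρ u = (opRel t).mkQ (op X ⊗ₜ 1))
    (hY : ∀ u, H.proj u = H.comul Y → transl ρ u = (opRel t).mkQ (op Y ⊗ₜ 1)) :
    ∃ u, H.proj u = H.comul (X * Y) ∧ transl ρ u = (opRel t).mkQ (op (X * Y) ⊗ₜ 1) := by
  obtain ⟨u, hu⟩ := H.exists_rep X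
  obtain ⟨v, hv⟩ := H.exists_rep Y
  refine ⟨u * v, (H.comul_mul X Y u v hu hv).symm, ?_⟩
  rw [transl_mul hρ u v (hX u hu), hY v hv, Submodule.IsRightIdeal.rmul_mkQ,
    Algebra.TensorProduct.tmul_mul_tmul, mul_one, MulOpposite.op_mul]

variable (hρt : ∀ a, (ρ (t (op a))).unop ((opRel t).mkQ 1) = (opRel t).mkQ (1 ⊗ₜ H.s a))
include ht hρt

/-- The requirement that τ(t(a)) act as 1 ⊗ s(a) is what makes X ⊗ Y ↦ τ(X)Y factor through L ⊗_A L.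
-/
theorem transl_eq {u v : L ⊗[ℂ] L} (h : H.proj u = H.proj v) : transl ρ u = transl ρ v := by
  have : H.rel ≤ LinearMap.ker (transl ρ) := by
    refine Submodule.span_le.2 ?_
    rintro _ ⟨a, m, n, rfl⟩
    rw [SetLike.mem_coe, LinearMap.mem_ker, map_sub, transl_tmul, transl_tmul, leftActR, leftActL,
      LinearMap.mulLeft_apply, LinearMap.mulLeft_apply, ht, map_mul, MulOpposite.unop_mul,
      Module.End.mul_apply, (isRightIdeal_opRel t).act_mkQ (hρ _) (hρt a).symm,
      Algebra.TensorProduct.tmul_mul_tmul, mul_one, sub_self]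
  exact sub_eq_zero.1 (by rw [← map_sub]; exact this ((Submodule.Quotient.eq _).1 h))

/-- The translation map is used only as a left inverse of the canonical map, after identifying the
quotient of L^op ⊗ L with that of L ⊗ L. Surjectivity enters separately, so the other composite need
not be computed. -/
theorem isLeftHopf (hinj : ∀ X, ∃ u, H.proj u = H.comul X ∧
      transl ρ u = (opRel t).mkQ (op X ⊗ₜ 1))
    (hsurj : ∀ X, H.proj (X ⊗ₜ 1) ∈ LinearMap.range H.galois) : H.IsLeftHopf := by
  refine ⟨H.opSub.liftQ H.galois H.opSub_le_ker_galois, fun X Y u hu => galois_tmul hu Y, ?_, ?_⟩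
  · let α : H.Tens →ₗ[ℂ] (Lᵐᵒᵖ ⊗[ℂ] L) ⧸ opRel t := H.rel.liftQ (transl ρ) fun u hu => by
      rw [LinearMap.mem_ker, ← map_zero (transl ρ)]
      exact transl_eq ht hρ hρt (by rwa [map_zero, ← LinearMap.mem_ker, Submodule.ker_mkQ])
    let β : ((Lᵐᵒᵖ ⊗[ℂ] L) ⧸ opRel t) →ₗ[ℂ] (L ⊗[ℂ] L) ⧸ H.opSub :=
      (opRel t).liftQ (H.opSub.mkQ ∘ₗ
        TensorProduct.map (MulOpposite.opLinearEquiv ℂ).symm.toLinearMap LinearMap.id) (by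
          refine Submodule.span_le.2 ?_
          rintro _ ⟨a, m, n, rfl⟩
          rw [SetLike.mem_coe, LinearMap.mem_ker, map_sub, sub_eq_zero]
          have := balSub_mkQ (fun a : A => LinearMap.mulRight ℂ (H.t (op a)))
            (fun a : A => LinearMap.mulLeft ℂ (H.t (op a))) a m.unop n
          subst ht
          exact this)
    refine Function.LeftInverse.injective (g := fun v => β (α v)) fun z => ?_
    obtain ⟨z, rfl⟩ := H.opSub.mkQ_surjective z
    induction z using TensorProduct.induction_on with
    | zero => simp
    | add x y hx hy => simp only [map_add, hx, hy]
    | tmul p q =>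
      obtain ⟨u, hu, hu'⟩ := hinj p
      change β (α (H.galois (p ⊗ₜ q))) = _
      rw [galois_tmul hu]
      change β (transl ρ (u * (1 ⊗ₜ q))) = _
      rw [transl_mul_one_tmul hρ, hu', Submodule.IsRightIdeal.rmul_mkQ,
        Algebra.TensorProduct.tmul_mul_tmul, mul_one, one_mul]
      rfl
  · intro v
    obtain ⟨z, rfl⟩ := galois_surjective hsurj v
    exact ⟨H.opSub.mkQ z, rfl⟩

end Translation

end LeftBialgebroid

section LeftHopf

variable {A Ω 𝔛 : Type*} [Ring A] [Algebra ℂ A] [StarRing A]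
  [AddCommGroup Ω] [Module ℂ Ω] [Module A Ω] [Module Aᵐᵒᵖ Ω] [StarAddMonoid Ω]
  [AddCommGroup 𝔛] [Module ℂ 𝔛] [Module A 𝔛] [Module Aᵐᵒᵖ 𝔛]
  {C : StarFODC A Ω} {P : PivotalDual A Ω 𝔛} {L : Type*} [Ring L] [Algebra ℂ L]
  {g : Gens A Ω 𝔛 L} {H : LeftBialgebroid A L}

namespace IsGhobadiLeft

theorem proj_tmul_s (hH : IsGhobadiLeft P g H) (m : L) (a : A) :
    H.proj (m ⊗ₜ g.s a) = H.proj ((g.t a * m) ⊗ₜ 1) := by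
  have := mkQ_left H.s H.t a m 1
  rw [hH.s_eq, hH.t_eq, mul_one] at this
  exact this.symm

/-- Preimages of X ⊗ 1 for generators are the values of the translation map, written in L ⊗ L;
products are handled by stability of the range. -/
theorem proj_mem_range_galois (hH : IsGhobadiLeft P g H) (h : g.SatIL C P) (h' : g.SatIIL P)
    (hg : g.Generates) (X : L) : H.proj (X ⊗ₜ 1) ∈ LinearMap.range H.galois := by
  have gxo : ∀ x ω (Y : L), H.galois (g.xo x ω ⊗ₜ Y) =
      ∑ i, H.proj (g.xo x (P.ωL i) ⊗ₜ (g.xo (P.xL i) ω * Y)) := fun x ω Y => by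
    rw [LeftBialgebroid.galois_tmul (hH.comul_xo x ω).symm]
    simp [Finset.sum_mul]
  induction X using hg.induction h.basic with
  | s a =>
    exact ⟨g.s a ⊗ₜ 1, by rw [LeftBialgebroid.galois_tmul (hH.comul_s a).symm]; simp⟩
  | t a =>
    refine ⟨1 ⊗ₜ g.s a, ?_⟩
    rw [LeftBialgebroid.galois_tmul H.comul_one.symm, one_mul, hH.proj_tmul_s, mul_one]
  | xo x ω =>
    refine ⟨∑ j, g.xo x (P.ηR j) ⊗ₜ g.ox ω (P.yR j), ?_⟩
    simp only [map_sum, gxo]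
    rw [Finset.sum_comm]
    simp only [← map_sum, ← TensorProduct.tmul_sum, h.xo_ox]
    simp only [map_sum, hH.proj_tmul_s, h.t_xo]
    rw [← map_sum, ← TensorProduct.sum_tmul, ← h.basic.xo_sum_right, P.snakeL_form]
  | ox ω y =>
    refine ⟨∑ i, g.ox ω (P.xL i) ⊗ₜ g.xo y (P.ωL i), ?_⟩
    have gox : ∀ ω y (Y : L), H.galois (g.ox ω y ⊗ₜ Y) =
        ∑ j, H.proj (g.ox ω (P.yR j) ⊗ₜ (g.ox (P.ηR j) y * Y)) := fun ω y Y => by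
      rw [LeftBialgebroid.galois_tmul (hH.comul_ox ω y).symm]
      simp [Finset.sum_mul]
    simp only [map_sum, gox]
    rw [Finset.sum_comm]
    simp only [← map_sum, ← TensorProduct.tmul_sum, h'.ox_xo]
    simp only [map_sum, hH.proj_tmul_s, h.t_ox]
    rw [← map_sum, ← TensorProduct.sum_tmul, ← h.basic.ox_sum_right, P.snakeR_field]
  | v x =>
    -- The canonical map sends x ⊗ 1 to x ⊗ 1 + ∑ (x, ω_i) ⊗ x_i. The correction term cancels the
    -- sum because contracting (x_i, η_j) with Φ⁻¹(y_j) recovers x_i.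
    refine ⟨g.v x ⊗ₜ 1 - ∑ j, g.xo x (P.ηR j) ⊗ₜ g.psiV P (P.yR j), ?_⟩
    rw [map_sub, LeftBialgebroid.galois_tmul (hH.comul_v x).symm, map_sum]
    simp only [gxo]
    rw [Finset.sum_comm]
    have key : ∀ x, ∑ j, g.xo x (P.ηR j) * g.psiV P (P.yR j) = g.v x := h.sum_phi_psi
    simp only [← map_sum, ← TensorProduct.tmul_sum, key]
    rw [← Algebra.TensorProduct.one_def, mul_one, map_add, map_sum, add_sub_cancel_right]
  | add X Y hX hY =>
    rw [TensorProduct.add_tmul, map_add]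
    exact Submodule.add_mem _ hX hY
  | mul X Y hX hY => exact LeftBialgebroid.tmul_one_mul_mem_range_galois hX hY

theorem isLeftHopf (hH : IsGhobadiLeft P g H) (h : g.SatIL C P) (h' : g.SatIIL P)
    (hg : g.Generates) (ρ : L →ₐ[ℂ] (Module.End ℂ ((Lᵐᵒᵖ ⊗[ℂ] L) ⧸ h.opRel))ᵐᵒᵖ)
    (hρ : g.map ρ = h.gammaIdealizer.map (AlgHom.op h.opRel.idealizerAct)) : H.IsLeftHopf := by
  have rs : ∀ a w, (ρ (g.s a)).unop (h.opRel.mkQ w) = h.opRel.mkQ ((op (g.s a) ⊗ₜ 1) * w) :=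
    fun a w => by rw [show ρ (g.s a) = _ from congrFun (congrArg Gens.s hρ) a]; rfl
  have rt : ∀ a w, (ρ (g.t a)).unop (h.opRel.mkQ w) = h.opRel.mkQ ((1 ⊗ₜ g.s a) * w) :=
    fun a w => by rw [show ρ (g.t a) = _ from congrFun (congrArg Gens.t hρ) a]; rfl
  have rv : ∀ x w, (ρ (g.v x)).unop (h.opRel.mkQ w) = h.opRel.mkQ
      ((op (g.v x) ⊗ₜ 1 - ∑ j, op (g.xo x (P.ηR j)) ⊗ₜ g.psiV P (P.yR j)) * w) :=
    fun x w => by rw [show ρ (g.v x) = _ from congrFun (congrArg Gens.v hρ) x]; rfl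
  have rxo : ∀ x ω w, (ρ (g.xo x ω)).unop (h.opRel.mkQ w) = h.opRel.mkQ
      ((∑ j, op (g.xo x (P.ηR j)) ⊗ₜ g.ox ω (P.yR j)) * w) :=
    fun x ω w => by
      rw [show ρ (g.xo x ω) = _ from congrFun (congrFun (congrArg Gens.xo hρ) x) ω]; rfl
  have rox : ∀ ω y w, (ρ (g.ox ω y)).unop (h.opRel.mkQ w) = h.opRel.mkQ
      ((∑ i, op (g.ox ω (P.xL i)) ⊗ₜ g.xo y (P.ωL i)) * w) :=
    fun ω y w => by
      rw [show ρ (g.ox ω y) = _ from congrFun (congrFun (congrArg Gens.ox hρ) ω) y]; rfl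
  have mem : ∀ X, (ρ X).unop ∈ h.opRel.idealizerAct.range := by
    refine hg.induction h.basic ?_ ?_ ?_ ?_ ?_ ?_ ?_
    · exact fun a => by rw [show ρ (g.s a) = _ from congrFun (congrArg Gens.s hρ) a]; exact ⟨_, rfl⟩
    · exact fun a => by rw [show ρ (g.t a) = _ from congrFun (congrArg Gens.t hρ) a]; exact ⟨_, rfl⟩
    · exact fun a => by rw [show ρ (g.v a) = _ from congrFun (congrArg Gens.v hρ) a]; exact ⟨_, rfl⟩
    · exact fun a b => by
        rw [show ρ (g.xo a b) = _ from congrFun (congrFun (congrArg Gens.xo hρ) a) b]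
        exact ⟨_, rfl⟩
    · exact fun a b => by
        rw [show ρ (g.ox a b) = _ from congrFun (congrFun (congrArg Gens.ox hρ) a) b]
        exact ⟨_, rfl⟩
    · intro X Y hX hY
      rw [map_add, MulOpposite.unop_add]
      exact add_mem hX hY
    · intro X Y hX hY
      rw [map_mul, MulOpposite.unop_mul]
      exact mul_mem hY hX
  have ht : H.t = h.basic.tHom := AlgHom.ext fun a => hH.t_eq a.unop
  have ht' : ∀ a, (ρ (h.basic.tHom (op a))).unop (h.opRel.mkQ 1) = h.opRel.mkQ (1 ⊗ₜ H.s a) :=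
    fun a => by rw [hH.s_eq]; exact (rt a 1).trans (by rw [mul_one])
  refine LeftBialgebroid.isLeftHopf ht mem ht' (fun X => ?_)
    (hH.proj_mem_range_galois h h' hg)
  induction X using hg.induction h.basic with
  | s a =>
    refine ⟨_, (hH.comul_s a).symm, ?_⟩
    rw [LeftBialgebroid.transl_tmul, rs]
    simp
  | t a =>
    refine ⟨_, (hH.comul_t a).symm, ?_⟩
    rw [LeftBialgebroid.transl_tmul, map_one, h.mkQ_opRel_left, mul_one]
    rfl
  | v x =>
    refine ⟨_, (hH.comul_v x).symm, ?_⟩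
    simp only [map_add, map_sum, LeftBialgebroid.transl_tmul, rv, rxo, Finset.sum_mul, sub_mul,
      Algebra.TensorProduct.tmul_mul_tmul, mul_one, one_mul, map_sub]
    -- After exchanging the sums, the inner sum over i is the definition of `psiV` at y_j, so the
    -- correction in τ(x) is cancelled.
    rw [Finset.sum_comm, sub_add_eq_add_sub, sub_eq_iff_eq_add]
    simp only [← map_sum, ← TensorProduct.tmul_sum]
    rfl
  | xo x ω =>
    refine ⟨_, (hH.comul_xo x ω).symm, ?_⟩
    simp only [map_add, map_sum, LeftBialgebroid.transl_tmul, rxo, Finset.sum_mul,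
      Algebra.TensorProduct.tmul_mul_tmul, mul_one]
    rw [Finset.sum_comm]
    simp only [← map_sum, ← TensorProduct.tmul_sum, h.ox_xo]
    simp only [map_sum, h.mkQ_opRel_right, h.xo_t]
    rw [← map_sum, ← TensorProduct.sum_tmul, ← Finset.op_sum, ← h.basic.xo_sum_right,
      P.snakeR_form]
  | ox ω y =>
    refine ⟨_, (hH.comul_ox ω y).symm, ?_⟩
    simp only [map_add, map_sum, LeftBialgebroid.transl_tmul, rox, Finset.sum_mul,
      Algebra.TensorProduct.tmul_mul_tmul, mul_one]
    rw [Finset.sum_comm]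
    simp only [← map_sum, ← TensorProduct.tmul_sum, h'.xo_ox]
    simp only [map_sum, h.mkQ_opRel_right, h.ox_t]
    rw [← map_sum, ← TensorProduct.sum_tmul, ← Finset.op_sum, ← h.basic.ox_sum_right,
      P.snakeL_field]
  | add X Y hX hY =>
    obtain ⟨u, hu, hu'⟩ := hX
    obtain ⟨v, hv, hv'⟩ := hY
    refine ⟨u + v, by rw [map_add, map_add, hu, hv], ?_⟩
    rw [map_add, hu', hv', MulOpposite.op_add, TensorProduct.add_tmul, map_add]
  | mul X Y hX hY =>
    obtain ⟨u, hu, hu'⟩ := hX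
    obtain ⟨v, hv, hv'⟩ := hY
    exact LeftBialgebroid.transl_comul_mul mem
      (fun w hw => (LeftBialgebroid.transl_eq ht mem ht' (hw.trans hu.symm)).trans hu')
      (fun w hw => (LeftBialgebroid.transl_eq ht mem ht' (hw.trans hv.symm)).trans hv')

end IsGhobadiLeft

end LeftHopf

/-! ### Transport along anti-isomorphisms -/

section Transfer

variable {σ σ' : ℂ →+* ℂ} [RingHomInvPair σ σ'] [RingHomInvPair σ' σ]
  {M N : Type*} [AddCommGroup M] [Module ℂ M] [AddCommGroup N] [Module ℂ N]

/-- Transport of a bijective map between quotients. -/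
theorem exists_transfer (e : M ≃ₛₗ[σ] N) {S U : Submodule ℂ M} {S' U' : Submodule ℂ N}
    (hS : ∀ x, x ∈ S ↔ e x ∈ S') (hU : ∀ x, x ∈ U ↔ e x ∈ U') (f : (M ⧸ S) →ₗ[ℂ] M ⧸ U)
    (hf : Function.Bijective f) : ∃ f' : (N ⧸ S') →ₗ[ℂ] N ⧸ U',
      (∀ x y, f (S.mkQ x) = U.mkQ y → f' (S'.mkQ (e x)) = U'.mkQ (e y)) ∧
      Function.Bijective f' := by
  let a : (N ⧸ S') →ₛₗ[σ'] M ⧸ S := S'.mapQ S e.symm.toLinearMap fun x hx =>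
    (hS _).2 (by simpa using hx)
  let b : (M ⧸ U) →ₛₗ[σ] N ⧸ U' := U.mapQ U' e.toLinearMap fun x hx => (hU x).1 hx
  have ha : ∀ x, a (S'.mkQ x) = S.mkQ (e.symm x) := fun _ => rfl
  have hb : ∀ x, b (U.mkQ x) = U'.mkQ (e x) := fun _ => rfl
  -- The twists σ' and σ of the outer maps cancel, so conjugation by an antilinear equivalence still
  -- yields a linear map.
  refine ⟨(b.comp f).comp a, fun x y h => ?_, ?_⟩
  · change b (f (a _)) = _
    rw [ha, e.symm_apply_apply, h, hb]
  · change Function.Bijective (b ∘ (f ∘ a))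
    refine .comp ⟨?_, ?_⟩ (hf.comp ⟨?_, ?_⟩)
    · rw [← LinearMap.ker_eq_bot, eq_bot_iff]
      intro x hx
      obtain ⟨x, rfl⟩ := U.mkQ_surjective x
      rw [LinearMap.mem_ker, hb, ← LinearMap.mem_ker, Submodule.ker_mkQ, ← hU] at hx
      exact (Submodule.Quotient.mk_eq_zero _).2 hx
    · intro y
      obtain ⟨y, rfl⟩ := U'.mkQ_surjective y
      exact ⟨U.mkQ (e.symm y), by rw [hb, e.apply_symm_apply]⟩
    · rw [← LinearMap.ker_eq_bot, eq_bot_iff]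
      intro x hx
      obtain ⟨x, rfl⟩ := S'.mkQ_surjective x
      rw [LinearMap.mem_ker, ha, ← LinearMap.mem_ker, Submodule.ker_mkQ, hS,
        e.apply_symm_apply] at hx
      exact (Submodule.Quotient.mk_eq_zero _).2 hx
    · intro y
      obtain ⟨y, rfl⟩ := S.mkQ_surjective y
      exact ⟨S'.mkQ (e y), by rw [ha, e.symm_apply_apply]⟩

theorem mem_balSub_map {M N : Type*} [AddCommGroup M] [Module ℂ M] [AddCommGroup N] [Module ℂ N]
    {A : Type*} {r l : A → M →ₗ[ℂ] M} {S : Submodule ℂ N} (e : M ⊗[ℂ] M →ₛₗ[σ] N)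
    (h : ∀ a m n, e (r a m ⊗ₜ n) - e (m ⊗ₜ l a n) ∈ S) {u : M ⊗[ℂ] M} (hu : u ∈ balSub r l) :
    e u ∈ S := by
  have : balSub r l ≤ S.comap e := by
    refine Submodule.span_le.2 ?_
    rintro _ ⟨a, m, n, rfl⟩
    rw [SetLike.mem_coe, Submodule.mem_comap, map_sub]
    exact h a m n
  exact this hu

end Transfer

namespace LeftBialgebroid

variable {A L R : Type*} [Ring A] [Algebra ℂ A] [Ring L] [Algebra ℂ L] [Ring R] [Algebra ℂ R]
  (H : LeftBialgebroid A L) (Φ : L ≃ₗ[ℂ] R) (h1 : Φ 1 = 1)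
  (hm : ∀ X Y, Φ (X * Y) = Φ Y * Φ X)

theorem sub_mem_balSub {A M N : Type*} [AddCommGroup M] [Module ℂ M] [AddCommGroup N] [Module ℂ N]
    {r : A → M →ₗ[ℂ] M} {l : A → N →ₗ[ℂ] N} (a : A) (m : M) (n : N) {m' : M} {n' : N}
    (hm : m' = r a m) (hn : n' = l a n) : m' ⊗ₜ[ℂ] n - m ⊗ₜ[ℂ] n' ∈ balSub r l :=
  hm ▸ hn ▸ Submodule.subset_span ⟨a, m, n, rfl⟩

include h1 hm

/-- The source map of the transported right bialgebroid. -/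
def rightS : A →ₐ[ℂ] R :=
  AlgHom.ofLinearMap (Φ.toLinearMap ∘ₗ H.t.toLinearMap ∘ₗ (MulOpposite.opLinearEquiv ℂ).toLinearMap)
    (by simp [h1]) (by simp [hm])

/-- The target map of the transported right bialgebroid. -/
def rightT : Aᵐᵒᵖ →ₐ[ℂ] R :=
  AlgHom.ofLinearMap
    (Φ.toLinearMap ∘ₗ H.s.toLinearMap ∘ₗ (MulOpposite.opLinearEquiv ℂ).symm.toLinearMap)
    (by simp [h1]) (by simp [hm])

theorem rightS_apply (a : A) : H.rightS Φ h1 hm a = Φ (H.t (op a)) := rfl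

theorem rightT_apply (a : A) : H.rightT Φ h1 hm (op a) = Φ (H.s a) := rfl

omit h1 hm in
/-- `Φ ⊗ Φ` -/
abbrev congr₂ : L ⊗[ℂ] L ≃ₗ[ℂ] R ⊗[ℂ] R := TensorProduct.congr Φ Φ

omit h1 in
theorem congr₂_mul (u v : L ⊗[ℂ] L) : congr₂ Φ (u * v) = congr₂ Φ v * congr₂ Φ u := by
  induction u using TensorProduct.induction_on with
  | zero => simp
  | add x y hx hy => simp only [add_mul, mul_add, map_add, hx, hy]
  | tmul x y =>
    induction v using TensorProduct.induction_on with
    | zero => simp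
    | add x y hx hy => simp only [add_mul, mul_add, map_add, hx, hy]
    | tmul x y => simp [hm]

/-- The relations of `R ⊗_A R`. -/
abbrev rightRel : Submodule ℂ (R ⊗[ℂ] R) :=
  balSub (rightActR (H.rightS Φ h1 hm)) (rightActL (H.rightT Φ h1 hm))

/-- Applying the anti-multiplicative Φ to t(a)m ⊗ n = m ⊗ s(a)n turns left into right
multiplications and exchanges source with target, which is the relation defining R ⊗_A R without a
flip. -/
theorem mem_rel_iff (u : L ⊗[ℂ] L) : u ∈ H.rel ↔ congr₂ Φ u ∈ H.rightRel Φ h1 hm := by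
  refine ⟨fun hu => mem_balSub_map (congr₂ Φ).toLinearMap (fun a m n => ?_) hu, fun hu => ?_⟩
  · exact sub_mem_balSub a (Φ m) (Φ n) (hm _ _) (hm _ _)
  · rw [← (congr₂ Φ).symm_apply_apply u]
    refine mem_balSub_map (congr₂ Φ).symm.toLinearMap (fun a m n => ?_) hu
    obtain ⟨m, rfl⟩ := Φ.surjective m
    obtain ⟨n, rfl⟩ := Φ.surjective n
    refine sub_mem_balSub a (Φ.symm (Φ m)) (Φ.symm (Φ n)) ?_ ?_ <;>
      exact Φ.injective (by simp [rightActR, rightActL, leftActR, leftActL, hm]; rfl)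

theorem rightRel_mkQ_iff (u v : L ⊗[ℂ] L) :
    (H.rightRel Φ h1 hm).mkQ (congr₂ Φ u) = (H.rightRel Φ h1 hm).mkQ (congr₂ Φ v) ↔
      H.proj u = H.proj v := by
  simp only [Submodule.mkQ_apply, Submodule.Quotient.eq]
  rw [← map_sub, ← mem_rel_iff]

/-- The coproduct of the transported right bialgebroid. -/
def rightComul : R →ₗ[ℂ] BalTensor (rightActR (H.rightS Φ h1 hm)) (rightActL (H.rightT Φ h1 hm)) :=
  (H.rel.mapQ (H.rightRel Φ h1 hm) (congr₂ Φ).toLinearMap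
    fun u hu => (H.mem_rel_iff Φ h1 hm u).1 hu) ∘ₗ H.comul ∘ₗ Φ.symm.toLinearMap

theorem rightComul_apply {X : L} {u : L ⊗[ℂ] L} (hu : H.proj u = H.comul X) :
    H.rightComul Φ h1 hm (Φ X) = (H.rightRel Φ h1 hm).mkQ (congr₂ Φ u) := by
  simp only [rightComul, LinearMap.comp_apply, LinearEquiv.coe_coe, Φ.symm_apply_apply, ← hu]
  rfl

/-- Representatives of coproducts correspond under Φ ⊗ Φ in both directions, so each right axiom,
stated for arbitrary representatives, pulls back to the corresponding left axiom. -/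
theorem rightComul_eq_iff (X : L) (u : L ⊗[ℂ] L) :
    (H.rightRel Φ h1 hm).mkQ (congr₂ Φ u) = H.rightComul Φ h1 hm (Φ X) ↔
      H.proj u = H.comul X := by
  obtain ⟨v, hv⟩ := H.exists_rep X
  rw [H.rightComul_apply Φ h1 hm hv, rightRel_mkQ_iff, hv]

theorem right_coassoc {X : L} {u : L ⊗[ℂ] L} (hu : H.proj u = H.comul X) :
    balAssocL _ _ (TensorProduct.map (H.rightComul Φ h1 hm) LinearMap.id (congr₂ Φ u)) =
      balAssocR _ _ (TensorProduct.map LinearMap.id (H.rightComul Φ h1 hm) (congr₂ Φ u)) := by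
  let e := TensorProduct.congr Φ (congr₂ Φ)
  have he : balSub3 (leftActR H.t) (leftActL H.s) ≤ (balSub3 (rightActR (H.rightS Φ h1 hm))
      (rightActL (H.rightT Φ h1 hm))).comap e.toLinearMap := by
    refine Submodule.span_le.2 ?_
    rintro w (⟨a, x, y, z, rfl⟩ | ⟨a, x, y, z, rfl⟩)
    · exact Submodule.subset_span (Or.inl ⟨a, Φ x, Φ y, Φ z, by
        simp [e, leftActR, leftActL, rightActR, rightActL, hm, rightS_apply, rightT_apply]⟩)
    · exact Submodule.subset_span (Or.inr ⟨a, Φ x, Φ y, Φ z, by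
        simp [e, leftActR, leftActL, rightActR, rightActL, hm, rightS_apply, rightT_apply]⟩)
  let T := Submodule.mapQ _ _ e.toLinearMap he
  have hL : ∀ w : L ⊗[ℂ] L,
      balAssocL _ _ (TensorProduct.map (H.rightComul Φ h1 hm) LinearMap.id (congr₂ Φ w)) =
        T (balAssocL _ _ (TensorProduct.map H.comul LinearMap.id w)) := fun w => by
    induction w using TensorProduct.induction_on with
    | zero => simp
    | add x y hx hy => simp only [map_add, hx, hy]
    | tmul p q =>
      obtain ⟨v, hv⟩ := H.exists_rep p
      simp only [TensorProduct.congr_tmul, TensorProduct.map_tmul, LinearMap.id_apply]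
      rw [H.rightComul_apply Φ h1 hm hv, ← hv, LeftActionData.balAssocL_mkQ,
        LeftActionData.balAssocL_mkQ]
      clear hv
      induction v using TensorProduct.induction_on with
      | zero => simp
      | add x y hx hy => simp only [map_add, TensorProduct.add_tmul, hx, hy]
      | tmul x y => rfl
  have hR : ∀ w : L ⊗[ℂ] L,
      balAssocR _ _ (TensorProduct.map LinearMap.id (H.rightComul Φ h1 hm) (congr₂ Φ w)) =
        T (balAssocR _ _ (TensorProduct.map LinearMap.id H.comul w)) := fun w => by
    induction w using TensorProduct.induction_on with
    | zero => simp
    | add x y hx hy => simp only [map_add, hx, hy]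
    | tmul p q =>
      obtain ⟨v, hv⟩ := H.exists_rep q
      simp only [TensorProduct.congr_tmul, TensorProduct.map_tmul, LinearMap.id_apply]
      rw [H.rightComul_apply Φ h1 hm hv, ← hv, LeftActionData.balAssocR_mkQ,
        LeftActionData.balAssocR_mkQ]
      rfl
  rw [hL, hR, H.coassoc X u hu]

/-- The right bialgebroid obtained from a left bialgebroid by transport along a linear
anti-isomorphism that exchanges source and target. -/
def toRight : RightBialgebroid A R where
  s := H.rightS Φ h1 hm
  t := H.rightT Φ h1 hm
  s_t_comm a b := by
    rw [← MulOpposite.op_unop b, rightS_apply, rightT_apply, ← hm, ← hm, H.s_t_comm]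
  comul := H.rightComul Φ h1 hm
  counit := H.counit ∘ₗ Φ.symm.toLinearMap
  comul_bimod a b X u hu := by
    obtain ⟨X, rfl⟩ := Φ.surjective X
    obtain ⟨u, rfl⟩ := (congr₂ Φ).surjective u
    rw [rightComul_eq_iff] at hu
    have h := H.rightComul_apply Φ h1 hm (H.comul_bimod a b X u hu).symm
    rw [congr₂_mul Φ hm, H.s_t_comm, hm, hm, ← mul_assoc] at h
    exact h
  counit_bimod a b X := by
    obtain ⟨X, rfl⟩ := Φ.surjective X
    rw [rightS_apply, rightT_apply, ← hm, ← hm, ← mul_assoc, ← H.s_t_comm]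
    simp [H.counit_bimod]
  coassoc X u hu := by
    obtain ⟨X, rfl⟩ := Φ.surjective X
    obtain ⟨u, rfl⟩ := (congr₂ Φ).surjective u
    rw [rightComul_eq_iff] at hu
    exact H.right_coassoc Φ h1 hm hu
  counit_left X u hu := by
    obtain ⟨X, rfl⟩ := Φ.surjective X
    obtain ⟨u, rfl⟩ := (congr₂ Φ).surjective u
    rw [rightComul_eq_iff] at hu
    rw [← H.counit_left X u hu]
    clear hu
    induction u using TensorProduct.induction_on with
    | zero => simp
    | add x y hx hy => simp only [map_add, hx, hy]
    | tmul x y => simp [rightT_apply, hm]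
  counit_right X u hu := by
    obtain ⟨X, rfl⟩ := Φ.surjective X
    obtain ⟨u, rfl⟩ := (congr₂ Φ).surjective u
    rw [rightComul_eq_iff] at hu
    rw [← H.counit_right X u hu]
    clear hu
    induction u using TensorProduct.induction_on with
    | zero => simp
    | add x y hx hy => simp only [map_add, hx, hy]
    | tmul x y => simp [rightS_apply, hm]
  takeuchi a X u hu := by
    obtain ⟨X, rfl⟩ := Φ.surjective X
    obtain ⟨u, rfl⟩ := (congr₂ Φ).surjective u
    rw [rightComul_eq_iff] at hu
    have h := (H.rightRel_mkQ_iff Φ h1 hm _ _).2 (H.takeuchi a X u hu)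
    rw [congr₂_mul Φ hm, congr₂_mul Φ hm, TensorProduct.congr_tmul, TensorProduct.congr_tmul,
      h1] at h
    exact h
  comul_one := by
    have h := H.rightComul_apply Φ h1 hm H.comul_one.symm
    rw [h1] at h
    rw [h]
    simp [Algebra.TensorProduct.one_def, h1]
  comul_mul X Y u v hu hv := by
    obtain ⟨X, rfl⟩ := Φ.surjective X
    obtain ⟨u, rfl⟩ := (congr₂ Φ).surjective u
    obtain ⟨Y, rfl⟩ := Φ.surjective Y
    obtain ⟨v, rfl⟩ := (congr₂ Φ).surjective v
    rw [rightComul_eq_iff] at hu hv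
    rw [← hm, ← congr₂_mul Φ hm]
    exact H.rightComul_apply Φ h1 hm (H.comul_mul Y X v u hv hu).symm
  counit_one := by
    have : Φ.symm 1 = 1 := Φ.symm_apply_eq.2 h1.symm
    simp [this, H.counit_one]
  counit_mul_s X Y := by
    obtain ⟨X, rfl⟩ := Φ.surjective X
    obtain ⟨Y, rfl⟩ := Φ.surjective Y
    rw [rightS_apply, ← hm, ← hm]
    simpa using H.counit_mul_t Y X
  counit_mul_t X Y := by
    obtain ⟨X, rfl⟩ := Φ.surjective X
    obtain ⟨Y, rfl⟩ := Φ.surjective Y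
    rw [rightT_apply, ← hm, ← hm]
    simpa using H.counit_mul_s Y X

theorem toRight_isReflexive : IsReflexive H (H.toRight Φ h1 hm) Φ where
  map_one := h1
  map_mul := hm
  map_s _ := rfl
  map_t _ := rfl
  map_comul _ _ hu := H.rightComul_apply Φ h1 hm hu
  map_counit X := congrArg H.counit (Φ.symm_apply_apply X)

/-- Conjugating X ⊗ Y ↦ X₁ ⊗ X₂Y by Φ ⊗ Φ gives X ⊗ Y ↦ X₁ ⊗ Y X₂: factors keep their places and
products are reversed. Left Hopf therefore becomes anti-right Hopf, and likewise anti-left becomes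
right. -/
theorem IsLeftHopf.toRight (hH : H.IsLeftHopf) : (H.toRight Φ h1 hm).IsAntiRightHopf := by
  obtain ⟨lam, hlam, hb⟩ := hH
  have hS : ∀ u, u ∈ H.opSub ↔ congr₂ Φ u ∈ (H.toRight Φ h1 hm).upSub := fun u => by
    refine ⟨fun hu => mem_balSub_map (congr₂ Φ).toLinearMap (fun a m n => ?_) hu, fun hu => ?_⟩
    · exact sub_mem_balSub a (Φ m) (Φ n) (hm _ _) (hm _ _)
    · rw [← (congr₂ Φ).symm_apply_apply u]
      refine mem_balSub_map (congr₂ Φ).symm.toLinearMap (fun a m n => ?_) hu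
      obtain ⟨m, rfl⟩ := Φ.surjective m
      obtain ⟨n, rfl⟩ := Φ.surjective n
      refine sub_mem_balSub a (Φ.symm (Φ m)) (Φ.symm (Φ n)) ?_ ?_ <;>
        exact Φ.injective (by simp [hm]; rfl)
  obtain ⟨mu, hmu, hb'⟩ := exists_transfer (congr₂ Φ) (S' := (H.toRight Φ h1 hm).upSub)
    (U' := H.rightRel Φ h1 hm) hS (H.mem_rel_iff Φ h1 hm) lam hb
  refine ⟨mu, fun X Y u hu => ?_, hb'⟩
  obtain ⟨X, rfl⟩ := Φ.surjective X
  obtain ⟨Y, rfl⟩ := Φ.surjective Y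
  obtain ⟨u, rfl⟩ := (congr₂ Φ).surjective u
  have := hmu (X ⊗ₜ Y) _ (hlam X Y u ((H.rightComul_eq_iff Φ h1 hm X u).1 hu))
  rw [congr₂_mul Φ hm, TensorProduct.congr_tmul, TensorProduct.congr_tmul, h1] at this
  exact this

theorem IsAntiLeftHopf.toRight (hH : H.IsAntiLeftHopf) : (H.toRight Φ h1 hm).IsRightHopf := by
  obtain ⟨lam, hlam, hb⟩ := hH
  have hS : ∀ u, u ∈ H.upSub ↔ congr₂ Φ u ∈ (H.toRight Φ h1 hm).opSub := fun u => by
    refine ⟨fun hu => mem_balSub_map (congr₂ Φ).toLinearMap (fun a m n => ?_) hu, fun hu => ?_⟩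
    · exact sub_mem_balSub a (Φ m) (Φ n) (hm _ _) (hm _ _)
    · rw [← (congr₂ Φ).symm_apply_apply u]
      refine mem_balSub_map (congr₂ Φ).symm.toLinearMap (fun a m n => ?_) hu
      obtain ⟨m, rfl⟩ := Φ.surjective m
      obtain ⟨n, rfl⟩ := Φ.surjective n
      refine sub_mem_balSub a (Φ.symm (Φ m)) (Φ.symm (Φ n)) ?_ ?_ <;>
        exact Φ.injective (by simp [hm]; rfl)
  obtain ⟨mu, hmu, hb'⟩ := exists_transfer (congr₂ Φ) (S' := (H.toRight Φ h1 hm).opSub)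
    (U' := H.rightRel Φ h1 hm) hS (H.mem_rel_iff Φ h1 hm) lam hb
  refine ⟨mu, fun X Y u hu => ?_, hb'⟩
  obtain ⟨X, rfl⟩ := Φ.surjective X
  obtain ⟨Y, rfl⟩ := Φ.surjective Y
  obtain ⟨u, rfl⟩ := (congr₂ Φ).surjective u
  have := hmu (X ⊗ₜ Y) _ (hlam X Y u ((H.rightComul_eq_iff Φ h1 hm Y u).1 hu))
  rw [congr₂_mul Φ hm, TensorProduct.congr_tmul, TensorProduct.congr_tmul, h1] at this
  exact this

end LeftBialgebroid

/-! ### The left and anti-left Hopf conditions in a *-related pair -/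

namespace LeftBialgebroid

variable {A L R : Type*} [Ring A] [Algebra ℂ A] [StarRing A] [StarModule ℂ A]
  [Ring L] [Algebra ℂ L] [Ring R] [Algebra ℂ R]
  {H : LeftBialgebroid A L} {Φ : L ≃ₗ[ℂ] R} {h1 : Φ 1 = 1}
  {hm : ∀ X Y, Φ (X * Y) = Φ Y * Φ X} {st : L ≃ₛₗ[starRingEnd ℂ] R}

/-- In a `*`-related pair the left Hopf condition implies the anti-left Hopf condition. -/
theorem IsLeftHopf.isAntiLeftHopf (hst : IsStarRelated H (H.toRight Φ h1 hm) st)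
    (hH : H.IsLeftHopf) : H.IsAntiLeftHopf := by
  obtain ⟨lam, hlam, hb⟩ := hH
  -- Two anti-multiplicative maps compose to an antilinear multiplicative automorphism; it exchanges
  -- source and target, up to * on A.
  let θ : L ≃ₛₗ[starRingEnd ℂ] L := st.trans Φ.symm
  have hθ : ∀ X, Φ (θ X) = st X := fun X => Φ.apply_symm_apply (st X)
  have θm : ∀ X Y, θ (X * Y) = θ X * θ Y := fun X Y => Φ.injective (by
    rw [hm, hθ, hθ, hθ, hst.map_mul])
  have θ1 : θ 1 = 1 := Φ.injective (by rw [hθ, hst.map_one, h1])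
  have θs : ∀ a, θ (H.s a) = H.t (op (star a)) := fun a => Φ.injective (by
    rw [hθ, hst.map_s]; rfl)
  have θt : ∀ a, θ (H.t (op a)) = H.s (star a) := fun a => Φ.injective (by
    rw [hθ, hst.map_t]; rfl)
  -- The flip is required because ⊛ reverses the coproduct while Φ preserves it. It also carries X₁
  -- ⊗ X₂Y to the form Y₁X ⊗ Y₂.
  let e : L ⊗[ℂ] L ≃ₛₗ[starRingEnd ℂ] L ⊗[ℂ] L :=
    (TensorProduct.congr θ θ).trans (TensorProduct.comm ℂ L L)
  have et : ∀ p q, e (p ⊗ₜ q) = θ q ⊗ₜ θ p := fun _ _ => rfl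
  have em : ∀ u v, e (u * v) = e u * e v := fun u v => by
    induction u using TensorProduct.induction_on with
    | zero => simp
    | add x y hx hy => simp only [add_mul, map_add, hx, hy]
    | tmul x y =>
      induction v using TensorProduct.induction_on with
      | zero => simp
      | add x y hx hy => simp only [mul_add, map_add, hx, hy]
      | tmul x y => simp [et, θm]
  have es : ∀ p q, e.symm (θ q ⊗ₜ θ p) = p ⊗ₜ q := fun p q => by
    rw [← et, e.symm_apply_apply]
  have hS : ∀ u, u ∈ H.opSub ↔ e u ∈ H.upSub := fun u => by
    refine ⟨fun hu => mem_balSub_map e.toLinearMap (fun a m n => ?_) hu, fun hu => ?_⟩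
    · rw [sub_mem_comm_iff]
      exact sub_mem_balSub (star a) (θ n) (θ m) (by simp [θm, θt]) (by simp [θm, θt])
    · rw [← e.symm_apply_apply u]
      refine mem_balSub_map e.symm.toLinearMap (fun a m n => ?_) hu
      obtain ⟨m, rfl⟩ := θ.surjective m
      obtain ⟨n, rfl⟩ := θ.surjective n
      have e1 : H.s a * θ m = θ (H.t (op (star a)) * m) := by rw [θm, θt, star_star]
      have e2 : θ n * H.s a = θ (n * H.t (op (star a))) := by rw [θm, θt, star_star]
      rw [sub_mem_comm_iff]
      simp only [LinearMap.mulLeft_apply, LinearMap.mulRight_apply, e1, e2, LinearEquiv.coe_coe,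
        es]
      exact sub_mem_balSub (star a) n m rfl rfl
  have hU : ∀ u, u ∈ H.rel ↔ e u ∈ H.rel := fun u => by
    refine ⟨fun hu => mem_balSub_map e.toLinearMap (fun a m n => ?_) hu, fun hu => ?_⟩
    · rw [sub_mem_comm_iff]
      exact sub_mem_balSub (star a) (θ n) (θ m) (by simp [θm, θs, leftActR, leftActL])
        (by simp [θm, θt, leftActR, leftActL])
    · rw [← e.symm_apply_apply u]
      refine mem_balSub_map e.symm.toLinearMap (fun a m n => ?_) hu
      obtain ⟨m, rfl⟩ := θ.surjective m
      obtain ⟨n, rfl⟩ := θ.surjective n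
      have e1 : H.s a * θ n = θ (H.t (op (star a)) * n) := by rw [θm, θt, star_star]
      have e2 : H.t (op a) * θ m = θ (H.s (star a) * m) := by rw [θm, θs, star_star]
      rw [sub_mem_comm_iff]
      simp only [leftActR, leftActL, LinearMap.mulLeft_apply, e1, e2, LinearEquiv.coe_coe, es]
      exact sub_mem_balSub (star a) n m rfl rfl
  have eΦ : ∀ u, congr₂ Φ (e u) = TensorProduct.comm ℂ R R
      (TensorProduct.map st.toLinearMap st.toLinearMap u) := fun u => by
    induction u using TensorProduct.induction_on with
    | zero => simp
    | add x y hx hy => simp only [map_add, hx, hy]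
    | tmul x y => simp [et, hθ]
  -- The map e intertwines Δ with θ, and it preserves the relations in both directions; hence
  -- representatives of Δ(θX) descend to representatives of Δ(X).
  have hΔ : ∀ X u, H.proj (e u) = H.comul (θ X) → H.proj u = H.comul X := fun X u hu => by
    obtain ⟨v, hv⟩ := H.exists_rep X
    have h := hst.map_comul X v hv
    rw [← eΦ, ← hθ] at h
    have h2 := (H.rightComul_eq_iff Φ h1 hm _ _).1 h.symm
    rw [← hv]
    refine (Submodule.Quotient.eq _).2 ((hU _).2 ?_)
    rw [map_sub]
    exact (Submodule.Quotient.eq _).1 (hu.trans h2.symm)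
  obtain ⟨mu, hmu, hb'⟩ := exists_transfer e hS hU lam hb
  refine ⟨mu, fun X Y u hu => ?_, hb'⟩
  obtain ⟨X, rfl⟩ := θ.surjective X
  obtain ⟨Y, rfl⟩ := θ.surjective Y
  obtain ⟨u, rfl⟩ := e.surjective u
  have := hmu (Y ⊗ₜ X) _ (hlam Y X u (hΔ _ _ hu))
  rwa [em, et, et, θ1] at this

end LeftBialgebroid

/-! ### The right bialgebroid on generators and the relation of ⊛ to coproducts and counits -/

section Ghobadi

variable {A Ω 𝔛 : Type*} [Ring A] [Algebra ℂ A] [StarRing A]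
  [AddCommGroup Ω] [Module ℂ Ω] [Module A Ω] [Module Aᵐᵒᵖ Ω] [StarAddMonoid Ω]
  [AddCommGroup 𝔛] [Module ℂ 𝔛] [Module A 𝔛] [Module Aᵐᵒᵖ 𝔛]
  {C : StarFODC A Ω} {P : PivotalDual A Ω 𝔛}
  {L R : Type*} [Ring L] [Algebra ℂ L] [Ring R] [Algebra ℂ R]
  {g : Gens A Ω 𝔛 L} {h : Gens A Ω 𝔛 R} {H : LeftBialgebroid A L}

/-- In Δ((ω_i, y))Δ(x_i), the summands with x_i ⊗ 1 give Φ⁻¹(y_j) ⊗ (η_j, y). In the others the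
first factors contract by an invertibility relation to target elements, which move across and leave
1 ⊗ Φ⁻¹(y). -/
theorem IsGhobadiLeft.comul_psiV (hH : IsGhobadiLeft P g H) (hL : g.SatIL C P) (y : 𝔛) :
    H.comul (g.psiV P y) = H.proj (1 ⊗ₜ[ℂ] g.psiV P y +
      ∑ j, g.psiV P (P.yR j) ⊗ₜ[ℂ] g.ox (P.ηR j) y) := by
  have hm : ∀ ω x, H.comul (g.ox ω y * g.v x) = H.proj
      ((∑ j, g.ox ω (P.yR j) ⊗ₜ[ℂ] g.ox (P.ηR j) y) *
        (g.v x ⊗ₜ[ℂ] 1 + ∑ i, g.xo x (P.ωL i) ⊗ₜ[ℂ] g.v (P.xL i))) := fun ω x =>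
    H.comul_mul _ _ _ _ (hH.comul_ox ω y).symm (hH.comul_v x).symm
  have key : ∑ i, ∑ j, ∑ k, H.proj ((g.ox (P.ωL i) (P.yR j) * g.xo (P.xL i) (P.ωL k)) ⊗ₜ
      (g.ox (P.ηR j) y * g.v (P.xL k))) = H.proj (1 ⊗ₜ g.psiV P y) := by
    rw [sum_comm₃]
    simp only [← map_sum, ← TensorProduct.sum_tmul, hL.ox_xo]
    have : ∀ a n, H.proj (g.t a ⊗ₜ n) = H.proj (1 ⊗ₜ (g.s a * n)) := fun a n => by
      have := mkQ_left H.s H.t a 1 n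
      rwa [hH.s_eq, hH.t_eq, mul_one] at this
    simp only [map_sum, this, ← mul_assoc, hL.s_ox]
    simp only [← map_sum, ← TensorProduct.tmul_sum, ← Finset.sum_mul, ← hL.basic.ox_sum_left,
      P.snakeR_form]
    rfl
  rw [show H.comul (g.psiV P y) = _ from map_sum _ _ _]
  simp only [hm, mul_add, map_add, Finset.sum_add_distrib]
  rw [add_comm]
  congr 1
  · rw [← key]
    simp only [Finset.sum_mul_sum, Algebra.TensorProduct.tmul_mul_tmul, map_sum]
  · simp only [Finset.sum_mul, Algebra.TensorProduct.tmul_mul_tmul, mul_one, map_sum]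
    rw [Finset.sum_comm]
    simp only [← map_sum, ← TensorProduct.sum_tmul]
    rfl

theorem IsGhobadiLeft.toRight (hH : IsGhobadiLeft P g H) (hL : g.SatIL C P) (hb : h.Basic)
    (Φ : L ≃ₗ[ℂ] R) (h1 : Φ 1 = 1) (hm : ∀ X Y, Φ (X * Y) = Φ Y * Φ X)
    (hΦ : IsGhobadiPhi P g h Φ) : IsGhobadiRight P h (H.toRight Φ h1 hm) := by
  have hr := H.toRight_isReflexive Φ h1 hm
  have fs := hΦ.phi_s hL.basic hb
  have ft := hΦ.phi_t hL.basic hb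
  have fv : ∀ y, Φ (g.psiV P y) = h.v y := hΦ.phi_ox_v
  refine ⟨fun a => ?_, fun a => ?_, fun a => ?_, fun a => ?_, fun y => ?_, fun ω y => ?_,
    fun x ω => ?_, fun a => ?_, fun a => ?_, fun y => ?_, fun ω y => ?_, fun x ω => ?_⟩
  · rw [← hr.map_t, hH.t_eq, ft]
  · rw [← hr.map_s, hH.s_eq, fs]
  · rw [← ft, hr.map_comul _ _ (hH.comul_t a).symm]
    simp [h1]
  · rw [← fs, hr.map_comul _ _ (hH.comul_s a).symm]
    simp [h1]
  · rw [← fv, hr.map_comul _ _ (hH.comul_psiV hL y).symm]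
    simp [h1, fv, hΦ.phi_ox]
  · rw [← hΦ.phi_ox, hr.map_comul _ _ (hH.comul_ox ω y).symm]
    simp [hΦ.phi_ox]
  · rw [← hΦ.phi_xo, hr.map_comul _ _ (hH.comul_xo x ω).symm]
    simp [hΦ.phi_xo]
  · rw [← ft, hr.map_counit, hH.counit_t]
  · rw [← fs, hr.map_counit, hH.counit_s]
  · rw [← fv, hr.map_counit, Gens.psiV, map_sum]
    -- Each term vanishes, since ε(XY) depends on Y only through ε(Y), and fields have counit zero.
    refine Finset.sum_eq_zero fun i _ => ?_
    rw [H.counit_mul_s, hH.counit_v, map_zero, mul_zero, map_zero]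
  · rw [← hΦ.phi_ox, hr.map_counit, hH.counit_ox]
  · rw [← hΦ.phi_xo, hr.map_counit, hH.counit_xo]

variable {HR : RightBialgebroid A R}

theorem IsGhobadiRight.balanced_ox (hR : IsGhobadiRight P h HR) (hb : h.SatIR C P)
    (f : 𝔛 → R) (hadd : ∀ x y, f (x + y) = f x + f y)
    (hf : ∀ a y, f (op a • y) = f y * h.s a) (z : 𝔛) :
    IsBalanced A fun (y : 𝔛) (η : Ω) => HR.proj (f y ⊗ₜ[ℂ] h.ox η z) where
  add_left := by simp [hadd, TensorProduct.add_tmul]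
  add_right := by simp [hb.basic.ox_add_left, TensorProduct.tmul_add]
  smul a y η := by
    have := balSub_mkQ (rightActR HR.s) (rightActL HR.t) a (f y) (h.ox η z)
    rw [rightActR, rightActL, LinearMap.mulRight_apply, LinearMap.mulRight_apply, hR.s_eq,
      hR.t_eq, hb.ox_t, ← hf] at this
    exact this

theorem IsGhobadiRight.balanced_xo (hR : IsGhobadiRight P h HR) (hb : h.SatIR C P)
    (z : 𝔛) (ω : Ω) :
    IsBalanced A fun (η : Ω) (x : 𝔛) => HR.proj (h.xo z η ⊗ₜ[ℂ] h.xo x ω) where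
  add_left := by simp [hb.basic.xo_add_right, TensorProduct.add_tmul]
  add_right := by simp [hb.basic.xo_add_left, TensorProduct.tmul_add]
  smul a η x := by
    have := balSub_mkQ (rightActR HR.s) (rightActL HR.t) a (h.xo z η) (h.xo x ω)
    rw [rightActR, rightActL, LinearMap.mulRight_apply, LinearMap.mulRight_apply, hR.s_eq,
      hR.t_eq, hb.xo_t, hb.xo_s] at this
    exact this

/-- `flip (⊛ ⊗ ⊛)` -/
abbrev flipStar (st : L ≃ₛₗ[starRingEnd ℂ] R) : L ⊗[ℂ] L →ₛₗ[starRingEnd ℂ] R ⊗[ℂ] R :=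
  (TensorProduct.comm ℂ R R).toLinearMap.comp
    (TensorProduct.map st.toLinearMap st.toLinearMap)

theorem flipStar_mul {st : L ≃ₛₗ[starRingEnd ℂ] R} (hm : ∀ X Y, st (X * Y) = st Y * st X)
    (u v : L ⊗[ℂ] L) : flipStar st (u * v) = flipStar st v * flipStar st u := by
  induction u using TensorProduct.induction_on with
  | zero => simp
  | add x y hx hy => simp only [add_mul, mul_add, map_add, hx, hy]
  | tmul x y =>
    induction v using TensorProduct.induction_on with
    | zero => simp
    | add x y hx hy => simp only [add_mul, mul_add, map_add, hx, hy]
    | tmul x y => simp [hm]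

/-- Compatibility with coproducts is multiplicative, hence checked on generators, where starring a
coevaluation gives the other coevaluation with its factors exchanged, as the flip demands. The
counit is not multiplicative and needs a stronger induction. -/
theorem isStarRelated [StarModule ℂ A] (hH : IsGhobadiLeft P g H) (hR : IsGhobadiRight P h HR)
    (hL : g.SatIL C P) (hg : g.Generates) (hb : h.SatIR C P)
    (st : L ≃ₛₗ[starRingEnd ℂ] R) (h1 : st 1 = 1) (hm : ∀ X Y, st (X * Y) = st Y * st X)
    (hst : IsGhobadiStar P g h st) : IsStarRelated H HR st := by
  have ss : ∀ a, st (H.s a) = HR.s (star a) := fun a => by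
    rw [hH.s_eq, hR.s_eq, hst.star_s]
  have tt : ∀ a, st (H.t (op a)) = HR.t (op (star a)) := fun a => by
    rw [hH.t_eq, hR.t_eq, hst.star_t]
  have wd : ∀ u v, H.proj u = H.proj v → HR.proj (flipStar st u) = HR.proj (flipStar st v) :=
    fun u v huv => by
      refine (Submodule.Quotient.eq _).2 ?_
      rw [← map_sub]
      refine mem_balSub_map (flipStar st) (fun a m n => ?_) ((Submodule.Quotient.eq _).1 huv)
      rw [sub_mem_comm_iff]
      exact LeftBialgebroid.sub_mem_balSub (star a) (st n) (st m)
        (by simp [leftActR, leftActL, rightActR, rightActL, hm, ss])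
        (by simp [leftActR, leftActL, rightActR, rightActL, hm, tt])
  have hΔ : ∀ X, ∃ u, H.proj u = H.comul X ∧ HR.comul (st X) = HR.proj (flipStar st u) := by
    refine hg.induction hL.basic ?_ ?_ ?_ ?_ ?_ ?_ ?_
    · refine fun a => ⟨_, (hH.comul_s a).symm, ?_⟩
      rw [hst.star_s, hR.comul_s]
      simp [hst.star_s, h1]
    · refine fun a => ⟨_, (hH.comul_t a).symm, ?_⟩
      rw [hst.star_t, hR.comul_t]
      simp [hst.star_t, h1]
    · refine fun x => ⟨_, (hH.comul_v x).symm, ?_⟩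
      have := P.coevR_star C (hR.balanced_ox hb h.v hb.basic.v_add (fun a y => (hb.v_s a y).symm)
        (P.fieldStar x))
      rw [hst.star_v, hR.comul_v, map_add, map_sum, ← this]
      simp [hst.star_v, hst.star_xo, h1, -Submodule.mkQ_apply]
    · refine fun x ω => ⟨_, (hH.comul_xo x ω).symm, ?_⟩
      have := P.coevR_star C (hR.balanced_ox hb (h.ox (star ω)) (hb.basic.ox_add_right _)
        (fun a y => (hb.ox_s a _ y).symm) (P.fieldStar x))
      rw [hst.star_xo, hR.comul_ox, map_sum, ← this]
      simp [hst.star_xo]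
    · refine fun ω y => ⟨_, (hH.comul_ox ω y).symm, ?_⟩
      have := P.coevL_star C (hR.balanced_xo hb (P.fieldStarInv y) (star ω))
      rw [hst.star_ox, hR.comul_xo, map_sum, ← this]
      simp [hst.star_ox]
    · rintro X Y ⟨u, hu, hu'⟩ ⟨v, hv, hv'⟩
      exact ⟨u + v, by rw [map_add, map_add, hu, hv], by
        rw [map_add, map_add, map_add, map_add, hu', hv']⟩
    · rintro X Y ⟨u, hu, hu'⟩ ⟨v, hv, hv'⟩
      refine ⟨u * v, (H.comul_mul X Y u v hu hv).symm, ?_⟩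
      rw [hm, flipStar_mul hm]
      exact HR.comul_mul _ _ _ _ hv'.symm hu'.symm
  -- The induction statement says that left multiplication by X preserves the set of Y satisfying
  -- the counit identity; in this form it passes to products of the X.
  have hε : ∀ X, ∀ Y, HR.counit (st Y) = star (H.counit Y) →
      HR.counit (st (X * Y)) = star (H.counit (X * Y)) := by
    -- Since ε(XY) = ε(X s(ε(Y))), and mirror-wise in R, only source elements Y have to be tested.
    -- For generators X, the product with s(b) is then evaluated by the relations of the algebra or
    -- by the bimodule property of the counits.
    have red : ∀ X, (∀ b, HR.counit (st (X * g.s b)) = star (H.counit (X * g.s b))) →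
        ∀ Y, HR.counit (st Y) = star (H.counit Y) →
          HR.counit (st (X * Y)) = star (H.counit (X * Y)) := fun X hX Y hY => by
      rw [H.counit_mul_s, hH.s_eq, ← hX, hm, hm, HR.counit_mul_s, hY, hst.star_s, hR.s_eq]
    have es : ∀ a, HR.counit (st (g.s a)) = star (H.counit (g.s a)) := fun a => by
      rw [hst.star_s, hR.counit_s, hH.counit_s]
    have exo : ∀ x ω, HR.counit (st (g.xo x ω)) = star (H.counit (g.xo x ω)) := fun x ω => by
      rw [hst.star_xo, hR.counit_ox, hH.counit_xo, P.evR_fieldStar C, star_star]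
    have eox : ∀ ω y, HR.counit (st (g.ox ω y)) = star (H.counit (g.ox ω y)) := fun ω y => by
      rw [hst.star_ox, hR.counit_xo, hH.counit_ox, P.evL_fieldStarInv C, star_star]
    refine hg.induction hL.basic ?_ ?_ ?_ ?_ ?_ ?_ ?_
    · exact fun a => red _ fun b => by rw [← hL.basic.s_mul, es]
    · refine fun a => red _ fun b => ?_
      have e1 := H.counit_bimod b a 1
      have e2 := HR.counit_bimod (star a) (star b) 1
      rw [H.counit_one, mul_one, mul_one, H.s_t_comm, hH.s_eq, hH.t_eq] at e1
      rw [HR.counit_one, mul_one, one_mul, hR.s_eq, hR.t_eq] at e2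
      rw [hm, hst.star_s, hst.star_t, hb.basic.s_t, e1, e2, star_mul]
    · refine fun x => red _ fun b => ?_
      rw [hL.v_s, map_add, map_add, map_add, star_add, es, hst.star_v, hR.counit_v, hH.counit_v,
        star_zero]
    · exact fun x ω => red _ fun b => by rw [hL.xo_s, exo]
    · exact fun ω y => red _ fun b => by rw [hL.ox_s, eox]
    · intro X Z hX hZ Y hY
      rw [add_mul, map_add, map_add, map_add, star_add, hX Y hY, hZ Y hY]
    · intro X Z hX hZ Y hY
      rw [mul_assoc]
      exact hX _ (hZ Y hY)
  refine ⟨h1, hm, ss, tt, fun X u hu => ?_, fun X => ?_⟩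
  · obtain ⟨v, hv, hv'⟩ := hΔ X
    exact hv'.trans (wd v u (hv.trans hu.symm))
  · have := hε X 1 (by rw [h1, HR.counit_one, H.counit_one, star_one])
    rwa [mul_one] at this

end Ghobadi

/-! ### Compatibility of the maps on IL and IR with the quotient maps -/

section Descent

variable {A Ω 𝔛 : Type*} [Ring A] [Algebra ℂ A] [StarRing A]
  [AddCommGroup Ω] [Module ℂ Ω] [Module A Ω] [Module Aᵐᵒᵖ Ω] [StarAddMonoid Ω]
  [AddCommGroup 𝔛] [Module ℂ 𝔛] [Module A 𝔛] [Module Aᵐᵒᵖ 𝔛]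
  {C : StarFODC A Ω} {P : PivotalDual A Ω 𝔛}
  {L R L' R' : Type*} [Ring L] [Algebra ℂ L] [Ring R] [Algebra ℂ R] [Ring L'] [Algebra ℂ L']
  [Ring R'] [Algebra ℂ R'] {g : Gens A Ω 𝔛 L} {h : Gens A Ω 𝔛 R}

/-- Two antilinear anti-algebra maps `⊛` are compatible with algebra maps of generators. -/
theorem IsGhobadiStar.descends (hL : g.Basic) (hg : g.Generates) (p : L →ₐ[ℂ] L')
    (q : R →ₐ[ℂ] R') {st₀ : L ≃ₛₗ[starRingEnd ℂ] R} {st : L' ≃ₛₗ[starRingEnd ℂ] R'}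
    (hm₀ : ∀ X Y, st₀ (X * Y) = st₀ Y * st₀ X) (hm : ∀ X Y, st (X * Y) = st Y * st X)
    (h₀ : IsGhobadiStar P g h st₀) (h' : IsGhobadiStar P (g.map p) (h.map q) st) (X : L) :
    st (p X) = q (st₀ X) := by
  induction X using hg.induction hL with
  | s a => rw [h₀.star_s]; exact h'.star_s a
  | t a => rw [h₀.star_t]; exact h'.star_t a
  | v x => rw [h₀.star_v]; exact h'.star_v x
  | xo x ω => rw [h₀.star_xo]; exact h'.star_xo x ω
  | ox ω y => rw [h₀.star_ox]; exact h'.star_ox ω y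
  | add X Y hX hY => simp only [map_add, hX, hY]
  | mul X Y hX hY => rw [map_mul, hm, hm₀, map_mul, hX, hY]

/-- Two linear anti-algebra maps `Φ` are compatible with algebra maps of generators. -/
theorem IsGhobadiPhi.descends (hL : g.Basic) (hR : h.Basic) (hg : g.Generates) (p : L →ₐ[ℂ] L')
    (q : R →ₐ[ℂ] R') (hL' : (g.map p).Basic) (hR' : (h.map q).Basic)
    {Φ₀ : L ≃ₗ[ℂ] R} {Φ : L' ≃ₗ[ℂ] R'}
    (hm₀ : ∀ X Y, Φ₀ (X * Y) = Φ₀ Y * Φ₀ X) (hm : ∀ X Y, Φ (X * Y) = Φ Y * Φ X)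
    (h₀ : IsGhobadiPhi P g h Φ₀) (h' : IsGhobadiPhi P (g.map p) (h.map q) Φ) (X : L) :
    Φ (p X) = q (Φ₀ X) := by
  induction X using hg.induction hL with
  | s a => rw [h₀.phi_s hL hR]; exact h'.phi_s hL' hR' a
  | t a => rw [h₀.phi_t hL hR]; exact h'.phi_t hL' hR' a
  | v x =>
    rw [h₀.phi_v, map_sum]
    simp only [map_mul]
    exact h'.phi_v x
  | xo x ω => rw [h₀.phi_xo]; exact h'.phi_xo x ω
  | ox ω y => rw [h₀.phi_ox]; exact h'.phi_ox ω y
  | add X Y hX hY => simp only [map_add, hX, hY]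
  | mul X Y hX hY => rw [map_mul, hm, hm₀, map_mul, hX, hY]

end Descent

end

theorem proposition5p10 {A Ω 𝔛 : Type*}
    [Ring A] [Algebra ℂ A] [StarRing A] [StarModule ℂ A]
    [AddCommGroup Ω] [Module ℂ Ω] [Module A Ω] [Module Aᵐᵒᵖ Ω] [SMulCommClass A Aᵐᵒᵖ Ω]
    [IsScalarTower ℂ A Ω] [IsScalarTower ℂ Aᵐᵒᵖ Ω] [StarAddMonoid Ω] [StarModule ℂ Ω]
    [AddCommGroup 𝔛] [Module ℂ 𝔛] [Module A 𝔛] [Module Aᵐᵒᵖ 𝔛] [SMulCommClass A Aᵐᵒᵖ 𝔛]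
    [IsScalarTower ℂ A 𝔛] [IsScalarTower ℂ Aᵐᵒᵖ 𝔛]
    (C : StarFODC A Ω) (P : PivotalDual A Ω 𝔛)
    (hP : P.fieldStar = P.fieldStarInv) :
    ∃ (HL : LeftBialgebroid A (IIL C P)) (HR : RightBialgebroid A (IIR C P))
      (st : IIL C P ≃ₛₗ[starRingEnd ℂ] IIR C P) (Φ : IIL C P ≃ₗ[ℂ] IIR C P),
      IsGhobadiLeft P (IILGens C P) HL ∧
      IsGhobadiRight P (IIRGens C P) HR ∧
      IsStarHopfAlgebroidPair HL HR st Φ ∧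
      IsGhobadiStar P (IILGens C P) (IIRGens C P) st ∧
      IsGhobadiPhi P (IILGens C P) (IIRGens C P) Φ ∧
      (∃ (st₀ : IL C P ≃ₛₗ[starRingEnd ℂ] IR C P) (Φ₀ : IL C P ≃ₗ[ℂ] IR C P),
        (st₀ 1 = 1 ∧ ∀ X Y, st₀ (X * Y) = st₀ Y * st₀ X) ∧
        IsGhobadiStar P (ILGens C P) (IRGens C P) st₀ ∧
        (Φ₀ 1 = 1 ∧ ∀ X Y, Φ₀ (X * Y) = Φ₀ Y * Φ₀ X) ∧
        IsGhobadiPhi P (ILGens C P) (IRGens C P) Φ₀ ∧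
        (∀ X, st (ILProj C P X) = IRProj C P (st₀ X)) ∧
        (∀ X, Φ (ILProj C P X) = IRProj C P (Φ₀ X))) := by
  have hL₀ := ILGens_sat C P
  have hR₀ := IRGens_sat C P
  have hg₀ := ILGens_generates C P
  have hL := IILGens_satIL C P
  have hL' := IILGens_satIIL C P
  have hR := IIRGens_satIR C P
  have hR' := IIRGens_satIIR C P
  have hg := IILGens_generates C P
  obtain ⟨Φ₀, hΦm₀, hΦ₀⟩ := exists_phi hL₀ hR₀ hg₀ (IRGens_generates C P) _
    (IL.map_lift hR₀.phi) _ (IR.map_lift hL₀.psi)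
  obtain ⟨st₀, hstm₀, hst₀, -⟩ := exists_star hL₀ hR₀ hg₀ _ (IL.map_lift hR₀.star) Φ₀ hΦm₀.2 hΦ₀
  obtain ⟨Φ, ⟨hΦ1, hΦm⟩, hΦ⟩ := exists_phi hL hR hg (IIRGens_generates C P) _
    (IIL.map_lift hR.phi hR'.phi) _ (IIR.map_lift hL.psi hL'.psi)
  -- The only point at which compatibility of the pivotal structure with * enters: without it ⊛ is
  -- available from IL to IR, but this argument does not pass it to the quotients.
  obtain ⟨st, ⟨hst1, hstm⟩, hst, hcompat⟩ := exists_star hL hR hg _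
    (IIL.map_lift hR.star (Gens.SatIIR.star hR hR' hP)) Φ hΦm hΦ
  obtain ⟨H, hH⟩ := exists_leftBialgebroid hL hg _
    (IIL.map_lift hL.satIL_deltaAct (hL.satIIL_deltaAct hL')) _
    (IIL.map_lift Gens.satIL_eval Gens.satIIL_eval)
  -- The right bialgebroid is defined by transport along Φ; this confirms that its values on
  -- generators are the prescribed ones.
  have hHR := hH.toRight hL hR.basic Φ hΦ1 hΦm hΦ
  have hrel := isStarRelated hH hHR hL hg hR st hst1 hstm hst
  have hopf := hH.isLeftHopf hL hL' hg _
    (IIL.map_lift (hL.satIL_gammaAct hL') (hL.satIIL_gammaAct hL'))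
  -- One Hopf condition has been proved by construction; the other three follow by symmetry, this
  -- one through Φ⁻¹ ∘ ⊛ and the two right-handed ones through Φ.
  have anti := hopf.isAntiLeftHopf hrel
  exact ⟨H, H.toRight Φ hΦ1 hΦm, st, Φ, hH, hHR,
    { star_related := hrel
      reflexive := H.toRight_isReflexive Φ hΦ1 hΦm
      compat := hcompat
      left_hopf := hopf
      anti_left_hopf := anti
      right_hopf := anti.toRight H Φ hΦ1 hΦm
      anti_right_hopf := hopf.toRight H Φ hΦ1 hΦm }, hst, hΦ, st₀, Φ₀, hstm₀, hst₀, hΦm₀, hΦ₀,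
    hst₀.descends hL₀.basic hg₀ _ _ hstm₀.2 hstm hst,
    hΦ₀.descends hL₀.basic hR₀.basic hg₀ _ _ hL.basic hR.basic hΦm₀.2 hΦm hΦ⟩
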